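/- **Setting.** Let $F_1,\dots,F_m$ be Borel probability distributions on Polish spaces, with supports $\Xi_1,\dots,\Xi_m$, and let $X_{i,j}$ ($i\le m$, $j\ge 1$) be independent with $X_{i,j}\sim F_i$. For data sizes $n_1,\dots,n_m$ let $n=\frac1m\sum_i n_i$ and let $\widehat F_i$ be the empirical distribution of $X_{i,1},\dots,X_{i,n_i}$. For resample sizes $s_1,\dots,s_m$ let $s=\frac1m\sum_i s_i$ and let $\widehat F^*_{s_i,i}$ be the empirical distribution of $s_i$ points drawn uniformly with replacement from $X_{i,1},\dots,X_{i,n_i}$, independently over $i$; $\mathbb E_*$ denotes expectation over the resampling, given the data. All $n_i\to\infty$ with $\max_i n_i/\min_i n_i$ bounded, and all $s_i\to\infty$ with $\max_i s_i/\min_i s_i$ bounded (for instance $s_i=\lfloor\theta n_i\rfloor$ with $0<\theta\le1$, $\theta n\to\infty$). Let $T_1,\dots,T_m$ be fixed integers and $h$ a real measurable function. For distributions $P_1,\dots,P_m$ let $\mathbf X_i=(X_i(1),\dots,X_i(T_i))$ consist of i.i.d. variables with distribution $P_i$, independent over $i$, and put $$\psi(P_1,\dots,P_m)=\mathbb E_{P_1,\dots,P_m}[h(\mathbf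 X_1,\dots,\mathbf X_m)],\qquad g_i(P_1,\dots,P_m;x)=\sum_{t=1}^{T_i}\mathbb E_{P_1,\dots,P_m}[h(\mathbf X_1,\dots,\mathbf X_m)\mid X_i(t)=x]-T_i\,\psi(P_1,\dots,P_m),$$ where the conditional expectation is the expectation with the coordinate $X_i(t)$ frozen at $x$. Let $\tau^2(P_1,\dots,P_m)$ and $\mu_4(P_1,\dots,P_m)$ be the variance and the fourth central moment of $h(\mathbf X_1,\dots,\mathbf X_m)$ under $P_1,\dots,P_m$. Write $g_i=g_i(F_1,\dots,F_m;\cdot)$ and $\hat g_i=g_i(\widehat F_1,\dots,\widehat F_m;\cdot)$. Let $\mathcal P_i$ be the convex hull of $F_i$ and all Dirac measures at points of $\Xi_i$. **Theorem.** Suppose that for each $i$ $$0<\mathrm{Var}_{F_i}\Big[\sum_{t=1}^{T_i}\mathbb E_{F_1,\dots,F_m}[h(\mathbf X_1,\dots,\mathbf X_m)\mid X_i(t)=X_i]\Big]<\infty,$$ and that $\mathbb E_{F_1,\dots,F_m}[|h(\mathbf X_{1,I_1},\dots,\mathbf X_{m,I_m})|^4]<\infty$ for all index sequences $I_i=(I_i(1),\dots,I_i(T_i))$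 with $1\le I_i(t)\le t$, where $\mathbf X_{i,I_i}=(X_i(I_i(1)),\dots,X_i(I_i(T_i)))$. Then: 1. (First order differentiability.) Provided $\psi$ is well defined on $\prod_i\mathcal P_i$, i.e. $h$ is integrable under all $(P_1,\dots,P_m)\in\prod_i\mathcal P_i$: for all $P_i,Q_i\in\mathcal P_i$ the function $g_i(P_1,\dots,P_m;\cdot)$ is integrable under $P_i$ and $Q_i$, $\mathbb E_{P_i}[g_i(P_1,\dots,P_m;X_i)]=0$, and as $(\nu_1,\dots,\nu_m)\in[0,1]^m$ tends to zero, with $P_i^{\nu_i}=(1-\nu_i)P_i+\nu_iQ_i$, $$\psi(P_1^{\nu_1},\dots,P_m^{\nu_m})-\psi(P_1,\dots,P_m)=\sum_{i=1}^m\nu_i\int g_i(P_1,\dots,P_m;x)\,d(Q_i-P_i)(x)+o\Big(\sqrt{\textstyle\sum_i\nu_i^2}\Big).$$ 2. (Smoothness at the true input models.) The remainder $\epsilon=\psi(\widehat F_1,\dots,\widehat F_m)-\psi(F_1,\dots,F_m)-\sum_i\int g_i\,d(\widehat F_i-F_i)$ satisfies $\mathbb E[\epsilon^2]=o(n^{-1})$,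 and $\mathrm{Var}_{F_i}[g_i(X_i)]>0$, $\mathbb E_{F_i}[g_i^4(X_i)]<\infty$ for each $i$. 3. (Smoothness at the empirical input models.) $\mathbb E[(\hat g_i-g_i)^4(X_{i,1})]\to0$ for each $i$, and for every $(\overline F_1,\dots,\overline F_m)\in\prod_i\{\widehat F_i,\widehat F^*_{s_i,i}\}$ the remainder $\epsilon^*=\psi(\overline F_1,\dots,\overline F_m)-\psi(\widehat F_1,\dots,\widehat F_m)-\sum_i\int\hat g_i\,d(\overline F_i-\widehat F_i)$ satisfies $\mathbb E_*[(\epsilon^*)^4]=o_p(s^{-2})$. 4. (Convergence of the empirical variance.) $\tau^2(\widehat F_1,\dots,\widehat F_m)\to\tau^2(F_1,\dots,F_m)$ in probability. 5. (Convergence of the bootstrapped variance.) $\mathbb E_*[(\tau^2(\overline F_1,\dots,\overline F_m)-\tau^2(\widehat F_1,\dots,\widehat F_m))^2]=o_p(1)$ for every $(\overline F_1,\dots,\overline F_m)$ as in 3. 6. (Boundedness of the fourth moment.) $\mathbb E_*[\mu_4(\overline F_1,\dots,\overline F_m)]=O_p(1)$ for every $(\overline F_1,\dots,\overline F_m)$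 as in 3. -/

import Mathlib

open MeasureTheory ProbabilityTheory Filter Topology Asymptotics
open scoped ENNReal NNReal

namespace InputUncertainty

noncomputable section

/-! ### Input laws, empirical laws, data -/

/-- The joint law of `m` independent samples, the `i`-th one consisting of `T i` i.i.d. draws
from `P i`. -/
def inputLaw {m : ℕ} {S : Fin m → Type*} [∀ i, MeasurableSpace (S i)] (T : Fin m → ℕ)
    (P : ∀ i, Measure (S i)) : Measure (∀ i, Fin (T i) → S i) :=
  Measure.pi fun i => Measure.pi fun _ : Fin (T i) => P i

/-- The empirical distribution of a sample `x` of size `k`. -/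
def empirical {S : Type*} [MeasurableSpace S] {k : ℕ} (x : Fin k → S) : Measure S :=
  (k : ℝ≥0∞)⁻¹ • ∑ j, Measure.dirac (x j)

/-- The convex hull of `F` and all Dirac measures at points of the support of `F`. -/
def hullWithDiracs {S : Type*} [TopologicalSpace S] [MeasurableSpace S] (F : Measure S) :
    Set (Measure S) :=
  {P | ∃ (l : ℕ) (w₀ : ℝ≥0) (w : Fin l → ℝ≥0) (x : Fin l → S),
    (∀ k, x k ∈ F.support) ∧ w₀ + ∑ k, w k = 1 ∧
      P = w₀ • F + ∑ k, w k • Measure.dirac (x k)}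

/-- The mixture `(1 - v) P + v Q`, for `v ∈ [0, 1]`. -/
def mix {S : Type*} [MeasurableSpace S] (P Q : Measure S) (v : ℝ) : Measure S :=
  ENNReal.ofReal (1 - v) • P + ENNReal.ofReal v • Q

/-- The data: `X i j` is the `j`-th data point of the `i`-th input model (counted from `0`).
All data points are independent, and `X i j` has law `F i`. -/
structure IsInputData {m : ℕ} {S : Fin m → Type*} [∀ i, MeasurableSpace (S i)]
    {Ω : Type*} [MeasurableSpace Ω] (μ : Measure Ω) (F : ∀ i, Measure (S i))
    (X : ∀ i, ℕ → Ω → S i) : Prop where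
  measurable : ∀ i j, Measurable (X i j)
  law : ∀ i j, μ.map (X i j) = F i
  indep : iIndepFun (fun p : (Σ _ : Fin m, ℕ) => X p.1 p.2) μ

/-- The empirical input models computed from the first `n i` data points of each model. -/
def empiricalInputs {m : ℕ} {S : Fin m → Type*} [∀ i, MeasurableSpace (S i)] {Ω : Type*}
    (X : ∀ i, ℕ → Ω → S i) (n : Fin m → ℕ) (ω : Ω) : ∀ i, Measure (S i) :=
  fun i => empirical fun j : Fin (n i) => X i j ω

/-- The resampling expectation `E_*`, conditional on the data: for every `i`, a sample
`x i` of size `s i` is drawn with replacement from the `i`-th distribution `Phat i`,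
independently over `i`. (For empirical `Phat` this law has finite support, so the integral is
a finite average.) -/
def resampleExp {m : ℕ} {S : Fin m → Type*} [∀ i, MeasurableSpace (S i)]
    (s : Fin m → ℕ) (Phat : ∀ i, Measure (S i)) (φ : (∀ i, Fin (s i) → S i) → ℝ) : ℝ :=
  ∫ x, φ x ∂(inputLaw s Phat)

/-- The input models that are resampled for `i ∈ A` and left at `Phat i` for `i ∉ A`. -/
def partialResample {m : ℕ} {S : Fin m → Type*} [∀ i, MeasurableSpace (S i)]
    {s : Fin m → ℕ} (A : Finset (Fin m)) (Phat : ∀ i, Measure (S i))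
    (x : ∀ i, Fin (s i) → S i) : ∀ i, Measure (S i) :=
  fun i => if i ∈ A then empirical (x i) else Phat i

/-! ### Sizes and stochastic orders -/

/-- All sizes tend to infinity, and they are of comparable magnitude. -/
def Balanced {m : ℕ} (n : ℕ → Fin m → ℕ) : Prop :=
  (∀ i, Tendsto (fun N => n N i) atTop atTop) ∧
    ∃ c : ℝ, 0 < c ∧ ∀ᶠ N in atTop, ∀ i j, (n N i : ℝ) ≤ c * n N j

/-- The average size. -/
def avgSize {m : ℕ} (n : Fin m → ℕ) : ℝ := (∑ i, (n i : ℝ)) / m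

/-- `A N = o_p(b N)`. -/
def IsLittleOP {Ω : Type*} [MeasurableSpace Ω] (μ : Measure Ω) (A : ℕ → Ω → ℝ) (b : ℕ → ℝ) :
    Prop :=
  TendstoInMeasure μ (fun N ω => A N ω / b N) atTop (fun _ => 0)

/-- `A N = O_p(1)`. -/
def IsBigOPOne {Ω : Type*} [MeasurableSpace Ω] (μ : Measure Ω) (A : ℕ → Ω → ℝ) : Prop :=
  ∀ ε : ℝ, 0 < ε → ∃ M : ℝ, 0 < M ∧ ∀ᶠ N in atTop, 1 - ε < μ.real {ω | |A N ω| ≤ M}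

/-! ### Regularity properties of a performance measure

Here `ψ` is a functional of the tuple of input distributions, and `g P i` is the `i`-th
influence function at the tuple `P`. -/

/-- The remainder of the first order expansion of `ψ` around `P`, evaluated at `Q`. -/
def remainder {m : ℕ} {S : Fin m → Type*} [∀ i, MeasurableSpace (S i)]
    (ψ : (∀ i, Measure (S i)) → ℝ) (g : (∀ i, Measure (S i)) → ∀ i, S i → ℝ)
    (P Q : ∀ i, Measure (S i)) : ℝ :=
  ψ Q - ψ P - ∑ i, ((∫ x, g P i x ∂(Q i)) - ∫ x, g P i x ∂(P i))

/-- First order Gateaux differentiability of `ψ`, with influence functions `g`, on the product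
of the convex hulls of the `F i` and the Dirac measures on their supports. -/
def FirstOrderDifferentiable {m : ℕ} {S : Fin m → Type*} [∀ i, TopologicalSpace (S i)]
    [∀ i, MeasurableSpace (S i)] (F : ∀ i, Measure (S i))
    (ψ : (∀ i, Measure (S i)) → ℝ) (g : (∀ i, Measure (S i)) → ∀ i, S i → ℝ) : Prop :=
  ∀ P Q : ∀ i, Measure (S i),
    (∀ i, P i ∈ hullWithDiracs (F i)) → (∀ i, Q i ∈ hullWithDiracs (F i)) →
    (∀ i, Integrable (g P i) (P i) ∧ Integrable (g P i) (Q i) ∧ ∫ x, g P i x ∂(P i) = 0) ∧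
    (fun v : Fin m → ℝ =>
        ψ (fun i => mix (P i) (Q i) (v i)) - ψ P
          - ∑ i, v i * ((∫ x, g P i x ∂(Q i)) - ∫ x, g P i x ∂(P i)))
      =o[𝓝[Set.Icc 0 1] 0] fun v => Real.sqrt (∑ i, v i ^ 2)

/-- Smoothness at the true input models: the remainder of the expansion of the plug-in
estimator has second moment `o(1/n)`, and the influence functions at the truth are
non-degenerate with finite fourth moments. -/
def SmoothAtTruth {m : ℕ} {S : Fin m → Type*} [∀ i, MeasurableSpace (S i)]
    {Ω : Type*} [MeasurableSpace Ω] (μ : Measure Ω) (F : ∀ i, Measure (S i))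
    (X : ∀ i, ℕ → Ω → S i) (n : ℕ → Fin m → ℕ)
    (ψ : (∀ i, Measure (S i)) → ℝ) (g : (∀ i, Measure (S i)) → ∀ i, S i → ℝ) : Prop :=
  (∀ᶠ N in atTop, Integrable (fun ω => remainder ψ g F (empiricalInputs X (n N) ω) ^ 2) μ) ∧
  ((fun N => ∫ ω, remainder ψ g F (empiricalInputs X (n N) ω) ^ 2 ∂μ)
    =o[atTop] fun N => (avgSize (n N))⁻¹) ∧
  ∀ i, 0 < variance (g F i) (F i) ∧ MemLp (g F i) 4 (F i)

/-- Smoothness at the empirical input models: the empirical influence functions converge in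
fourth mean, and for every choice of the models that are resampled the remainder has
conditional fourth moment `o_p(s⁻²)`. -/
def SmoothAtEmpirical {m : ℕ} {S : Fin m → Type*} [∀ i, MeasurableSpace (S i)]
    {Ω : Type*} [MeasurableSpace Ω] (μ : Measure Ω) (F : ∀ i, Measure (S i))
    (X : ∀ i, ℕ → Ω → S i) (n s : ℕ → Fin m → ℕ)
    (ψ : (∀ i, Measure (S i)) → ℝ) (g : (∀ i, Measure (S i)) → ∀ i, S i → ℝ) : Prop :=
  (∀ i,
    (∀ᶠ N in atTop, Integrable
      (fun ω => (g (empiricalInputs X (n N) ω) i (X i 0 ω) - g F i (X i 0 ω)) ^ 4) μ) ∧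
    Tendsto
      (fun N => ∫ ω, (g (empiricalInputs X (n N) ω) i (X i 0 ω) - g F i (X i 0 ω)) ^ 4 ∂μ)
      atTop (𝓝 0)) ∧
  ∀ A : Finset (Fin m),
    IsLittleOP μ
      (fun N ω => resampleExp (s N) (empiricalInputs X (n N) ω) fun x =>
        remainder ψ g (empiricalInputs X (n N) ω)
          (partialResample A (empiricalInputs X (n N) ω) x) ^ 4)
      (fun N => (avgSize (s N) ^ 2)⁻¹)

/-- The simulation variance at the empirical models converges in probability to the one at the
true models. -/
def EmpiricalVarianceConverges {m : ℕ} {S : Fin m → Type*} [∀ i, MeasurableSpace (S i)]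
    {Ω : Type*} [MeasurableSpace Ω] (μ : Measure Ω) (F : ∀ i, Measure (S i))
    (X : ∀ i, ℕ → Ω → S i) (n : ℕ → Fin m → ℕ) (τsq : (∀ i, Measure (S i)) → ℝ) : Prop :=
  TendstoInMeasure μ (fun N ω => τsq (empiricalInputs X (n N) ω)) atTop (fun _ => τsq F)

/-- The simulation variance at the (partially) resampled models is close, in conditional mean
square, to the one at the empirical models. -/
def BootstrapVarianceConverges {m : ℕ} {S : Fin m → Type*} [∀ i, MeasurableSpace (S i)]
    {Ω : Type*} [MeasurableSpace Ω] (μ : Measure Ω)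
    (X : ∀ i, ℕ → Ω → S i) (n s : ℕ → Fin m → ℕ) (τsq : (∀ i, Measure (S i)) → ℝ) : Prop :=
  ∀ A : Finset (Fin m),
    IsLittleOP μ
      (fun N ω => resampleExp (s N) (empiricalInputs X (n N) ω) fun x =>
        (τsq (partialResample A (empiricalInputs X (n N) ω) x)
          - τsq (empiricalInputs X (n N) ω)) ^ 2)
      (fun _ => 1)

/-- The conditional expectation of the fourth central moment of the simulation output at the
(partially) resampled models is bounded in probability. -/
def FourthMomentBounded {m : ℕ} {S : Fin m → Type*} [∀ i, MeasurableSpace (S i)]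
    {Ω : Type*} [MeasurableSpace Ω] (μ : Measure Ω)
    (X : ∀ i, ℕ → Ω → S i) (n s : ℕ → Fin m → ℕ) (μ₄ : (∀ i, Measure (S i)) → ℝ) : Prop :=
  ∀ A : Finset (Fin m),
    IsBigOPOne μ
      (fun N ω => resampleExp (s N) (empiricalInputs X (n N) ω) fun x =>
        μ₄ (partialResample A (empiricalInputs X (n N) ω) x))

/-! ### Finite-horizon performance measures -/

/-- The performance measure `ψ(P) = E_P[h(X₁, …, X_m)]`, where `X_i` consists of `T i` i.i.d.
variables with distribution `P i`. -/
def perf {m : ℕ} {S : Fin m → Type*} [∀ i, MeasurableSpace (S i)] (T : Fin m → ℕ)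
    (h : (∀ i, Fin (T i) → S i) → ℝ) (P : ∀ i, Measure (S i)) : ℝ :=
  ∫ x, h x ∂(inputLaw T P)

/-- The variance of the simulation replication `h(X₁, …, X_m)` driven by `P`. -/
def simVariance {m : ℕ} {S : Fin m → Type*} [∀ i, MeasurableSpace (S i)] (T : Fin m → ℕ)
    (h : (∀ i, Fin (T i) → S i) → ℝ) (P : ∀ i, Measure (S i)) : ℝ :=
  ∫ x, (h x - perf T h P) ^ 2 ∂(inputLaw T P)

/-- The fourth central moment of the simulation replication driven by `P`. -/
def simFourthMoment {m : ℕ} {S : Fin m → Type*} [∀ i, MeasurableSpace (S i)] (T : Fin m → ℕ)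
    (h : (∀ i, Fin (T i) → S i) → ℝ) (P : ∀ i, Measure (S i)) : ℝ :=
  ∫ x, (h x - perf T h P) ^ 4 ∂(inputLaw T P)

/-- `E_P[h(X₁, …, X_m) | X_i(t) = z]`: as all coordinates are independent, this is the
expectation of `h` with the coordinate `(i, t)` frozen at `z`. -/
def condMean {m : ℕ} {S : Fin m → Type*} [∀ i, MeasurableSpace (S i)] (T : Fin m → ℕ)
    (h : (∀ i, Fin (T i) → S i) → ℝ) (P : ∀ i, Measure (S i)) (i : Fin m) (t : Fin (T i))
    (z : S i) : ℝ :=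
  ∫ x, h (Function.update x i (Function.update (x i) t z)) ∂(inputLaw T P)

/-- The influence functions of the finite-horizon performance measure:
`g_i(P; z) = ∑_t E_P[h | X_i(t) = z] - T_i ψ(P)`. -/
def influence {m : ℕ} {S : Fin m → Type*} [∀ i, MeasurableSpace (S i)] (T : Fin m → ℕ)
    (h : (∀ i, Fin (T i) → S i) → ℝ) (P : ∀ i, Measure (S i)) (i : Fin m) (z : S i) : ℝ :=
  (∑ t, condMean T h P i t z) - T i * perf T h P

/-- For every `i`, the variance under `F i` of `∑_t E_F[h | X_i(t) = X_i]` is positive and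
finite. -/
def NondegenerateInfluence {m : ℕ} {S : Fin m → Type*} [∀ i, MeasurableSpace (S i)]
    (T : Fin m → ℕ) (h : (∀ i, Fin (T i) → S i) → ℝ) (F : ∀ i, Measure (S i)) : Prop :=
  ∀ i, 0 < evariance (fun z => ∑ t, condMean T h F i t z) (F i) ∧
    evariance (fun z => ∑ t, condMean T h F i t z) (F i) < ⊤

/-- Finite `k`-th absolute moments of `h` along all index patterns `I` with `I i t ≤ t`, in
which the `t`-th argument of the `i`-th process is replaced by the `I i t`-th one. -/
def FiniteMoments {m : ℕ} {S : Fin m → Type*} [∀ i, MeasurableSpace (S i)]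
    (T : Fin m → ℕ) (h : (∀ i, Fin (T i) → S i) → ℝ) (F : ∀ i, Measure (S i)) (k : ℕ) : Prop :=
  ∀ I : ∀ i, Fin (T i) → Fin (T i), (∀ i t, I i t ≤ t) →
    Integrable (fun x => |h (fun i t => x i (I i t))| ^ k) (inputLaw T F)

/-- The expectation defining the finite-horizon performance measure exists at every tuple of
distributions in the product of the convex hulls. -/
def PerfWellDefined {m : ℕ} {S : Fin m → Type*} [∀ i, TopologicalSpace (S i)]
    [∀ i, MeasurableSpace (S i)] (T : Fin m → ℕ) (h : (∀ i, Fin (T i) → S i) → ℝ)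
    (F : ∀ i, Measure (S i)) : Prop :=
  ∀ P : ∀ i, Measure (S i), (∀ i, P i ∈ hullWithDiracs (F i)) → Integrable h (inputLaw T P)

end

end InputUncertainty

open InputUncertainty

/-! Statements 2 to 6 rest on a Hoeffding-type decomposition of the plug-in estimator, seen as a
V-statistic. Averaging `h` over a product of empirical laws is averaging `h` over all index maps
`J`, which send each coordinate `(i, t)` to a data point. For a set `B` of coordinates,
`interaction` is the Möbius transform, over `C ⊆ B`, of the mean of `h` with the coordinates in `C`
frozen at the selected data. By Möbius inversion the error of the plug-in estimator is the sum over
nonempty `B` of the index averages of the interactions. The singletons give exactly the integrals of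
the influence functions, so the remainder is the sum over `2 ≤ B.card` (`perf_partialResample_sub`,
`remainder_partialResample`).

For even `r`, the `r`-th moment of an index average is a normalised sum over `r`-tuples of index
maps. Interactions at colliding indices need not be centred, but a tuple contributes nothing as soon
as some data point is selected by a single slot in `B`. To see this, frozen means are written as
conditional means over independent ghost data. Exchanging that data point with its ghost preserves
the law and flips the sign of the product (`integral_prod_ghostInteraction_eq_zero`); Jensen's
inequality removes the ghosts again. In the surviving tuples half of the slots in `B` are determined
by the others, so their proportion is `O(L⁻ᵈ)` when `2 d ≤ r |B|` and all samples have size at least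
`L` (`pow_mul_card_allMatched_le`). The `r`-th moment of the remainder is therefore `O(L⁻ʳ)`, that
of the estimation error `O(L⁻¹)`. The assumed moments suffice because the law of the selected
arguments depends only on the collision pattern of the index map (`exists_pattern`).

These bounds are non-asymptotic and hold for all probability laws `P` with finite pattern moments,
on which they depend only through `patternMoment`. They apply to `F`, and conditionally on the data
to the empirical laws, whose `patternMoment` is bounded in mean; Markov's inequality yields the
statements in probability. Variances are reduced to the plug-in bounds for `h` and `h²`, and
empirical influence functions to index averages with one index held fixed (`setIndex`).

Statement 1 is algebraic: along a mixture, `ψ` is a polynomial in the mixing weights whose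
coefficients are Möbius transforms, and its terms with `2 ≤ B.card` are negligible. -/

namespace InputUncertainty

/-! ### Nested product measures -/

/-- A measure on a nested product is determined by its values on boxes. -/
theorem pi_pi_eq_of_boxes {ι : Type*} [Fintype ι] {κ : ι → Type*} [∀ i, Fintype (κ i)]
    {S : ι → Type*} [∀ i, MeasurableSpace (S i)] (R : ∀ i, κ i → Measure (S i))
    [∀ i k, SigmaFinite (R i k)] {ν : Measure (∀ i, κ i → S i)}
    (hν : ∀ s : ∀ i, κ i → Set (S i), (∀ i k, MeasurableSet (s i k)) →
      ν {y | ∀ i k, y i k ∈ s i k} = ∏ i, ∏ k, R i k (s i k)) :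
    ν = Measure.pi fun i => Measure.pi (R i) := by
  -- Uncurrying turns the nested product into one product over the sigma type, where boxes determine
  -- the measure.
  have key : ∀ ρ : Measure (∀ i, κ i → S i),
      (∀ s : ∀ i, κ i → Set (S i), (∀ i k, MeasurableSet (s i k)) →
        ρ {y | ∀ i k, y i k ∈ s i k} = ∏ i, ∏ k, R i k (s i k)) →
      ρ.map (MeasurableEquiv.piCurry fun i (_ : κ i) => S i).symm =
        Measure.pi fun p : Σ i, κ i => R p.1 p.2 := by
    intro ρ hρ
    refine (Measure.pi_eq fun s hs => ?_).symm
    rw [MeasurableEquiv.map_apply, Fintype.prod_sigma]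
    rw [← hρ (fun i k => s ⟨i, k⟩) (fun i k => hs _)]
    congr 1
    ext y
    simp only [Set.mem_preimage, Set.mem_pi, Set.mem_univ, true_imp_iff, Set.mem_ofPred_eq,
      Sigma.forall]
    rfl
  refine (MeasurableEquiv.piCurry fun i (_ : κ i) => S i).symm.map_measurableEquiv_injective ?_
  rw [key ν hν, key]
  intro s hs
  have : {y : ∀ i, κ i → S i | ∀ i k, y i k ∈ s i k} =
      Set.univ.pi fun i => Set.univ.pi fun k => s i k := by
    ext y; simp [Set.mem_pi]
  rw [this, Measure.pi_pi]
  simp_rw [Measure.pi_pi]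

/-- The product of finite mixtures is the mixture of the products. -/
theorem pi_sum_smul {ι : Type*} [Fintype ι] [DecidableEq ι] {S : ι → Type*}
    [∀ i, MeasurableSpace (S i)]
    {α : ι → Type*} [∀ i, Fintype (α i)] (w : ∀ i, α i → ℝ≥0∞) (M : ∀ i, α i → Measure (S i))
    (hw : ∀ i a, w i a ≠ ∞) [∀ i a, IsFiniteMeasure (M i a)] :
    Measure.pi (fun i => ∑ a, w i a • M i a) =
      ∑ f : ∀ i, α i, (∏ i, w i (f i)) • Measure.pi fun i => M i (f i) := by
  have : ∀ i, IsFiniteMeasure (∑ a, w i a • M i a) := fun i => by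
    have : ∀ a, IsFiniteMeasure (w i a • M i a) := fun a => Measure.smul_finite _ (hw i a)
    infer_instance
  refine Measure.pi_eq fun s hs => ?_
  simp only [Measure.coe_finsetSum, Finset.sum_apply, Measure.smul_apply, smul_eq_mul,
    Measure.pi_pi]
  rw [Finset.prod_univ_sum, Fintype.piFinset_univ]
  simp_rw [Finset.prod_mul_distrib]

/-- The law of a subfamily of independent coordinates. -/
theorem pi_map_comp_injective {ι κ : Type*} [Fintype ι] [Fintype κ] {S : Type*}
    [MeasurableSpace S] (P : Measure S) [IsProbabilityMeasure P] {e : κ → ι}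
    (he : Function.Injective e) :
    (Measure.pi fun _ : ι => P).map (fun y k => y (e k)) = Measure.pi fun _ : κ => P := by
  have h := (iIndepFun_pi (μ := fun _ : ι => P) (X := fun _ => id)
    (fun _ => aemeasurable_id)).precomp he
  rw [iIndepFun_iff_map_fun_eq_pi_map (fun i => by simpa using (measurable_pi_apply _).aemeasurable)] at h
  simp only [id] at h
  rw [h]
  congr 1; ext1 k
  exact (measurePreserving_eval (fun _ : ι => P) (e k)).map_eq

/-! ### Joint laws of independent samples: relabelling, joining, blending -/

variable {m : ℕ} {S : Fin m → Type*} [∀ i, MeasurableSpace (S i)]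

/-- The joint law of independent families, the `i`-th one consisting of i.i.d. draws from `P i`
indexed by `κ i`. -/
noncomputable def sampleLaw (κ : Fin m → Type*) [∀ i, Fintype (κ i)] (P : ∀ i, Measure (S i)) :
    Measure (∀ i, κ i → S i) :=
  Measure.pi fun i => Measure.pi fun _ : κ i => P i

instance (κ : Fin m → Type*) [∀ i, Fintype (κ i)] (P : ∀ i, Measure (S i))
    [∀ i, IsProbabilityMeasure (P i)] : IsProbabilityMeasure (sampleLaw κ P) := by
  unfold sampleLaw; infer_instance

instance (T : Fin m → ℕ) (P : ∀ i, Measure (S i))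
    [∀ i, IsProbabilityMeasure (P i)] : IsProbabilityMeasure (inputLaw T P) := by
  unfold inputLaw; infer_instance

/-- Relabelling a sample injectively within each family does not change its law. -/
theorem measurePreserving_relabel {κ β : Fin m → Type*} [∀ i, Fintype (κ i)]
    [∀ i, Fintype (β i)] (P : ∀ i, Measure (S i)) [∀ i, IsProbabilityMeasure (P i)]
    (e : ∀ i, κ i → β i) (he : ∀ i, Function.Injective (e i)) :
    MeasurePreserving (fun (y : ∀ i, β i → S i) i k => y i (e i k))
      (sampleLaw β P) (sampleLaw κ P) := by
  refine measurePreserving_pi _ _ fun i => ⟨by fun_prop, pi_map_comp_injective (P i) (he i)⟩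

/-- The concatenation of two independent samples. -/
def joinSample {κ β : Fin m → Type*} (q : (∀ i, κ i → S i) × (∀ i, β i → S i)) :
    ∀ i, κ i ⊕ β i → S i := fun i => Sum.elim (q.1 i) (q.2 i)

theorem measurePreserving_joinSample {κ β : Fin m → Type*} [∀ i, Fintype (κ i)]
    [∀ i, Fintype (β i)] (P : ∀ i, Measure (S i)) [∀ i, IsProbabilityMeasure (P i)] :
    MeasurePreserving (joinSample (S := S) (κ := κ) (β := β))
      ((sampleLaw κ P).prod (sampleLaw β P)) (sampleLaw (fun i => κ i ⊕ β i) P) := by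
  have hm : Measurable (joinSample (S := S) (κ := κ) (β := β)) := by
    refine measurable_pi_lambda _ fun i => measurable_pi_lambda _ fun k => ?_
    rcases k with k | k
    · exact (measurable_pi_apply k).comp ((measurable_pi_apply i).comp measurable_fst)
    · exact (measurable_pi_apply k).comp ((measurable_pi_apply i).comp measurable_snd)
  refine ⟨hm, pi_pi_eq_of_boxes (fun i (_ : κ i ⊕ β i) => P i) fun s hs => ?_⟩
  rw [Measure.map_apply hm (by
    simp only [Set.ofPred_forall]
    exact MeasurableSet.iInter fun i => MeasurableSet.iInter fun k =>
      hs i k |>.preimage (by fun_prop))]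
  have : joinSample (S := S) (κ := κ) (β := β) ⁻¹' {y | ∀ i k, y i k ∈ s i k} =
      (Set.univ.pi fun i => Set.univ.pi fun k => s i (Sum.inl k)) ×ˢ
      (Set.univ.pi fun i => Set.univ.pi fun k => s i (Sum.inr k)) := by
    ext y
    simp only [joinSample, Set.mem_preimage, Set.mem_ofPred_eq, Sum.forall, Sum.elim_inl,
      Sum.elim_inr, Set.mem_prod, Set.mem_pi, Set.mem_univ, true_imp_iff, forall_and]
  rw [this, Measure.prod_prod, sampleLaw, sampleLaw, Measure.pi_pi, Measure.pi_pi]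
  simp_rw [Measure.pi_pi, Fintype.prod_sum_type, Finset.prod_mul_distrib]

/-- The coordinates in `C` are taken from `u`, the others from `w`. -/
def blend {κ : Fin m → Type*} [∀ i, DecidableEq (κ i)] (C : Finset (Σ i, κ i)) (u w : ∀ i, κ i → S i) :
    ∀ i, κ i → S i :=
  fun i t => if ⟨i, t⟩ ∈ C then u i t else w i t

theorem measurable_blend {κ : Fin m → Type*} [∀ i, DecidableEq (κ i)] (C : Finset (Σ i, κ i)) :
    Measurable fun q : (∀ i, κ i → S i) × (∀ i, κ i → S i) => blend C q.1 q.2 := by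
  refine measurable_pi_lambda _ fun i => measurable_pi_lambda _ fun k => ?_
  by_cases hk : (⟨i, k⟩ : Σ i, κ i) ∈ C <;> simp only [blend, hk, if_true, if_false] <;> fun_prop

/-- Blending two independent families of independent coordinates. -/
theorem measurePreserving_blend {κ : Fin m → Type*} [∀ i, Fintype (κ i)] [∀ i, DecidableEq (κ i)]
    (C : Finset (Σ i, κ i)) (P Q : ∀ i, κ i → Measure (S i))
    [∀ i k, IsProbabilityMeasure (P i k)] [∀ i k, IsProbabilityMeasure (Q i k)] :
    MeasurePreserving (fun q : (∀ i, κ i → S i) × (∀ i, κ i → S i) => blend C q.1 q.2)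
      ((Measure.pi fun i => Measure.pi (Q i)).prod (Measure.pi fun i => Measure.pi (P i)))
      (Measure.pi fun i => Measure.pi fun k => if ⟨i, k⟩ ∈ C then Q i k else P i k) := by
  have : ∀ i k, IsProbabilityMeasure (if (⟨i, k⟩ : Σ i, κ i) ∈ C then Q i k else P i k) :=
    fun i k => by split_ifs <;> infer_instance
  refine ⟨measurable_blend C, pi_pi_eq_of_boxes _ fun s hs => ?_⟩
  rw [Measure.map_apply (measurable_blend C) (by
    simp only [Set.ofPred_forall]
    exact MeasurableSet.iInter fun i => MeasurableSet.iInter fun k =>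
      hs i k |>.preimage (by fun_prop))]
  have : (fun q : (∀ i, κ i → S i) × (∀ i, κ i → S i) => blend C q.1 q.2) ⁻¹'
        {y | ∀ i k, y i k ∈ s i k} =
      (Set.univ.pi fun i => Set.univ.pi fun k =>
        if (⟨i, k⟩ : Σ i, κ i) ∈ C then s i k else Set.univ) ×ˢ
      (Set.univ.pi fun i => Set.univ.pi fun k =>
        if (⟨i, k⟩ : Σ i, κ i) ∈ C then Set.univ else s i k) := by
    ext q
    simp only [blend, Set.mem_preimage, Set.mem_ofPred_eq, Set.mem_prod, Set.mem_pi, Set.mem_univ,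
      true_imp_iff, ← forall_and]
    refine forall_congr' fun i => forall_congr' fun k => ?_
    split_ifs <;> simp
  rw [this, Measure.prod_prod, Measure.pi_pi, Measure.pi_pi]
  simp_rw [Measure.pi_pi, ← Finset.prod_mul_distrib]
  refine Finset.prod_congr rfl fun i _ => Finset.prod_congr rfl fun k _ => ?_
  split_ifs <;> simp

/-- The law of a finite part of the data. -/
theorem IsInputData.map_eq {Ω : Type*} [MeasurableSpace Ω] {μ : Measure Ω}
    {F : ∀ i, Measure (S i)} [∀ i, IsProbabilityMeasure (F i)] {X : ∀ i, ℕ → Ω → S i}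
    (hX : IsInputData μ F X) (n : Fin m → ℕ) :
    MeasurePreserving (fun ω i (j : Fin (n i)) => X i j ω) μ (inputLaw n F) := by
  have hm : Measurable (fun ω i (j : Fin (n i)) => X i j ω) := by
    refine measurable_pi_lambda _ fun i => measurable_pi_lambda _ fun k => hX.measurable i k
  refine ⟨hm, pi_pi_eq_of_boxes (fun i (_ : Fin (n i)) => F i) fun s hs => ?_⟩
  have : IsProbabilityMeasure μ := hX.indep.isProbabilityMeasure
  have hi := hX.indep.precomp (g := fun p : Σ i, Fin (n i) => (⟨p.1, p.2⟩ : Σ _ : Fin m, ℕ)) (by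
    rintro ⟨i, k⟩ ⟨j, l⟩ h
    simp only [Sigma.mk.injEq] at h
    obtain ⟨rfl, h⟩ := h
    simp only [heq_eq_eq, Fin.val_inj] at h
    simp [h])
  rw [iIndepFun_iff_map_fun_eq_pi_map (fun p => (hX.measurable _ _).aemeasurable)] at hi
  have hm' : Measurable fun ω (p : Σ i, Fin (n i)) => X p.1 p.2 ω :=
    measurable_pi_lambda _ fun p => hX.measurable p.1 p.2
  have h1 := congrArg (fun ρ => ρ (Set.univ.pi fun p : Σ i, Fin (n i) => s p.1 p.2)) hi
  simp only at h1
  rw [Measure.map_apply hm' (MeasurableSet.univ_pi fun p => hs _ _), Measure.pi_pi,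
    Fintype.prod_sigma] at h1
  simp_rw [hX.law] at h1
  rw [Measure.map_apply hm (by
    simp only [Set.ofPred_forall]
    exact MeasurableSet.iInter fun i => MeasurableSet.iInter fun k =>
      hs i k |>.preimage (by fun_prop)), ← h1]
  congr 1
  ext ω
  simp [Set.mem_pi, Sigma.forall]

/-! ### Alternating sums over subsets -/

section AltSum

variable {κ : Type*} [DecidableEq κ]

/-- The Möbius transform of a function of finite sets. -/
noncomputable def altSum (φ : Finset κ → ℝ) (B : Finset κ) : ℝ :=
  -- The sum of the cardinalities has the parity of their difference and avoids truncated
  -- subtraction.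
  ∑ C ∈ B.powerset, (-1) ^ (B.card + C.card) * φ C

omit [DecidableEq κ] in
theorem altSum_empty (φ : Finset κ → ℝ) : altSum φ ∅ = φ ∅ := by simp [altSum]

/-- Splitting the subsets according to whether they contain `a` exhibits `altSum` as an iterated
difference; the inductions below run on this recursion. -/
theorem altSum_insert (φ : Finset κ → ℝ) {a : κ} {B : Finset κ} (ha : a ∉ B) :
    altSum φ (insert a B) = altSum (fun C => φ (insert a C)) B - altSum φ B := by
  unfold altSum
  rw [Finset.sum_powerset_insert ha, add_comm, ← Finset.sum_add_distrib, ← Finset.sum_sub_distrib]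
  refine Finset.sum_congr rfl fun C hC => ?_
  have haC : a ∉ C := fun h => ha (Finset.mem_powerset.1 hC h)
  rw [Finset.card_insert_of_notMem ha, Finset.card_insert_of_notMem haC]
  ring

theorem altSum_singleton (φ : Finset κ → ℝ) (a : κ) : altSum φ {a} = φ {a} - φ ∅ := by
  have := altSum_insert φ (Finset.notMem_empty a)
  simpa [altSum_empty] using this

theorem sum_powerset_altSum (φ : Finset κ → ℝ) (A : Finset κ) :
    ∑ B ∈ A.powerset, altSum φ B = φ A := by
  induction A using Finset.induction_on generalizing φ with
  | empty => simp [altSum_empty]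
  | insert a A ha ih =>
    rw [Finset.sum_powerset_insert ha, ← Finset.sum_add_distrib, ← ih (fun C => φ (insert a C))]
    refine Finset.sum_congr rfl fun B hB => ?_
    rw [altSum_insert φ fun h => ha (Finset.mem_powerset.1 hB h)]
    ring

theorem sum_altSum_nonempty (φ : Finset κ → ℝ) (A : Finset κ) :
    ∑ B ∈ A.powerset with 1 ≤ B.card, altSum φ B = φ A - φ ∅ := by
  rw [← sum_powerset_altSum φ A, ← Finset.sum_filter_add_sum_filter_not A.powerset
    (fun B => 1 ≤ B.card)]
  have : A.powerset.filter (fun B => ¬ 1 ≤ B.card) = {∅} := by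
    ext B
    simp only [Finset.mem_filter, Finset.mem_powerset, Finset.mem_singleton, not_le,
      Nat.lt_one_iff, Finset.card_eq_zero]
    exact ⟨fun h => h.2, fun h => ⟨h ▸ Finset.empty_subset _, h⟩⟩
  rw [this, Finset.sum_singleton, altSum_empty]
  ring

omit [DecidableEq κ] in
theorem sum_powerset_split (a : Finset κ → ℝ) (A : Finset κ) :
    ∑ B ∈ A.powerset, a B =
      a ∅ + ∑ k ∈ A, a {k} + ∑ B ∈ A.powerset with 2 ≤ B.card, a B := by
  classical
  rw [← Finset.sum_filter_add_sum_filter_not A.powerset (fun B => 2 ≤ B.card), add_comm]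
  congr 1
  have : A.powerset.filter (fun B => ¬ 2 ≤ B.card) = insert ∅ (A.image fun k => {k}) := by
    ext B
    simp only [Finset.mem_filter, Finset.mem_powerset, Finset.mem_insert, Finset.mem_image]
    constructor
    · rintro ⟨hB, h⟩
      rcases B.eq_empty_or_nonempty with hB0 | hB0
      · exact Or.inl hB0
      · have := hB0.card_pos
        obtain ⟨a, rfl⟩ := Finset.card_eq_one.1 (show B.card = 1 by omega)
        exact Or.inr ⟨a, by simpa using hB, rfl⟩
    · rintro (rfl | ⟨a, ha, rfl⟩)
      · simp
      · simpa using ha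
  rw [this, Finset.sum_insert (by simp),
    Finset.sum_image fun a _ b _ h => Finset.singleton_injective h]

/-- Möbius inversion without its constant and linear terms: the algebraic form of a first order
remainder. -/
theorem sum_altSum_two_le (φ : Finset κ → ℝ) (A : Finset κ) :
    ∑ B ∈ A.powerset with 2 ≤ B.card, altSum φ B
      = φ A - φ ∅ - ∑ k ∈ A, (φ {k} - φ ∅) := by
  have h := sum_powerset_split (altSum φ) A
  rw [sum_powerset_altSum, altSum_empty] at h
  simp_rw [altSum_singleton] at h
  linarith

/-- The multilinear interpolation of a function of finite sets, in terms of its Möbius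
transform. -/
theorem sum_powerset_prod_mul_altSum (φ : Finset κ → ℝ) (v : κ → ℝ) (A : Finset κ) :
    ∑ B ∈ A.powerset, (∏ k ∈ B, v k) * altSum φ B =
      ∑ C ∈ A.powerset, ((∏ k ∈ C, v k) * ∏ k ∈ A \ C, (1 - v k)) * φ C := by
  induction A using Finset.induction_on generalizing φ with
  | empty => simp [altSum_empty]
  | insert a A ha ih =>
    rw [Finset.sum_powerset_insert ha, Finset.sum_powerset_insert ha]
    have h1 : ∑ B ∈ A.powerset, (∏ k ∈ insert a B, v k) * altSum φ (insert a B) =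
        v a * ∑ B ∈ A.powerset, (∏ k ∈ B, v k) * altSum (fun C => φ (insert a C)) B -
          v a * ∑ B ∈ A.powerset, (∏ k ∈ B, v k) * altSum φ B := by
      rw [Finset.mul_sum, Finset.mul_sum, ← Finset.sum_sub_distrib]
      refine Finset.sum_congr rfl fun B hB => ?_
      have haB : a ∉ B := fun h => ha (Finset.mem_powerset.1 hB h)
      rw [altSum_insert φ haB, Finset.prod_insert haB]
      ring
    have h2 : ∑ C ∈ A.powerset, ((∏ k ∈ C, v k) * ∏ k ∈ insert a A \ C, (1 - v k)) * φ C =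
        (1 - v a) * ∑ C ∈ A.powerset, ((∏ k ∈ C, v k) * ∏ k ∈ A \ C, (1 - v k)) * φ C := by
      rw [Finset.mul_sum]
      refine Finset.sum_congr rfl fun C hC => ?_
      have haC : a ∉ C := fun h => ha (Finset.mem_powerset.1 hC h)
      rw [Finset.insert_sdiff_of_notMem _ haC, Finset.prod_insert (by simp [ha])]
      ring
    have h3 : ∑ C ∈ A.powerset, ((∏ k ∈ insert a C, v k) *
          ∏ k ∈ insert a A \ insert a C, (1 - v k)) * φ (insert a C) =
        v a * ∑ C ∈ A.powerset, ((∏ k ∈ C, v k) * ∏ k ∈ A \ C, (1 - v k)) *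
          φ (insert a C) := by
      rw [Finset.mul_sum]
      refine Finset.sum_congr rfl fun C hC => ?_
      have haC : a ∉ C := fun h => ha (Finset.mem_powerset.1 hC h)
      rw [Finset.prod_insert haC, Finset.insert_sdiff_insert,
        Finset.sdiff_insert_of_notMem ha]
      ring
    rw [h1, h2, h3, ih φ, ih fun C => φ (insert a C)]
    ring

/-- Being a difference in the direction `k`, the Möbius transform is odd under exchanging presence
and absence of `k`. This produces the sign change under an exchange with ghost data. -/
theorem altSum_swap {φ φ' : Finset κ → ℝ} {k : κ} {B : Finset κ} (hk : k ∈ B)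
    (h1 : ∀ C ⊆ B.erase k, φ' (insert k C) = φ C)
    (h2 : ∀ C ⊆ B.erase k, φ' C = φ (insert k C)) :
    altSum φ' B = - altSum φ B := by
  rw [← Finset.insert_erase hk, altSum_insert _ (Finset.notMem_erase k B),
    altSum_insert _ (Finset.notMem_erase k B)]
  have e1 : altSum (fun C => φ' (insert k C)) (B.erase k) = altSum φ (B.erase k) :=
    Finset.sum_congr rfl fun C hC => by
      simp only []
      rw [h1 C (Finset.mem_powerset.1 hC)]
  have e2 : altSum (fun C => φ (insert k C)) (B.erase k) = altSum φ' (B.erase k) :=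
    Finset.sum_congr rfl fun C hC => by
      simp only []
      rw [h2 C (Finset.mem_powerset.1 hC)]
  rw [e1, e2]
  ring

end AltSum

/-! ### Counting index maps with repeated values -/

section Counting

variable {m : ℕ} {T n : Fin m → ℕ} {r : ℕ}

/-- The value of `r` index maps at a slot, consisting of one of the maps and of one of the
coordinates. -/
def slotValue (J : Fin r → ∀ i, Fin (T i) → Fin (n i)) (u : Fin r × Σ i, Fin (T i)) :
    Σ i, Fin (n i) :=
  ⟨u.2.1, J u.1 u.2.1 u.2.2⟩

/-- Every value taken in a slot with coordinate in `B` is taken in another such slot. -/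
def AllMatched (B : Finset (Σ i, Fin (T i))) (J : Fin r → ∀ i, Fin (T i) → Fin (n i)) : Prop :=
  ∀ u : Fin r × Σ i, Fin (T i), u.2 ∈ B → ∃ u' : Fin r × Σ i, Fin (T i),
    u'.2 ∈ B ∧ u' ≠ u ∧ slotValue J u' = slotValue J u

theorem slotValue_eq_iff {J J' : Fin r → ∀ i, Fin (T i) → Fin (n i)}
    {u : Fin r × Σ i, Fin (T i)} :
    slotValue J u = slotValue J' u ↔ J u.1 u.2.1 u.2.2 = J' u.1 u.2.1 u.2.2 := by
  simp [slotValue]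

/-- Index maps that are determined by their values outside `D` are rare. -/
theorem pow_mul_card_le_of_determined {L : ℕ} (hL : ∀ i, L ≤ n i)
    (𝒥 : Finset (Fin r → ∀ i, Fin (T i) → Fin (n i))) (D : Finset (Fin r × Σ i, Fin (T i)))
    (hD : ∀ J ∈ 𝒥, ∀ J' ∈ 𝒥, (∀ u ∉ D, slotValue J u = slotValue J' u) → J = J') :
    L ^ D.card * 𝒥.card ≤ Fintype.card (Fin r → ∀ i, Fin (T i) → Fin (n i)) := by
  -- Overwriting the slots in `D` by arbitrary values below `L` loses no information, since the
  -- slots outside `D` still identify `J ∈ 𝒥`.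
  let Φ : (D → Fin L) × 𝒥 → (Fin r → ∀ i, Fin (T i) → Fin (n i)) := fun p q i t =>
    if h : (q, (⟨i, t⟩ : Σ i, Fin (T i))) ∈ D then Fin.castLE (hL i) (p.1 ⟨_, h⟩)
    else p.2.1 q i t
  have hΦ : Function.Injective Φ := by
    rintro ⟨v, J, hJ⟩ ⟨v', J', hJ'⟩ h
    have h1 : J = J' := by
      refine hD J hJ J' hJ' fun u hu => ?_
      rw [slotValue_eq_iff]
      have := congrFun (congrFun (congrFun h u.1) u.2.1) u.2.2
      simpa [Φ, hu] using this
    subst h1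
    have h2 : v = v' := by
      funext ⟨u, hu⟩
      have := congrFun (congrFun (congrFun h u.1) u.2.1) u.2.2
      simpa [Φ, hu] using this
    rw [h2]
  have := Fintype.card_le_of_injective Φ hΦ
  simpa using this

-- One representative slot is chosen for each value taken in `B`. Every representative has a partner
-- of equal value that is not a representative, so the non-representatives make up at least half of
-- the `r * B.card` slots. `D` consists of `d` of them, and `p` sends each to its representative.
open Classical in
theorem exists_representatives {B : Finset (Σ i, Fin (T i))}
    {J : Fin r → ∀ i, Fin (T i) → Fin (n i)} (hJ : AllMatched B J) {d : ℕ}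
    (hd : 2 * d ≤ r * B.card) :
    ∃ (D : Finset (Fin r × Σ i, Fin (T i)))
      (p : Fin r × (Σ i, Fin (T i)) → Fin r × Σ i, Fin (T i)),
      D.card = d ∧ ∀ u ∈ D, p u ∉ D ∧ slotValue J (p u) = slotValue J u := by
  set U : Finset (Fin r × Σ i, Fin (T i)) := Finset.univ ×ˢ B with hU
  have hUc : U.card = r * B.card := by simp [hU]
  have hmem : ∀ u, u ∈ U ↔ u.2 ∈ B := fun u => by simp [hU]
  -- The choice depends on the value and not on the slot, so that slots of equal value share their
  -- representative.
  let g : (Σ i, Fin (n i)) → (Fin r × Σ i, Fin (T i)) → (Fin r × Σ i, Fin (T i)) := fun v u =>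
    if h : ∃ u' ∈ U, slotValue J u' = v then h.choose else u
  let rep := fun u => g (slotValue J u) u
  have hrep : ∀ u ∈ U, rep u ∈ U ∧ slotValue J (rep u) = slotValue J u := by
    intro u hu
    have h : ∃ u' ∈ U, slotValue J u' = slotValue J u := ⟨u, hu, rfl⟩
    have : rep u = h.choose := dif_pos h
    rw [this]
    exact h.choose_spec
  have hrep_congr : ∀ u ∈ U, ∀ u' ∈ U, slotValue J u = slotValue J u' → rep u = rep u' := by
    intro u hu u' hu' huu
    have h : ∃ u'' ∈ U, slotValue J u'' = slotValue J u := ⟨u, hu, rfl⟩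
    have h' : ∃ u'' ∈ U, slotValue J u'' = slotValue J u' := ⟨u', hu', rfl⟩
    have e : rep u = h.choose := dif_pos h
    have e' : rep u' = h'.choose := dif_pos h'
    rw [e, e']
    congr 1
    simp only [huu]
  have hrr : ∀ u ∈ U, rep (rep u) = rep u := fun u hu =>
    hrep_congr _ (hrep u hu).1 _ hu (hrep u hu).2
  set D₀ := U.filter fun u => rep u ≠ u with hD₀
  have hcard : (U.filter fun u => rep u = u).card ≤ D₀.card := by
    choose! partner h1 h2 h3 using hJ
    refine Finset.card_le_card_of_injOn partner ?_ ?_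
    · intro u hu
      rw [Finset.mem_coe, Finset.mem_filter] at hu
      have hu' := (hmem u).1 hu.1
      have hp : partner u ∈ U := (hmem _).2 (h1 u hu')
      rw [Finset.mem_coe, hD₀, Finset.mem_filter]
      refine ⟨hp, fun h => h2 u hu' ?_⟩
      rw [← h, hrep_congr _ hp _ hu.1 (h3 u hu'), hu.2]
    · intro u hu v hv huv
      rw [Finset.mem_coe, Finset.mem_filter] at hu hv
      have hu' := (hmem u).1 hu.1
      have hv' := (hmem v).1 hv.1
      rw [← hu.2, ← hv.2]
      refine hrep_congr _ hu.1 _ hv.1 ?_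
      rw [← h3 u hu', huv, h3 v hv']
  have hsum : (U.filter fun u => rep u = u).card + D₀.card = U.card :=
    Finset.card_filter_add_card_filter_not (s := U) (fun u => rep u = u)
  obtain ⟨D, hDD, hDc⟩ := Finset.exists_subset_card_eq (s := D₀) (n := d) (by omega)
  refine ⟨D, rep, hDc, fun u hu => ?_⟩
  have hu' := Finset.mem_filter.1 (hDD hu)
  refine ⟨fun h => ?_, (hrep u hu'.1).2⟩
  exact (Finset.mem_filter.1 (hDD h)).2 (hrr u hu'.1)

/-- A constant that only depends on the number of slots. -/
def matchConst (T : Fin m → ℕ) (r : ℕ) : ℕ :=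
  Fintype.card (Finset (Fin r × Σ i, Fin (T i)) ×
    (Fin r × (Σ i, Fin (T i)) → Fin r × Σ i, Fin (T i)))

-- Union bound over the pairs `(D, p)` of `exists_representatives`. For a fixed pair the slots in
-- `D` copy slots outside `D`, so `J` is determined by its values outside `D`.
open Classical in
theorem pow_mul_card_allMatched_le {L : ℕ} (hL : ∀ i, L ≤ n i) (B : Finset (Σ i, Fin (T i)))
    {d : ℕ} (hd : 2 * d ≤ r * B.card) :
    L ^ d * (Finset.univ.filter fun J : Fin r → ∀ i, Fin (T i) → Fin (n i) =>
      AllMatched B J).card ≤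
      matchConst T r * Fintype.card (Fin r → ∀ i, Fin (T i) → Fin (n i)) := by
  let 𝒥 : (Finset (Fin r × Σ i, Fin (T i)) ×
      (Fin r × (Σ i, Fin (T i)) → Fin r × Σ i, Fin (T i))) →
      Finset (Fin r → ∀ i, Fin (T i) → Fin (n i)) := fun a =>
    Finset.univ.filter fun J => a.1.card = d ∧ ∀ u ∈ a.1,
      a.2 u ∉ a.1 ∧ slotValue J (a.2 u) = slotValue J u
  have hsub : (Finset.univ.filter fun J : Fin r → ∀ i, Fin (T i) → Fin (n i) =>
      AllMatched B J) ⊆ Finset.univ.biUnion 𝒥 := by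
    intro J hJ
    obtain ⟨D, p, h1, h2⟩ := exists_representatives (Finset.mem_filter.1 hJ).2 hd
    rw [Finset.mem_biUnion]
    exact ⟨(D, p), Finset.mem_univ _, Finset.mem_filter.2 ⟨Finset.mem_univ _, h1, h2⟩⟩
  have hle : ∀ a, L ^ d * (𝒥 a).card ≤
      Fintype.card (Fin r → ∀ i, Fin (T i) → Fin (n i)) := by
    intro a
    by_cases ha : a.1.card = d
    · rw [← ha]
      refine pow_mul_card_le_of_determined hL _ _ fun J hJ J' hJ' h => ?_
      have hJ := (Finset.mem_filter.1 hJ).2.2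
      have hJ' := (Finset.mem_filter.1 hJ').2.2
      have hall : ∀ u, slotValue J u = slotValue J' u := by
        intro u
        by_cases hu : u ∈ a.1
        · rw [← (hJ u hu).2, ← (hJ' u hu).2]
          exact h _ (hJ u hu).1
        · exact h u hu
      funext q i t
      exact slotValue_eq_iff.1 (hall (q, ⟨i, t⟩))
    · have : 𝒥 a = ∅ := by
        refine Finset.filter_eq_empty_iff.2 fun J _ h => ha h.1
      simp [this]
  calc _ ≤ L ^ d * ∑ a, (𝒥 a).card :=
        Nat.mul_le_mul_left _ ((Finset.card_le_card hsub).trans Finset.card_biUnion_le)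
    _ = ∑ a, L ^ d * (𝒥 a).card := Finset.mul_sum _ _ _
    _ ≤ ∑ _a, Fintype.card (Fin r → ∀ i, Fin (T i) → Fin (n i)) :=
        Finset.sum_le_sum fun a _ => hle a
    _ = _ := by rw [Finset.sum_const, smul_eq_mul, matchConst, Finset.card_univ]

/-- The index map `J` with the value at the coordinate `k` replaced by `j`. -/
def setIndex (k : Σ i, Fin (T i)) (j : Fin (n k.1)) (J : ∀ i, Fin (T i) → Fin (n i)) :
    ∀ i, Fin (T i) → Fin (n i) :=
  Function.update J k.1 (Function.update (J k.1) k.2 j)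

theorem setIndex_self (k : Σ i, Fin (T i)) (j : Fin (n k.1)) (J : ∀ i, Fin (T i) → Fin (n i)) :
    setIndex k j J k.1 k.2 = j := by simp [setIndex]

theorem setIndex_of_ne {k l : Σ i, Fin (T i)} (h : l ≠ k) (j : Fin (n k.1))
    (J : ∀ i, Fin (T i) → Fin (n i)) : setIndex k j J l.1 l.2 = J l.1 l.2 := by
  obtain ⟨i, t⟩ := k
  obtain ⟨i', t'⟩ := l
  simp only [setIndex]
  by_cases hi : i' = i
  · subst hi
    have : t' ≠ t := fun ht => h (by rw [ht])
    simp [this]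
  · simp [hi]

-- The slots at `k` all carry the value `j` and can match each other for free, so a single factor
-- `L` is extracted: the slot `(0, l)` must agree with another slot and is thus determined by the
-- rest.
open Classical in
theorem mul_card_allMatched_setIndex_le {L : ℕ} (hL : ∀ i, L ≤ n i)
    {B : Finset (Σ i, Fin (T i))} {k l : Σ i, Fin (T i)} (hl : l ∈ B) (hlk : l ≠ k)
    (j : Fin (n k.1)) (hr : 0 < r) :
    L * (Finset.univ.filter fun J : Fin r → ∀ i, Fin (T i) → Fin (n i) =>
      AllMatched B fun q => setIndex k j (J q)).card ≤
      matchConst T r * Fintype.card (Fin r → ∀ i, Fin (T i) → Fin (n i)) := by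
  let u₀ : Fin r × Σ i, Fin (T i) := (⟨0, hr⟩, l)
  let 𝒥 : (Fin r × Σ i, Fin (T i)) →
      Finset (Fin r → ∀ i, Fin (T i) → Fin (n i)) := fun u =>
    Finset.univ.filter fun J => u ≠ u₀ ∧
      slotValue (fun q => setIndex k j (J q)) u = slotValue (fun q => setIndex k j (J q)) u₀
  have hsub : (Finset.univ.filter fun J : Fin r → ∀ i, Fin (T i) → Fin (n i) =>
      AllMatched B fun q => setIndex k j (J q)) ⊆ Finset.univ.biUnion 𝒥 := by
    intro J hJ
    obtain ⟨u, -, h1, h2⟩ := (Finset.mem_filter.1 hJ).2 u₀ hl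
    rw [Finset.mem_biUnion]
    exact ⟨u, Finset.mem_univ _, Finset.mem_filter.2 ⟨Finset.mem_univ _, h1, h2⟩⟩
  have hset : ∀ J J' : Fin r → ∀ i, Fin (T i) → Fin (n i), ∀ u, slotValue J u = slotValue J' u →
      slotValue (fun q => setIndex k j (J q)) u = slotValue (fun q => setIndex k j (J' q)) u := by
    intro J J' u h
    rw [slotValue_eq_iff] at h ⊢
    obtain ⟨q, v⟩ := u
    by_cases hv : v = k
    · subst hv
      simp only [setIndex_self]
    · simpa only [setIndex_of_ne hv] using h
  have hle : ∀ u, L * (𝒥 u).card ≤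
      Fintype.card (Fin r → ∀ i, Fin (T i) → Fin (n i)) := by
    intro u
    by_cases hu : u = u₀
    · have : 𝒥 u = ∅ := Finset.filter_eq_empty_iff.2 fun J _ h => h.1 hu
      simp [this]
    · have := pow_mul_card_le_of_determined hL (𝒥 u) {u₀} fun J hJ J' hJ' h => ?_
      · simpa using this
      have hJ := (Finset.mem_filter.1 hJ).2.2
      have hJ' := (Finset.mem_filter.1 hJ').2.2
      have h0 : slotValue J u₀ = slotValue J' u₀ := by
        have h3 := hset J J' u (h u (by simpa using hu))
        rw [hJ, hJ', slotValue_eq_iff] at h3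
        rw [slotValue_eq_iff]
        simpa only [u₀, setIndex_of_ne hlk] using h3
      funext q i t
      by_cases hq : (q, (⟨i, t⟩ : Σ i, Fin (T i))) = u₀
      · have h0 := slotValue_eq_iff.1 h0
        rw [← hq] at h0
        exact h0
      · exact slotValue_eq_iff.1 (h (q, ⟨i, t⟩) (by simpa using hq))
  calc _ ≤ L * ∑ a, (𝒥 a).card :=
        Nat.mul_le_mul_left _ ((Finset.card_le_card hsub).trans Finset.card_biUnion_le)
    _ = ∑ a, L * (𝒥 a).card := Finset.mul_sum _ _ _
    _ ≤ ∑ _a, Fintype.card (Fin r → ∀ i, Fin (T i) → Fin (n i)) :=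
        Finset.sum_le_sum fun a _ => hle a
    _ = Fintype.card (Fin r × Σ i, Fin (T i)) *
          Fintype.card (Fin r → ∀ i, Fin (T i) → Fin (n i)) := by
        rw [Finset.sum_const, smul_eq_mul, Finset.card_univ]
    _ ≤ _ := by
        refine Nat.mul_le_mul_right _ ?_
        -- Sending a slot `u` to the pair `({u}, id)` shows that there are at most `matchConst T r`
        -- slots.
        exact Fintype.card_le_of_injective (fun u => (({u} : Finset _), id)) fun a b h => by
          simpa using h

end Counting

/-! ### Elementary inequalities -/

theorem abs_prod_le_sum_pow {r : ℕ} (hr : 0 < r) (a : Fin r → ℝ) :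
    |∏ q, a q| ≤ ∑ q, |a q| ^ r := by
  obtain ⟨q, -, hq⟩ := Finset.exists_max_image (Finset.univ : Finset (Fin r)) (fun q => |a q|)
    ⟨⟨0, hr⟩, Finset.mem_univ _⟩
  rw [Finset.abs_prod]
  calc ∏ q, |a q| ≤ ∏ _q' : Fin r, |a q| :=
        Finset.prod_le_prod (fun _ _ => abs_nonneg _) fun q' _ => hq q' (Finset.mem_univ _)
    _ = |a q| ^ r := by simp
    _ ≤ _ := Finset.single_le_sum (f := fun q => |a q| ^ r)
        (fun _ _ => pow_nonneg (abs_nonneg _) _) (Finset.mem_univ q)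

theorem abs_sum_pow_le {ι : Type*} (s : Finset ι) (a : ι → ℝ) {r : ℕ} (hr : 0 < r) :
    |∑ i ∈ s, a i| ^ r ≤ (s.card : ℝ) ^ r * ∑ i ∈ s, |a i| ^ r := by
  rcases s.eq_empty_or_nonempty with rfl | hs
  · simp [hr.ne']
  obtain ⟨j, hj, hmax⟩ := Finset.exists_max_image s (fun i => |a i|) hs
  calc |∑ i ∈ s, a i| ^ r ≤ (∑ i ∈ s, |a i|) ^ r :=
        pow_le_pow_left₀ (abs_nonneg _) (Finset.abs_sum_le_sum_abs _ _) _
    _ ≤ (∑ _i ∈ s, |a j|) ^ r :=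
        pow_le_pow_left₀ (Finset.sum_nonneg fun _ _ => abs_nonneg _)
          (Finset.sum_le_sum fun i hi => hmax i hi) _
    _ = (s.card : ℝ) ^ r * |a j| ^ r := by rw [Finset.sum_const, nsmul_eq_mul, mul_pow]
    _ ≤ _ := by
        gcongr
        exact Finset.single_le_sum (f := fun i => |a i| ^ r)
          (fun _ _ => pow_nonneg (abs_nonneg _) _) hj

theorem Integrable.of_abs_pow {Ω : Type*} [MeasurableSpace Ω] {μ : Measure Ω}
    [IsFiniteMeasure μ] {g : Ω → ℝ} (hg : AEStronglyMeasurable g μ) {r : ℕ} (hr : 0 < r)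
    (h : Integrable (fun ω => |g ω| ^ r) μ) : Integrable g μ := by
  refine ((integrable_const (1 : ℝ)).add h).mono' hg (ae_of_all _ fun ω => ?_)
  simp only [Real.norm_eq_abs, Pi.add_apply]
  rcases le_total |g ω| 1 with h1 | h1
  · have : 0 ≤ |g ω| ^ r := by positivity
    linarith
  · have : |g ω| ^ 1 ≤ |g ω| ^ r := pow_le_pow_right₀ h1 hr
    rw [pow_one] at this
    linarith

theorem pow_integral_le {Ω : Type*} [MeasurableSpace Ω] {μ : Measure Ω}
    [IsProbabilityMeasure μ] {g : Ω → ℝ} {r : ℕ} (hr : Even r)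
    (hg : Integrable g μ) (h : Integrable (fun ω => g ω ^ r) μ) :
    (∫ ω, g ω ∂μ) ^ r ≤ ∫ ω, g ω ^ r ∂μ :=
  hr.convexOn_pow.map_integral_le (continuous_pow r).continuousOn isClosed_univ (by simp) hg h

/-! ### Arguments selected by index maps, and their moments -/

section Core

variable {m : ℕ} {S : Fin m → Type*} [∀ i, MeasurableSpace (S i)] {T : Fin m → ℕ}

/-- The arguments selected from a sample by an index map. -/
def pick {κ : Fin m → Type*} (y : ∀ i, κ i → S i) (e : ∀ i, Fin (T i) → κ i) :
    ∀ i, Fin (T i) → S i := fun i t => y i (e i t)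

@[fun_prop]
theorem measurable_pick {κ : Fin m → Type*} (e : ∀ i, Fin (T i) → κ i) :
    Measurable fun y : ∀ i, κ i → S i => pick y e := by
  unfold pick; fun_prop

/-- The law of the arguments selected by an index map only depends on its collision pattern. -/
theorem exists_pattern {κ : Fin m → Type*} [∀ i, Fintype (κ i)] (P : ∀ i, Measure (S i))
    [∀ i, IsProbabilityMeasure (P i)] (J : ∀ i, Fin (T i) → κ i) :
    ∃ I : ∀ i, Fin (T i) → Fin (T i), (∀ i t, I i t ≤ t) ∧
      (sampleLaw κ P).map (fun y => pick y J) = (inputLaw T P).map (fun x => pick x I) := by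
  classical
  have hne : ∀ i t, (Finset.univ.filter fun t' => J i t' = J i t).Nonempty :=
    fun i t => ⟨t, by simp⟩
  -- Each position points to the earliest position with the same index, whence `I i t ≤ t`. The
  -- fixed points of `I` represent the distinct indices, on which `J` is injective.
  let I : ∀ i, Fin (T i) → Fin (T i) := fun i t => Finset.min' _ (hne i t)
  have hJI : ∀ i t, J i (I i t) = J i t := fun i t =>
    (Finset.mem_filter.1 (Finset.min'_mem _ (hne i t))).2
  have hcongr : ∀ i t t', J i t = J i t' → I i t = I i t' := by
    intro i t t' h
    simp only [I, h]
  have hII : ∀ i t, I i (I i t) = I i t := fun i t => hcongr _ _ _ (hJI i t)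
  let R : Fin m → Type := fun i => {t : Fin (T i) // I i t = t}
  let I' : ∀ i, Fin (T i) → R i := fun i t => ⟨I i t, hII i t⟩
  have h1 := measurePreserving_relabel P (fun i (t : R i) => J i t.1) (fun i t t' h =>
    Subtype.ext (by rw [← t.2, ← t'.2]; exact hcongr _ _ _ h))
  have h2 : MeasurePreserving _ (inputLaw T P) _ :=
    measurePreserving_relabel P (fun i (t : R i) => t.1) (fun i t t' h => Subtype.ext h)
  refine ⟨I, fun i t => Finset.min'_le _ _ (by simp), ?_⟩
  have e1 : (fun y : ∀ i, κ i → S i => pick y J) =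
      (fun y => pick y I') ∘ fun y i (t : R i) => y i (J i t.1) := by
    funext y i t
    simp [pick, I', hJI]
  have e2 : (fun y : ∀ i, Fin (T i) → S i => pick y I) =
      (fun y => pick y I') ∘ fun y i (t : R i) => y i t.1 := by
    funext y i t
    simp [pick, I']
  rw [e1, e2, ← Measure.map_map (measurable_pick _) h1.measurable,
    ← Measure.map_map (measurable_pick _) h2.measurable, h1.map_eq, h2.map_eq]

/-- The sum of the `r`-th absolute moments of `f` along all index patterns. -/
noncomputable def patternMoment (T : Fin m → ℕ) (f : (∀ i, Fin (T i) → S i) → ℝ)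
    (P : ∀ i, Measure (S i)) (r : ℕ) : ℝ :=
  ∑ I : ∀ i, Fin (T i) → Fin (T i), ∫ x, |f (pick x I)| ^ r ∂(inputLaw T P)

theorem patternMoment_nonneg (f : (∀ i, Fin (T i) → S i) → ℝ) (P : ∀ i, Measure (S i)) (r : ℕ) :
    0 ≤ patternMoment T f P r :=
  Finset.sum_nonneg fun _ _ => integral_nonneg fun _ => by positivity

variable {f : (∀ i, Fin (T i) → S i) → ℝ} {P : ∀ i, Measure (S i)}
  [∀ i, IsProbabilityMeasure (P i)] {r : ℕ}

/-- Only patterns with `I i t ≤ t` are assumed integrable; `exists_pattern` reduces index maps into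
arbitrary finite index types, ghosts included, to these. -/
theorem FiniteMoments.integrable_pick (hf : Measurable f) (h : FiniteMoments T f P r)
    {κ : Fin m → Type*} [∀ i, Fintype (κ i)] (J : ∀ i, Fin (T i) → κ i) :
    Integrable (fun y => |f (pick y J)| ^ r) (sampleLaw κ P) := by
  obtain ⟨I, hI, hmap⟩ := exists_pattern P J
  have hm : Measurable fun x => |f x| ^ r := by fun_prop
  have h1 : Integrable (fun x => |f x| ^ r) ((inputLaw T P).map fun x => pick x I) :=
    (integrable_map_measure hm.aestronglyMeasurable (by fun_prop)).2 (h I hI)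
  rw [← hmap] at h1
  exact (integrable_map_measure hm.aestronglyMeasurable (by fun_prop)).1 h1

theorem integral_pick_le (hf : Measurable f)
    {κ : Fin m → Type*} [∀ i, Fintype (κ i)] (J : ∀ i, Fin (T i) → κ i) :
    ∫ y, |f (pick y J)| ^ r ∂(sampleLaw κ P) ≤ patternMoment T f P r := by
  obtain ⟨I, hI, hmap⟩ := exists_pattern P J
  have hm : Measurable fun x => |f x| ^ r := by fun_prop
  have h1 : ∫ y, |f (pick y J)| ^ r ∂(sampleLaw κ P) =
      ∫ x, |f x| ^ r ∂((sampleLaw κ P).map fun y => pick y J) :=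
    (integral_map (by fun_prop) hm.aestronglyMeasurable).symm
  rw [h1, hmap, integral_map (by fun_prop) hm.aestronglyMeasurable]
  exact Finset.single_le_sum (f := fun I => ∫ x, |f (pick x I)| ^ r ∂(inputLaw T P))
    (fun _ _ => integral_nonneg fun _ => by positivity) (Finset.mem_univ I)

/-! ### Ghost data and the exchange symmetry -/

variable {n : Fin m → ℕ}

/-- The index set of the data of one model together with its ghost data, which are available
in a separate copy for each coordinate. -/
abbrev GhostIndex (T n : Fin m → ℕ) (i : Fin m) : Type := Fin (T i) × Fin (n i)

/-- The coordinates in `C` are selected from the data, the others from the ghost data. -/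
def ghostIndex (C : Finset (Σ i, Fin (T i))) (J : ∀ i, Fin (T i) → Fin (n i)) :
    ∀ i, Fin (T i) → Fin (n i) ⊕ GhostIndex T n i :=
  fun i t => if ⟨i, t⟩ ∈ C then Sum.inl (J i t) else Sum.inr (t, J i t)

/-- The interaction of `f` in the coordinates `B`, before the ghost data are averaged out. -/
noncomputable def ghostInteraction (f : (∀ i, Fin (T i) → S i) → ℝ)
    (B : Finset (Σ i, Fin (T i))) (J : ∀ i, Fin (T i) → Fin (n i))
    (y : ∀ i, Fin (n i) ⊕ GhostIndex T n i → S i) : ℝ :=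
  altSum (fun C => f (pick y (ghostIndex C J))) B

theorem measurable_ghostInteraction (hf : Measurable f) (B : Finset (Σ i, Fin (T i)))
    (J : ∀ i, Fin (T i) → Fin (n i)) : Measurable (ghostInteraction (S := S) f B J) := by
  unfold ghostInteraction altSum
  fun_prop

/-- The exchange of a data point with its ghost for the coordinate `k`. -/
def ghostSwap (k : Σ i, Fin (T i)) (j : Fin (n k.1)) :
    ∀ i, Fin (n i) ⊕ GhostIndex T n i → Fin (n i) ⊕ GhostIndex T n i :=
  Function.update (fun _ => id) k.1 (Equiv.swap (Sum.inl j) (Sum.inr (k.2, j)))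

theorem ghostSwap_injective (k : Σ i, Fin (T i)) (j : Fin (n k.1)) (i : Fin m) :
    Function.Injective (ghostSwap k j i) := by
  by_cases hi : i = k.1
  · subst hi
    rw [ghostSwap, Function.update_self]
    exact Equiv.injective _
  · rw [ghostSwap, Function.update_of_ne hi]
    exact Function.injective_id

theorem ghostSwap_inl (k : Σ i, Fin (T i)) (j : Fin (n k.1)) :
    ghostSwap k j k.1 (Sum.inl j) = Sum.inr (k.2, j) := by
  rw [ghostSwap, Function.update_self, Equiv.swap_apply_left]

theorem ghostSwap_inr (k : Σ i, Fin (T i)) (j : Fin (n k.1)) :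
    ghostSwap k j k.1 (Sum.inr (k.2, j)) = Sum.inl j := by
  rw [ghostSwap, Function.update_self, Equiv.swap_apply_right]

/-- The swap moves only the data point `(k.1, j)` and its ghost for `k`. The first hypothesis keeps
`l` away from the data point; the second keeps it away from the ghost, which no coordinate but `k`
can select. -/
theorem ghostSwap_ghostIndex (k : Σ i, Fin (T i)) (j : Fin (n k.1))
    (C : Finset (Σ i, Fin (T i))) (J : ∀ i, Fin (T i) → Fin (n i)) (l : Σ i, Fin (T i))
    (h1 : l ∈ C → (⟨l.1, J l.1 l.2⟩ : Σ i, Fin (n i)) ≠ ⟨k.1, j⟩)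
    (h2 : l = k → (⟨l.1, J l.1 l.2⟩ : Σ i, Fin (n i)) ≠ ⟨k.1, j⟩) :
    ghostSwap k j l.1 (ghostIndex C J l.1 l.2) = ghostIndex C J l.1 l.2 := by
  obtain ⟨i, t⟩ := l
  obtain ⟨i₀, t₀⟩ := k
  by_cases hi : i = i₀
  · subst hi
    simp only [ghostSwap, Function.update_self]
    refine Equiv.swap_apply_of_ne_of_ne ?_ ?_
    · unfold ghostIndex
      split_ifs with hC
      · intro h
        exact h1 hC (by rw [Sum.inl.inj h])
      · exact Sum.inr_ne_inl
    · unfold ghostIndex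
      split_ifs with hC
      · exact Sum.inl_ne_inr
      · intro h
        obtain ⟨ht, hJ⟩ := Prod.mk.inj (Sum.inr.inj h)
        exact h2 (by rw [ht]) (by simp only; rw [hJ])
  · simp only [ghostSwap, Function.update_of_ne hi, id]

omit [∀ i, MeasurableSpace (S i)] in
theorem ghostInteraction_swap_of_ne {B : Finset (Σ i, Fin (T i))} (k : Σ i, Fin (T i))
    (hk : k ∈ B) (j : Fin (n k.1)) (J : ∀ i, Fin (T i) → Fin (n i))
    (h : ∀ l ∈ B, (⟨l.1, J l.1 l.2⟩ : Σ i, Fin (n i)) ≠ ⟨k.1, j⟩)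
    (y : ∀ i, Fin (n i) ⊕ GhostIndex T n i → S i) :
    ghostInteraction f B J (fun i b => y i (ghostSwap k j i b)) = ghostInteraction f B J y := by
  unfold ghostInteraction altSum
  refine Finset.sum_congr rfl fun C hC => ?_
  have hC := Finset.mem_powerset.1 hC
  congr 1
  refine congrArg f ?_
  funext i t
  simp only [pick]
  rw [ghostSwap_ghostIndex k j C J ⟨i, t⟩ (fun hl => h _ (hC hl)) fun hl => by
    rw [hl]; exact h k hk]

-- The exchange turns `k ∈ C` into `k ∉ C` and leaves the other coordinates alone, so `altSum_swap`
-- applies. Uniqueness of the data point within `B` is essential: a second coordinate selecting it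
-- would be moved too.
omit [∀ i, MeasurableSpace (S i)] in
theorem ghostInteraction_swap_self {B : Finset (Σ i, Fin (T i))} (k : Σ i, Fin (T i))
    (hk : k ∈ B) (J : ∀ i, Fin (T i) → Fin (n i))
    (h : ∀ l ∈ B, l ≠ k → (⟨l.1, J l.1 l.2⟩ : Σ i, Fin (n i)) ≠ ⟨k.1, J k.1 k.2⟩)
    (y : ∀ i, Fin (n i) ⊕ GhostIndex T n i → S i) :
    ghostInteraction f B J (fun i b => y i (ghostSwap k (J k.1 k.2) i b)) =
      - ghostInteraction f B J y := by
  have key : ∀ C ⊆ B.erase k, ∀ l : Σ i, Fin (T i),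
      ghostSwap k (J k.1 k.2) l.1 (ghostIndex (insert k C) J l.1 l.2) =
        ghostIndex C J l.1 l.2 ∧
      ghostSwap k (J k.1 k.2) l.1 (ghostIndex C J l.1 l.2) =
        ghostIndex (insert k C) J l.1 l.2 := by
    intro C hC l
    have hkC : k ∉ C := fun h => Finset.notMem_erase k B (hC h)
    by_cases hl : l = k
    · subst hl
      have e1 : ghostIndex (insert l C) J l.1 l.2 = Sum.inl (J l.1 l.2) := by
        simp [ghostIndex]
      have e2 : ghostIndex C J l.1 l.2 = Sum.inr (l.2, J l.1 l.2) := by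
        simp [ghostIndex, hkC]
      rw [e1, e2, ghostSwap_inl, ghostSwap_inr]
      exact ⟨rfl, rfl⟩
    · have e : ghostIndex (insert k C) J l.1 l.2 = ghostIndex C J l.1 l.2 := by
        simp [ghostIndex, hl]
      rw [e, ghostSwap_ghostIndex k _ C J l
        (fun hlC => h l (Finset.mem_of_mem_erase (hC hlC)) hl) fun h => absurd h hl]
      exact ⟨rfl, rfl⟩
  refine altSum_swap hk (fun C hC => ?_) fun C hC => ?_
  · congr 1
    funext i t
    simp only [pick]
    rw [(key C hC ⟨i, t⟩).1]
  · congr 1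
    funext i t
    simp only [pick]
    rw [(key C hC ⟨i, t⟩).2]

/-- A product of interactions is centred as soon as some data point occurs only once. -/
theorem integral_prod_ghostInteraction_eq_zero (hf : Measurable f)
    {B : Finset (Σ i, Fin (T i))} {J : Fin r → ∀ i, Fin (T i) → Fin (n i)}
    (hJ : ¬ AllMatched B J) :
    ∫ y, ∏ q, ghostInteraction f B (J q) y
      ∂(sampleLaw (fun i => Fin (n i) ⊕ GhostIndex T n i) P) = 0 := by
  unfold AllMatched at hJ
  push Not at hJ
  obtain ⟨⟨q₀, k⟩, hk, hu⟩ := hJ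
  have hmp := measurePreserving_relabel P (ghostSwap k (J q₀ k.1 k.2))
    (ghostSwap_injective k (J q₀ k.1 k.2))
  -- The exchange negates the factor `q₀` and fixes the others, while the law is invariant, so the
  -- integral equals its own negative.
  have hneg : ∀ y : ∀ i, Fin (n i) ⊕ GhostIndex T n i → S i,
      ∏ q, ghostInteraction f B (J q) (fun i b => y i (ghostSwap k (J q₀ k.1 k.2) i b)) =
        - ∏ q, ghostInteraction f B (J q) y := by
    intro y
    rw [← Finset.mul_prod_erase _ _ (Finset.mem_univ q₀),
      ← Finset.mul_prod_erase _ _ (Finset.mem_univ q₀), ← neg_mul]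
    congr 1
    · refine ghostInteraction_swap_self k hk (J q₀) (fun l hl hlk => ?_) y
      exact hu (q₀, l) hl fun h => hlk (congrArg Prod.snd h)
    · refine Finset.prod_congr rfl fun q hq => ?_
      refine ghostInteraction_swap_of_ne k hk _ (J q) (fun l hl => ?_) y
      exact hu (q, l) hl fun h => Finset.ne_of_mem_erase hq (congrArg Prod.fst h)
  have hm : Measurable fun y : ∀ i, Fin (n i) ⊕ GhostIndex T n i → S i =>
      ∏ q, ghostInteraction f B (J q) y :=
    Finset.measurable_fun_prod _ fun q _ => measurable_ghostInteraction hf B (J q)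
  have h1 := integral_map hmp.measurable.aemeasurable
    (hm.aestronglyMeasurable (μ := (sampleLaw (fun i => Fin (n i) ⊕ GhostIndex T n i) P).map _))
  rw [hmp.map_eq] at h1
  simp_rw [hneg, integral_neg] at h1
  linarith

/-- The exponent `r + 1` combines the factor `(2 ^ B.card) ^ r` from `abs_sum_pow_le` with the
number `2 ^ B.card` of summands. -/
theorem integrable_abs_ghostInteraction_pow (hf : Measurable f) (h : FiniteMoments T f P r)
    (hr : 0 < r) (B : Finset (Σ i, Fin (T i))) (J : ∀ i, Fin (T i) → Fin (n i)) :
    Integrable (fun y => |ghostInteraction f B J y| ^ r)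
      (sampleLaw (fun i => Fin (n i) ⊕ GhostIndex T n i) P) ∧
    ∫ y, |ghostInteraction f B J y| ^ r
      ∂(sampleLaw (fun i => Fin (n i) ⊕ GhostIndex T n i) P) ≤
      (2 ^ B.card) ^ (r + 1) * patternMoment T f P r := by
  have hle : ∀ y : ∀ i, Fin (n i) ⊕ GhostIndex T n i → S i, |ghostInteraction f B J y| ^ r ≤
      (2 ^ B.card) ^ r * ∑ C ∈ B.powerset, |f (pick y (ghostIndex C J))| ^ r := by
    intro y
    refine (abs_sum_pow_le _ _ hr).trans (le_of_eq ?_)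
    simp [Finset.card_powerset, abs_mul, abs_pow]
  have hint : Integrable (fun y => (2 ^ B.card : ℝ) ^ r * ∑ C ∈ B.powerset,
      |f (pick y (ghostIndex C J))| ^ r)
      (sampleLaw (fun i => Fin (n i) ⊕ GhostIndex T n i) P) :=
    (integrable_finsetSum _ fun C _ => h.integrable_pick hf _).const_mul _
  have hint' : Integrable (fun y => |ghostInteraction f B J y| ^ r)
      (sampleLaw (fun i => Fin (n i) ⊕ GhostIndex T n i) P) := by
    refine hint.mono' ?_ (ae_of_all _ fun y => ?_)
    · have := measurable_ghostInteraction (S := S) hf B J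
      exact (this.abs.pow_const r).aestronglyMeasurable
    · rw [Real.norm_of_nonneg (by positivity)]
      exact hle y
  refine ⟨hint', (integral_mono hint' hint hle).trans ?_⟩
  rw [integral_const_mul, integral_finsetSum _ fun C _ => h.integrable_pick hf _, pow_succ,
    mul_assoc]
  gcongr
  calc _ ≤ ∑ _C ∈ B.powerset, patternMoment T f P r :=
        Finset.sum_le_sum fun C _ => integral_pick_le hf _
    _ = _ := by simp [Finset.card_powerset]

open Classical in
/-- The `r`-th moment of a sum of interactions is controlled by the number of matched index
maps. -/
theorem integral_sum_ghostInteraction_pow_le (hf : Measurable f) (h : FiniteMoments T f P r)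
    (hr : 0 < r) (B : Finset (Σ i, Fin (T i))) {α : Type*} [Fintype α]
    (θ : α → ∀ i, Fin (T i) → Fin (n i)) :
    Integrable (fun y => (∑ a, ghostInteraction f B (θ a) y) ^ r)
      (sampleLaw (fun i => Fin (n i) ⊕ GhostIndex T n i) P) ∧
    ∫ y, (∑ a, ghostInteraction f B (θ a) y) ^ r
      ∂(sampleLaw (fun i => Fin (n i) ⊕ GhostIndex T n i) P) ≤
      (Finset.univ.filter fun a : Fin r → α => AllMatched B fun q => θ (a q)).card *
        (r * ((2 ^ B.card) ^ (r + 1) * patternMoment T f P r)) := by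
  set ν := sampleLaw (fun i => Fin (n i) ⊕ GhostIndex T n i) P
  have hexp : ∀ y : ∀ i, Fin (n i) ⊕ GhostIndex T n i → S i,
      (∑ a, ghostInteraction f B (θ a) y) ^ r =
        ∑ a : Fin r → α, ∏ q, ghostInteraction f B (θ (a q)) y := by
    intro y
    have := Finset.prod_univ_sum (fun _ : Fin r => (Finset.univ : Finset α))
      (fun _ a => ghostInteraction f B (θ a) y)
    simpa [Fintype.piFinset_univ] using this
  have hD := fun J => integrable_abs_ghostInteraction_pow (n := n) (P := P) hf h hr B J
  have hsum : ∀ a : Fin r → α,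
      Integrable (fun y => ∑ q, |ghostInteraction f B (θ (a q)) y| ^ r) ν :=
    fun a => integrable_finsetSum _ fun q _ => (hD _).1
  have hprod : ∀ a : Fin r → α,
      Integrable (fun y => ∏ q, ghostInteraction f B (θ (a q)) y) ν := by
    intro a
    refine (hsum a).mono' ?_ (ae_of_all _ fun y => ?_)
    · exact (Finset.measurable_fun_prod _ fun q _ =>
        measurable_ghostInteraction hf B (θ (a q))).aestronglyMeasurable
    · exact abs_prod_le_sum_pow hr _
  simp_rw [hexp]
  refine ⟨integrable_finsetSum _ fun a _ => hprod a, ?_⟩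
  rw [integral_finsetSum _ fun a _ => hprod a, ← nsmul_eq_mul, ← Finset.sum_const,
    Finset.sum_filter]
  -- Matched tuples are bounded crudely, unmatched ones integrate to zero.
  refine Finset.sum_le_sum fun a _ => ?_
  split_ifs with ha
  · calc _ ≤ ∫ y, ∑ q, |ghostInteraction f B (θ (a q)) y| ^ r ∂ν :=
          integral_mono (hprod a) (hsum a) fun y =>
            (le_abs_self _).trans (abs_prod_le_sum_pow hr _)
      _ = ∑ q, ∫ y, |ghostInteraction f B (θ (a q)) y| ^ r ∂ν :=
          integral_finsetSum _ fun q _ => (hD _).1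
      _ ≤ ∑ _q : Fin r, (2 ^ B.card) ^ (r + 1) * patternMoment T f P r :=
          Finset.sum_le_sum fun q _ => (hD _).2
      _ = _ := by simp
  · rw [integral_prod_ghostInteraction_eq_zero hf ha]

end Core

/-! ### Interactions, with the ghost data averaged out, and their moments -/

section Core

variable {m : ℕ} {S : Fin m → Type*} [∀ i, MeasurableSpace (S i)] {T n : Fin m → ℕ}

/-- The mean of `f` with the coordinates in `C` frozen at `u`. -/
noncomputable def frozenMean (f : (∀ i, Fin (T i) → S i) → ℝ) (P : ∀ i, Measure (S i))
    (C : Finset (Σ i, Fin (T i))) (u : ∀ i, Fin (T i) → S i) : ℝ :=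
  ∫ w, f (blend C u w) ∂(inputLaw T P)

/-- The interaction of `f` in the coordinates `B`, at the arguments selected by `J`. -/
noncomputable def interaction (f : (∀ i, Fin (T i) → S i) → ℝ) (P : ∀ i, Measure (S i))
    (B : Finset (Σ i, Fin (T i))) (J : ∀ i, Fin (T i) → Fin (n i))
    (x : ∀ i, Fin (n i) → S i) : ℝ :=
  altSum (fun C => frozenMean f P C (pick x J)) B

variable {f : (∀ i, Fin (T i) → S i) → ℝ} {P : ∀ i, Measure (S i)}
  [∀ i, IsProbabilityMeasure (P i)] {r : ℕ}

@[fun_prop]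
theorem measurable_blend_right (C : Finset (Σ i, Fin (T i))) (u : ∀ i, Fin (T i) → S i) :
    Measurable (blend C u) :=
  (measurable_blend C).comp measurable_prodMk_left

theorem measurable_frozenMean (hf : Measurable f) (C : Finset (Σ i, Fin (T i))) :
    Measurable (frozenMean f P C) := by
  have : StronglyMeasurable fun q : (∀ i, Fin (T i) → S i) × (∀ i, Fin (T i) → S i) =>
      f (blend C q.1 q.2) := (hf.comp (measurable_blend C)).stronglyMeasurable
  exact (this.integral_prod_right' (ν := inputLaw T P)).measurable

theorem measurable_interaction (hf : Measurable f) (B : Finset (Σ i, Fin (T i)))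
    (J : ∀ i, Fin (T i) → Fin (n i)) : Measurable (interaction (S := S) f P B J) := by
  unfold interaction altSum
  have := fun C => measurable_frozenMean (P := P) hf C
  fun_prop

omit [∀ i, MeasurableSpace (S i)] in
theorem pick_joinSample (x : ∀ i, Fin (n i) → S i) (z : ∀ i, GhostIndex T n i → S i)
    (C : Finset (Σ i, Fin (T i))) (J : ∀ i, Fin (T i) → Fin (n i)) :
    pick (joinSample (x, z)) (ghostIndex C J) =
      blend C (pick x J) (fun i t => z i (t, J i t)) := by
  funext i t
  by_cases h : (⟨i, t⟩ : Σ i, Fin (T i)) ∈ C <;> simp [pick, joinSample, ghostIndex, blend, h]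

-- Distinct coordinates select distinct ghosts however much `J` collides, because each coordinate
-- owns a copy. The selected ghosts are therefore a genuine independent sample.
variable (P) in
theorem measurePreserving_ghost (J : ∀ i, Fin (T i) → Fin (n i)) :
    MeasurePreserving (fun (z : ∀ i, GhostIndex T n i → S i) i t => z i (t, J i t))
      (sampleLaw (GhostIndex T n) P) (inputLaw T P) :=
  measurePreserving_relabel P (fun i t => (t, J i t)) fun _ _ _ h => congrArg Prod.fst h

theorem frozenMean_eq_integral_ghost (hf : Measurable f) (C : Finset (Σ i, Fin (T i)))
    (J : ∀ i, Fin (T i) → Fin (n i)) (x : ∀ i, Fin (n i) → S i) :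
    frozenMean f P C (pick x J) =
      ∫ z, f (pick (joinSample (x, z)) (ghostIndex C J)) ∂(sampleLaw (GhostIndex T n) P) := by
  have h := measurePreserving_ghost (T := T) (n := n) P J
  simp_rw [pick_joinSample]
  have hm : Measurable fun w => f (blend C (pick x J) w) := hf.comp (measurable_blend_right C _)
  rw [frozenMean, ← h.map_eq, integral_map h.measurable.aemeasurable hm.aestronglyMeasurable]

variable (P) in
theorem measurePreserving_joinGhost :
    MeasurePreserving (joinSample (S := S) (κ := fun i => Fin (n i)) (β := GhostIndex T n))
      ((inputLaw n P).prod (sampleLaw (GhostIndex T n) P))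
      (sampleLaw (fun i => Fin (n i) ⊕ GhostIndex T n i) P) :=
  measurePreserving_joinSample P

theorem FiniteMoments.ae_integrable_ghost (hf : Measurable f) (h : FiniteMoments T f P r) :
    ∀ᵐ x ∂(inputLaw n P), ∀ (C : Finset (Σ i, Fin (T i))) (J : ∀ i, Fin (T i) → Fin (n i)),
      Integrable (fun z => |f (pick (joinSample (x, z)) (ghostIndex C J))| ^ r)
        (sampleLaw (GhostIndex T n) P) := by
  rw [ae_all_iff]
  intro C
  rw [ae_all_iff]
  intro J
  have hj := measurePreserving_joinGhost (T := T) (n := n) P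
  have h1 := h.integrable_pick hf (ghostIndex (n := n) C J)
  rw [← hj.map_eq] at h1
  have h2 := h1.comp_measurable hj.measurable
  exact h2.prod_right_ae

/-- The conditional moments along all index maps are finite for almost every sample. -/
theorem FiniteMoments.ae_integrable_blend (hf : Measurable f) (h : FiniteMoments T f P r) :
    ∀ᵐ x ∂(inputLaw n P), ∀ (C : Finset (Σ i, Fin (T i))) (J : ∀ i, Fin (T i) → Fin (n i)),
      Integrable (fun w => |f (blend C (pick x J) w)| ^ r) (inputLaw T P) := by
  filter_upwards [h.ae_integrable_ghost hf] with x hx C J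
  have hg := measurePreserving_ghost (T := T) (n := n) P J
  have h1 := hx C J
  simp_rw [pick_joinSample] at h1
  have hm : Measurable fun w => |f (blend C (pick x J) w)| ^ r := by
    have := hf.comp (measurable_blend_right C (pick x J))
    exact (this.abs).pow_const r
  exact (hg.integrable_comp hm.aestronglyMeasurable).1 h1

open Classical in
/-- The `r`-th moment of a sum of interactions is controlled by the number of matched index
maps. -/
theorem integral_sum_interaction_pow_le (hf : Measurable f) (h : FiniteMoments T f P r)
    (hr : 0 < r) (hr' : Even r) (B : Finset (Σ i, Fin (T i))) {α : Type*} [Fintype α]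
    (θ : α → ∀ i, Fin (T i) → Fin (n i)) :
    Integrable (fun x => (∑ a, interaction f P B (θ a) x) ^ r) (inputLaw n P) ∧
    ∫ x, (∑ a, interaction f P B (θ a) x) ^ r ∂(inputLaw n P) ≤
      (Finset.univ.filter fun a : Fin r → α => AllMatched B fun q => θ (a q)).card *
        (r * ((2 ^ B.card) ^ (r + 1) * patternMoment T f P r)) := by
  obtain ⟨hint, hle⟩ := integral_sum_ghostInteraction_pow_le (n := n) hf h hr B θ
  set G : (∀ i, Fin (n i) ⊕ GhostIndex T n i → S i) → ℝ :=
    fun y => ∑ a, ghostInteraction f B (θ a) y with hG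
  have hGm : Measurable G := by
    have := fun a => measurable_ghostInteraction (S := S) hf B (θ a)
    fun_prop
  have hj := measurePreserving_joinGhost (T := T) (n := n) P
  rw [← hj.map_eq] at hint hle
  have hint2 : Integrable (fun q => G (joinSample q) ^ r)
      ((inputLaw n P).prod (sampleLaw (GhostIndex T n) P)) := hint.comp_measurable hj.measurable
  rw [integral_map hj.measurable.aemeasurable (hGm.pow_const r).aestronglyMeasurable] at hle
  rw [integral_prod _ hint2] at hle
  have hmeas : Measurable fun x => (∑ a, interaction (S := S) f P B (θ a) x) ^ r := by
    have := fun a => measurable_interaction (S := S) (P := P) hf B (θ a)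
    fun_prop
  -- For fixed data `x` the interaction is the mean of the ghost interaction, so Jensen's inequality
  -- for the even power `r` applies pointwise; integrating in `x` gives back the joint moment.
  have hae : ∀ᵐ x ∂(inputLaw n P), (∑ a, interaction f P B (θ a) x) ^ r ≤
      ∫ z, G (joinSample (x, z)) ^ r ∂(sampleLaw (GhostIndex T n) P) := by
    filter_upwards [h.ae_integrable_ghost hf, hint2.prod_right_ae] with x hx hx2
    have hfz : ∀ C J, Integrable (fun z => f (pick (joinSample (x, z)) (ghostIndex C J)))
        (sampleLaw (GhostIndex T n) P) := fun C J =>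
      Integrable.of_abs_pow (by
        have : Measurable fun z : ∀ i, GhostIndex T n i → S i => joinSample (x, z) :=
          hj.measurable.comp measurable_prodMk_left
        exact (hf.comp ((measurable_pick _).comp this)).aestronglyMeasurable) hr (hx C J)
    have hD : ∀ a, Integrable (fun z => ghostInteraction f B (θ a) (joinSample (x, z)))
        (sampleLaw (GhostIndex T n) P) := fun a =>
      integrable_finsetSum _ fun C _ => (hfz C _).const_mul _
    have heq : ∑ a, interaction f P B (θ a) x =
        ∫ z, G (joinSample (x, z)) ∂(sampleLaw (GhostIndex T n) P) := by
      rw [hG, integral_finsetSum _ fun a _ => hD a]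
      refine Finset.sum_congr rfl fun a _ => ?_
      simp only [interaction, ghostInteraction, altSum]
      rw [integral_finsetSum _ fun C _ => (hfz C _).const_mul _]
      refine Finset.sum_congr rfl fun C _ => ?_
      rw [integral_const_mul, frozenMean_eq_integral_ghost hf]
    rw [heq]
    exact pow_integral_le hr' (integrable_finsetSum _ fun a _ => hD a) hx2
  have hint3 : Integrable (fun x => (∑ a, interaction f P B (θ a) x) ^ r) (inputLaw n P) := by
    refine hint2.integral_prod_left.mono' hmeas.aestronglyMeasurable ?_
    filter_upwards [hae] with x hx
    rw [Real.norm_of_nonneg (hr'.pow_nonneg _)]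
    exact hx
  exact ⟨hint3, (integral_mono_ae hint3 hint2.integral_prod_left hae).trans hle⟩

/-- The average of `φ` over all index maps. -/
noncomputable def indexAverage (T n : Fin m → ℕ) (φ : (∀ i, Fin (T i) → Fin (n i)) → ℝ) : ℝ :=
  (Fintype.card (∀ i, Fin (T i) → Fin (n i)) : ℝ)⁻¹ * ∑ J, φ J

/-- A constant that only depends on the number of coordinates and on the order of the moment. -/
noncomputable def momentConst (T : Fin m → ℕ) (r : ℕ) : ℝ :=
  matchConst T r * (r * (2 ^ Fintype.card (Σ i, Fin (T i))) ^ (r + 1))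

theorem momentConst_nonneg (T : Fin m → ℕ) (r : ℕ) : 0 ≤ momentConst T r := by
  unfold momentConst; positivity

open Classical in
theorem integral_indexAverage_interaction_pow_le_of_card (hf : Measurable f)
    (h : FiniteMoments T f P r)
    (hr : 0 < r) (hr' : Even r) (B : Finset (Σ i, Fin (T i)))
    (θ : (∀ i, Fin (T i) → Fin (n i)) → ∀ i, Fin (T i) → Fin (n i)) {Λ : ℕ} (hΛ : 0 < Λ)
    (hcard : Λ * (Finset.univ.filter fun J : Fin r → ∀ i, Fin (T i) → Fin (n i) =>
      AllMatched B fun q => θ (J q)).card ≤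
      matchConst T r * Fintype.card (Fin r → ∀ i, Fin (T i) → Fin (n i))) :
    Integrable (fun x => indexAverage T n (fun J => interaction f P B (θ J) x) ^ r)
      (inputLaw n P) ∧
    ∫ x, indexAverage T n (fun J => interaction f P B (θ J) x) ^ r ∂(inputLaw n P) ≤
      momentConst T r * patternMoment T f P r / Λ := by
  obtain ⟨h1, h2⟩ := integral_sum_interaction_pow_le hf h hr hr' B θ
  simp only [indexAverage, mul_pow]
  refine ⟨h1.const_mul _, ?_⟩
  rw [integral_const_mul]
  set N : ℝ := (Fintype.card (∀ i, Fin (T i) → Fin (n i)) : ℝ)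
  set b : ℝ := ((Finset.univ.filter fun J : Fin r → ∀ i, Fin (T i) → Fin (n i) =>
      AllMatched B fun q => θ (J q)).card : ℝ)
  have hc : (Λ : ℝ) * b ≤ matchConst T r * N ^ r := by
    have : ((Λ * (Finset.univ.filter fun J : Fin r → ∀ i, Fin (T i) → Fin (n i) =>
      AllMatched B fun q => θ (J q)).card : ℕ) : ℝ) ≤ _ := Nat.cast_le.2 hcard
    rw [Fintype.card_fun, Fintype.card_fin] at this
    simpa [N, b] using this
  have hM := patternMoment_nonneg f P r
  have hN : 0 ≤ N := Nat.cast_nonneg _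
  have hΛ' : (0 : ℝ) < Λ := Nat.cast_pos.2 hΛ
  have hpow : ((2 : ℝ) ^ B.card) ^ (r + 1) ≤ (2 ^ Fintype.card (Σ i, Fin (T i))) ^ (r + 1) := by
    gcongr
    · norm_num
    · exact Finset.card_le_univ B
  rw [le_div_iff₀ hΛ']
  calc N⁻¹ ^ r * (∫ x, (∑ a, interaction f P B (θ a) x) ^ r ∂(inputLaw n P)) * Λ
      ≤ N⁻¹ ^ r * (b * (r * ((2 ^ B.card) ^ (r + 1) * patternMoment T f P r))) * Λ := by
        gcongr
    _ = N⁻¹ ^ r * (Λ * b) * (r * ((2 ^ B.card) ^ (r + 1) * patternMoment T f P r)) := by ring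
    _ ≤ N⁻¹ ^ r * (matchConst T r * N ^ r) *
        (r * ((2 ^ Fintype.card (Σ i, Fin (T i))) ^ (r + 1) * patternMoment T f P r)) := by
        gcongr
    _ = (N⁻¹ * N) ^ r * (momentConst T r * patternMoment T f P r) := by
        rw [momentConst, mul_pow]; ring
    _ ≤ 1 * (momentConst T r * patternMoment T f P r) := by
        have := momentConst_nonneg T r
        gcongr
        refine pow_le_one₀ (by positivity) ?_
        -- There may be no index map at all, if some sample is empty; then `N⁻¹ * N` is `0`.
        by_cases h0 : N = 0
        · simp [h0]
        · rw [inv_mul_cancel₀ h0]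
    _ = _ := one_mul _

theorem integral_indexAverage_interaction_pow_le (hf : Measurable f) (h : FiniteMoments T f P r)
    (hr : 0 < r) (hr' : Even r) (B : Finset (Σ i, Fin (T i))) {L d : ℕ} (hL : 0 < L)
    (hLn : ∀ i, L ≤ n i) (hd : 2 * d ≤ r * B.card) :
    Integrable (fun x => indexAverage T n (fun J => interaction f P B J x) ^ r)
      (inputLaw n P) ∧
    ∫ x, indexAverage T n (fun J => interaction f P B J x) ^ r ∂(inputLaw n P) ≤
      momentConst T r * patternMoment T f P r / L ^ d := by
  have := integral_indexAverage_interaction_pow_le_of_card (n := n) hf h hr hr' B id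
    (pow_pos hL d) (pow_mul_card_allMatched_le hLn B hd)
  exact_mod_cast this

theorem integral_indexAverage_interaction_setIndex_pow_le (hf : Measurable f)
    (h : FiniteMoments T f P r) (hr : 0 < r) (hr' : Even r) {B : Finset (Σ i, Fin (T i))}
    {k l : Σ i, Fin (T i)} (hl : l ∈ B) (hlk : l ≠ k) (j : Fin (n k.1)) {L : ℕ} (hL : 0 < L)
    (hLn : ∀ i, L ≤ n i) :
    Integrable (fun x => indexAverage T n (fun J => interaction f P B (setIndex k j J) x) ^ r)
      (inputLaw n P) ∧
    ∫ x, indexAverage T n (fun J => interaction f P B (setIndex k j J) x) ^ r ∂(inputLaw n P) ≤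
      momentConst T r * patternMoment T f P r / L :=
  integral_indexAverage_interaction_pow_le_of_card (n := n) hf h hr hr' B (setIndex k j)
    hL (mul_card_allMatched_setIndex_le hLn hl hlk j hr)

end Core

/-! ### Integrals with respect to (partially) resampled input models -/

section Resample

theorem isProbabilityMeasure_empirical {S : Type*} [MeasurableSpace S] {k : ℕ} (hk : 0 < k)
    (x : Fin k → S) : IsProbabilityMeasure (empirical x) := by
  refine ⟨?_⟩
  simp [empirical, ENNReal.inv_mul_cancel (Nat.cast_ne_zero.2 hk.ne') (ENNReal.natCast_ne_top k)]

theorem integrable_empirical {S : Type*} [MeasurableSpace S] {k : ℕ} (hk : 0 < k)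
    (x : Fin k → S) {g : S → ℝ} (hg : Measurable g) : Integrable g (empirical x) := by
  refine Integrable.smul_measure ?_ (by simpa using hk.ne')
  exact integrable_finsetSum_measure.2 fun j _ =>
    integrable_dirac' hg.stronglyMeasurable (by simp)

theorem pi_empirical {S : Type*} [MeasurableSpace S] {k t : ℕ} (hk : 0 < k) (x : Fin k → S) :
    Measure.pi (fun _ : Fin t => empirical x) =
      ∑ J : Fin t → Fin k, ((k : ℝ≥0∞)⁻¹ ^ t) • Measure.dirac (fun l => x (J l)) := by
  simp only [empirical, Finset.smul_sum]
  rw [pi_sum_smul (fun _ _ => (k : ℝ≥0∞)⁻¹) (fun _ j => Measure.dirac (x j))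
    (by simpa using fun _ _ => hk.ne')]
  refine Finset.sum_congr rfl fun J _ => ?_
  rw [← Measure.infinitePi_eq_pi, Measure.infinitePi_dirac]
  simp

/-! ### Plug-in functionals as averages over index maps -/

variable {m : ℕ} {S : Fin m → Type*} [∀ i, MeasurableSpace (S i)] {T n : Fin m → ℕ}

/-- The coordinates that belong to the models in `A`. -/
def coordsOf (T : Fin m → ℕ) (A : Finset (Fin m)) : Finset (Σ i, Fin (T i)) :=
  Finset.univ.filter fun k => k.1 ∈ A

theorem mem_coordsOf {A : Finset (Fin m)} {k : Σ i, Fin (T i)} : k ∈ coordsOf T A ↔ k.1 ∈ A := by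
  simp [coordsOf]

theorem coordsOf_univ : coordsOf T Finset.univ = Finset.univ := by
  simp [coordsOf]

theorem partialResample_univ (P : ∀ i, Measure (S i)) (x : ∀ i, Fin (n i) → S i) :
    partialResample Finset.univ P x = fun i => empirical (x i) := by
  funext i
  simp [partialResample]

theorem isProbabilityMeasure_partialResample (hn : ∀ i, 0 < n i) (A : Finset (Fin m))
    (P : ∀ i, Measure (S i)) [∀ i, IsProbabilityMeasure (P i)] (x : ∀ i, Fin (n i) → S i)
    (i : Fin m) : IsProbabilityMeasure (partialResample A P x i) := by
  unfold partialResample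
  split_ifs
  · exact isProbabilityMeasure_empirical (hn i) _
  · infer_instance

variable {P : ∀ i, Measure (S i)} [∀ i, IsProbabilityMeasure (P i)]

/-- Sampling from empirical laws amounts to choosing an index map uniformly. For models outside `A`
the summand does not depend on `J i` and the weights add up to one, so one index set serves every
`A`. -/
theorem inputLaw_partialResample (hn : ∀ i, 0 < n i) (A : Finset (Fin m))
    (x : ∀ i, Fin (n i) → S i) :
    inputLaw T (partialResample A P x) =
      ∑ J : ∀ i, Fin (T i) → Fin (n i), (∏ i, (n i : ℝ≥0∞)⁻¹ ^ (T i)) •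
        (inputLaw T P).map (blend (coordsOf T A) (pick x J)) := by
  have hw : ∀ i, (n i : ℝ≥0∞)⁻¹ ^ (T i) ≠ ∞ := fun i =>
    ENNReal.pow_ne_top (by simpa using (hn i).ne')
  have hinner : ∀ i, Measure.pi (fun _ : Fin (T i) => partialResample A P x i) =
      ∑ J : Fin (T i) → Fin (n i), (n i : ℝ≥0∞)⁻¹ ^ (T i) •
        (Measure.pi fun _ : Fin (T i) => P i).map
          (fun w t => if i ∈ A then x i (J t) else w t) := by
    intro i
    by_cases hi : i ∈ A
    · simp only [partialResample, hi, if_true]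
      rw [pi_empirical (hn i)]
      simp [Measure.map_const]
    · simp only [partialResample, hi, if_false]
      rw [show (fun (w : Fin (T i) → S i) t => w t) = id from rfl, Measure.map_id,
        Finset.sum_const, ← Nat.cast_smul_eq_nsmul ℝ≥0∞, smul_smul]
      simp only [Finset.card_univ, Fintype.card_fun, Fintype.card_fin, Nat.cast_pow]
      rw [← mul_pow, ENNReal.mul_inv_cancel (by simpa using (hn i).ne')
        (ENNReal.natCast_ne_top _), one_pow, one_smul]
  have hmi : ∀ i (J : Fin (T i) → Fin (n i)), Measurable
      (fun (w : Fin (T i) → S i) t => if i ∈ A then x i (J t) else w t) := by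
    intro i J
    by_cases hi : i ∈ A <;> simp only [hi, if_true, if_false] <;> fun_prop
  have : ∀ i (J : Fin (T i) → Fin (n i)), IsProbabilityMeasure
      ((Measure.pi fun _ : Fin (T i) => P i).map
        (fun w t => if i ∈ A then x i (J t) else w t)) := fun i J =>
    Measure.isProbabilityMeasure_map (hmi i J).aemeasurable
  rw [inputLaw]
  simp_rw [hinner]
  rw [pi_sum_smul _ _ fun i _ => hw i]
  refine Finset.sum_congr rfl fun J _ => ?_
  rw [← Measure.pi_map_pi fun i => (hmi i (J i)).aemeasurable]
  congr 2
  funext w i t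
  simp [blend, pick, mem_coordsOf]

theorem integrable_inputLaw_partialResample (hn : ∀ i, 0 < n i) (A : Finset (Fin m))
    {x : ∀ i, Fin (n i) → S i} {f : (∀ i, Fin (T i) → S i) → ℝ} (hf : Measurable f)
    (hint : ∀ J : ∀ i, Fin (T i) → Fin (n i),
      Integrable (fun w => f (blend (coordsOf T A) (pick x J) w)) (inputLaw T P)) :
    Integrable f (inputLaw T (partialResample A P x)) := by
  rw [inputLaw_partialResample hn]
  refine integrable_finsetSum_measure.2 fun J _ => Integrable.smul_measure ?_
    (ENNReal.prod_ne_top fun i _ => ENNReal.pow_ne_top (by simpa using (hn i).ne'))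
  exact (integrable_map_measure hf.aestronglyMeasurable (by fun_prop)).2 (hint J)

theorem perf_partialResample (hn : ∀ i, 0 < n i) (A : Finset (Fin m))
    {x : ∀ i, Fin (n i) → S i} {f : (∀ i, Fin (T i) → S i) → ℝ} (hf : Measurable f)
    (hint : ∀ J : ∀ i, Fin (T i) → Fin (n i),
      Integrable (fun w => f (blend (coordsOf T A) (pick x J) w)) (inputLaw T P)) :
    perf T f (partialResample A P x) =
      indexAverage T n fun J => frozenMean f P (coordsOf T A) (pick x J) := by
  have hw : ∏ i, (n i : ℝ≥0∞)⁻¹ ^ (T i) ≠ ∞ :=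
    ENNReal.prod_ne_top fun i _ => ENNReal.pow_ne_top (by simpa using (hn i).ne')
  rw [perf, inputLaw_partialResample hn, integral_finsetSum_measure fun J _ => ?_]
  · rw [indexAverage, Finset.mul_sum]
    refine Finset.sum_congr rfl fun J _ => ?_
    rw [integral_smul_measure, integral_map (by fun_prop) hf.aestronglyMeasurable, frozenMean,
      smul_eq_mul]
    congr 1
    simp [ENNReal.toReal_prod, Fintype.card_pi]
  · exact ((integrable_map_measure hf.aestronglyMeasurable (by fun_prop)).2
      (hint J)).smul_measure hw

omit [∀ i, MeasurableSpace (S i)] in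
theorem blend_univ (u w : ∀ i, Fin (T i) → S i) : blend Finset.univ u w = u := by
  funext i t; simp [blend]

omit [∀ i, MeasurableSpace (S i)] in
theorem blend_empty (u w : ∀ i, Fin (T i) → S i) : blend ∅ u w = w := by
  funext i t; simp [blend]

omit [∀ i, IsProbabilityMeasure (P i)] in
theorem frozenMean_empty (f : (∀ i, Fin (T i) → S i) → ℝ) (u : ∀ i, Fin (T i) → S i) :
    frozenMean f P ∅ u = perf T f P := by
  simp [frozenMean, blend_empty, perf]

theorem frozenMean_univ (f : (∀ i, Fin (T i) → S i) → ℝ) (u : ∀ i, Fin (T i) → S i) :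
    frozenMean f P Finset.univ u = f u := by
  simp [frozenMean, blend_univ]

theorem integrable_inputLaw_empirical (hn : ∀ i, 0 < n i) (x : ∀ i, Fin (n i) → S i)
    {f : (∀ i, Fin (T i) → S i) → ℝ} (hf : Measurable f) :
    Integrable f (inputLaw T fun i => empirical (x i)) := by
  have := fun i => isProbabilityMeasure_empirical (hn i) (x i)
  rw [← partialResample_univ (fun i => empirical (x i)) x]
  refine integrable_inputLaw_partialResample hn _ hf fun J => ?_
  simp [coordsOf_univ, blend_univ]

theorem perf_empirical (hn : ∀ i, 0 < n i) (x : ∀ i, Fin (n i) → S i)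
    {f : (∀ i, Fin (T i) → S i) → ℝ} (hf : Measurable f) :
    perf T f (fun i => empirical (x i)) = indexAverage T n fun J => f (pick x J) := by
  have := fun i => isProbabilityMeasure_empirical (hn i) (x i)
  have h := perf_partialResample (P := fun i => empirical (x i)) hn Finset.univ (x := x) hf
    fun J => by simp [coordsOf_univ, blend_univ]
  rw [partialResample_univ] at h
  simpa [coordsOf_univ, frozenMean_univ] using h

theorem condMean_eq_frozenMean (f : (∀ i, Fin (T i) → S i) → ℝ) (P : ∀ i, Measure (S i))
    (i : Fin m) (t : Fin (T i)) (u : ∀ i, Fin (T i) → S i) :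
    condMean T f P i t (u i t) = frozenMean f P {⟨i, t⟩} u := by
  unfold condMean frozenMean
  congr 1
  funext w
  congr 1
  funext i' t'
  by_cases hi : i' = i
  · subst hi
    by_cases ht : t' = t
    · subst ht; simp [blend]
    · simp [blend, ht]
  · simp [blend, hi]

theorem measurable_condMean {f : (∀ i, Fin (T i) → S i) → ℝ} (hf : Measurable f)
    (i : Fin m) (t : Fin (T i)) : Measurable (condMean T f P i t) := by
  have hm : Measurable fun q : S i × (∀ i, Fin (T i) → S i) =>
      Function.update q.2 i (Function.update (q.2 i) t q.1) := by
    refine measurable_pi_lambda _ fun i' => measurable_pi_lambda _ fun t' => ?_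
    by_cases hi : i' = i
    · subst hi
      by_cases ht : t' = t
      · subst ht
        simp only [Function.update_self]
        fun_prop
      · simp only [Function.update_self, Function.update_of_ne ht]
        fun_prop
    · simp only [Function.update_of_ne hi]
      fun_prop
  exact ((hf.comp hm).stronglyMeasurable.integral_prod_right' (ν := inputLaw T P)).measurable

theorem measurePreserving_inputLaw_eval (P : ∀ i, Measure (S i)) [∀ i, IsProbabilityMeasure (P i)]
    (i : Fin m) (t : Fin (T i)) :
    MeasurePreserving (fun w : ∀ i, Fin (T i) → S i => w i t) (inputLaw T P) (P i) :=
  (measurePreserving_eval (fun _ : Fin (T i) => P i) t).comp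
    (measurePreserving_eval (fun i => Measure.pi fun _ : Fin (T i) => P i) i)

/-- A single coordinate of a sample from the empirical laws has law `empirical (x i)`, so this
integral is itself a plug-in functional, with a frozen mean as integrand. -/
theorem integral_condMean_empirical (hn : ∀ i, 0 < n i) (x : ∀ i, Fin (n i) → S i)
    {f : (∀ i, Fin (T i) → S i) → ℝ} (hf : Measurable f) (i : Fin m) (t : Fin (T i)) :
    ∫ z, condMean T f P i t z ∂(empirical (x i)) =
      indexAverage T n fun J => frozenMean f P {⟨i, t⟩} (pick x J) := by
  have := fun i => isProbabilityMeasure_empirical (hn i) (x i)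
  have h := measurePreserving_inputLaw_eval (fun i => empirical (x i)) i t
  have hc := measurable_condMean (P := P) hf i t
  rw [← h.map_eq, integral_map h.measurable.aemeasurable hc.aestronglyMeasurable]
  simp_rw [condMean_eq_frozenMean]
  exact perf_empirical hn x (measurable_frozenMean hf _)

/-- The joint law of independent coordinates which have the law given by `Q` for the coordinates
in `C`, and by `P` for the others. -/
noncomputable def mixedLaw (C : Finset (Σ i, Fin (T i))) (Q P : ∀ i, Measure (S i)) :
    Measure (∀ i, Fin (T i) → S i) :=
  Measure.pi fun i => Measure.pi fun t => if ⟨i, t⟩ ∈ C then Q i else P i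

theorem mixedLaw_self (C : Finset (Σ i, Fin (T i))) (P : ∀ i, Measure (S i)) :
    mixedLaw C P P = inputLaw T P := by
  simp only [mixedLaw, inputLaw, ite_self]

theorem mixedLaw_empty (Q P : ∀ i, Measure (S i)) : mixedLaw ∅ Q P = inputLaw T P := by
  simp only [mixedLaw, inputLaw, Finset.notMem_empty, if_false]

/-! ### Frozen means and influence functions integrated under a second family of laws -/

variable {Q : ∀ i, Measure (S i)} [∀ i, IsProbabilityMeasure (Q i)]

theorem measurePreserving_blend_mixedLaw (C : Finset (Σ i, Fin (T i))) :
    MeasurePreserving (fun q : (∀ i, Fin (T i) → S i) × (∀ i, Fin (T i) → S i) =>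
      blend C q.1 q.2) ((inputLaw T Q).prod (inputLaw T P)) (mixedLaw C Q P) :=
  measurePreserving_blend C (fun i (_ : Fin (T i)) => P i) (fun i (_ : Fin (T i)) => Q i)

theorem integrable_frozenMean {f : (∀ i, Fin (T i) → S i) → ℝ} (hf : Measurable f)
    {C : Finset (Σ i, Fin (T i))} (hint : Integrable f (mixedLaw C Q P)) :
    Integrable (frozenMean f P C) (inputLaw T Q) ∧
      ∫ u, frozenMean f P C u ∂(inputLaw T Q) = ∫ x, f x ∂(mixedLaw C Q P) := by
  have h := measurePreserving_blend_mixedLaw (P := P) (Q := Q) C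
  have h1 : Integrable (fun q : (∀ i, Fin (T i) → S i) × (∀ i, Fin (T i) → S i) =>
      f (blend C q.1 q.2)) ((inputLaw T Q).prod (inputLaw T P)) := by
    rw [← h.map_eq] at hint
    exact hint.comp_measurable h.measurable
  refine ⟨h1.integral_prod_left, ?_⟩
  unfold frozenMean
  rw [← integral_prod _ h1]
  conv_rhs => rw [← h.map_eq]
  rw [integral_map h.measurable.aemeasurable hf.aestronglyMeasurable]

theorem integrable_condMean {f : (∀ i, Fin (T i) → S i) → ℝ} (hf : Measurable f)
    {i : Fin m} {t : Fin (T i)} (hint : Integrable f (mixedLaw {⟨i, t⟩} Q P)) :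
    Integrable (condMean T f P i t) (Q i) ∧
      ∫ z, condMean T f P i t z ∂(Q i) = ∫ x, f x ∂(mixedLaw {⟨i, t⟩} Q P) := by
  have h := measurePreserving_inputLaw_eval Q i t
  have hc := measurable_condMean (P := P) hf i t
  have h1 := integrable_frozenMean hf hint
  constructor
  · refine (h.integrable_comp hc.aestronglyMeasurable).1 ?_
    refine h1.1.congr (ae_of_all _ fun u => ?_)
    exact (condMean_eq_frozenMean f P i t u).symm
  · rw [← h1.2]
    nth_rewrite 1 [← h.map_eq]
    rw [integral_map h.measurable.aemeasurable hc.aestronglyMeasurable]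
    simp_rw [condMean_eq_frozenMean]

theorem integrable_influence_of_mixedLaw {f : (∀ i, Fin (T i) → S i) → ℝ} (hf : Measurable f)
    {i : Fin m} (hint : ∀ t, Integrable f (mixedLaw {⟨i, t⟩} Q P)) :
    Integrable (influence T f P i) (Q i) ∧
      ∫ z, influence T f P i z ∂(Q i) =
        ∑ t, (∫ x, f x ∂(mixedLaw {⟨i, t⟩} Q P) - perf T f P) := by
  have h := fun t => integrable_condMean hf (hint t)
  have hs : Integrable (fun z => ∑ t, condMean T f P i t z) (Q i) :=
    integrable_finsetSum _ fun t _ => (h t).1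
  refine ⟨hs.sub (integrable_const _), ?_⟩
  unfold influence
  rw [integral_sub hs (integrable_const _), integral_finsetSum _ fun t _ => (h t).1]
  simp [fun t => (h t).2]

theorem integrable_influence {f : (∀ i, Fin (T i) → S i) → ℝ} (hf : Measurable f)
    (hint : Integrable f (inputLaw T P)) (i : Fin m) :
    Integrable (influence T f P i) (P i) ∧ ∫ z, influence T f P i z ∂(P i) = 0 := by
  obtain ⟨h1, h2⟩ := integrable_influence_of_mixedLaw (P := P) (Q := P) (i := i) hf
    fun t => by rwa [mixedLaw_self]
  refine ⟨h1, h2.trans (Finset.sum_eq_zero fun t _ => ?_)⟩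
  rw [mixedLaw_self, perf, sub_self]

theorem integral_influence_empirical (hn : ∀ i, 0 < n i) (x : ∀ i, Fin (n i) → S i)
    {f : (∀ i, Fin (T i) → S i) → ℝ} (hf : Measurable f) (i : Fin m) :
    ∫ z, influence T f P i z ∂(empirical (x i)) = ∑ t, indexAverage T n fun J =>
      (frozenMean f P {⟨i, t⟩} (pick x J) - frozenMean f P ∅ (pick x J)) := by
  have := isProbabilityMeasure_empirical (hn i) (x i)
  have hc := fun t => integrable_empirical (hn i) (x i) (measurable_condMean (P := P) hf i t)
  unfold influence
  rw [integral_sub (integrable_finsetSum _ fun t _ => hc t) (integrable_const _),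
    integral_finsetSum _ fun t _ => hc t]
  simp_rw [integral_condMean_empirical hn x hf, frozenMean_empty, indexAverage,
    Finset.sum_sub_distrib, mul_sub, Finset.sum_sub_distrib]
  have hpos : (Fintype.card (∀ i, Fin (T i) → Fin (n i)) : ℝ) ≠ 0 := by
    have : ∀ i, Nonempty (Fin (n i)) := fun i => ⟨⟨0, hn i⟩⟩
    exact Nat.cast_ne_zero.2 Fintype.card_ne_zero
  simp only [integral_const, probReal_univ, one_smul, Finset.sum_const, Finset.card_univ,
    nsmul_eq_mul, Fintype.card_fin]
  rw [inv_mul_cancel_left₀ hpos]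

theorem indexAverage_sum {ι : Type*} (s : Finset ι)
    (φ : ι → (∀ i, Fin (T i) → Fin (n i)) → ℝ) :
    indexAverage T n (fun J => ∑ b ∈ s, φ b J) = ∑ b ∈ s, indexAverage T n (φ b) := by
  simp only [indexAverage]
  rw [Finset.sum_comm, Finset.mul_sum]

theorem indexAverage_sub (φ φ' : (∀ i, Fin (T i) → Fin (n i)) → ℝ) :
    indexAverage T n (fun J => φ J - φ' J) = indexAverage T n φ - indexAverage T n φ' := by
  simp only [indexAverage]
  rw [Finset.sum_sub_distrib, mul_sub]

theorem indexAverage_const (hn : ∀ i, 0 < n i) (c : ℝ) : indexAverage T n (fun _ => c) = c := by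
  have hpos : (Fintype.card (∀ i, Fin (T i) → Fin (n i)) : ℝ) ≠ 0 := by
    have : ∀ i, Nonempty (Fin (n i)) := fun i => ⟨⟨0, hn i⟩⟩
    exact Nat.cast_ne_zero.2 Fintype.card_ne_zero
  simp only [indexAverage, Finset.sum_const, Finset.card_univ, nsmul_eq_mul]
  rw [inv_mul_cancel_left₀ hpos]

/-- Möbius inversion under the index average: freezing all coordinates of `A` gives the resampled
functional, freezing none the original one. -/
theorem perf_partialResample_sub (hn : ∀ i, 0 < n i) (A : Finset (Fin m))
    {x : ∀ i, Fin (n i) → S i} {f : (∀ i, Fin (T i) → S i) → ℝ} (hf : Measurable f)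
    (hint : ∀ J : ∀ i, Fin (T i) → Fin (n i),
      Integrable (fun w => f (blend (coordsOf T A) (pick x J) w)) (inputLaw T P)) :
    perf T f (partialResample A P x) - perf T f P =
      ∑ B ∈ (coordsOf T A).powerset with 1 ≤ B.card,
        indexAverage T n fun J => interaction f P B J x := by
  rw [perf_partialResample hn A hf hint, ← indexAverage_sum]
  unfold interaction
  simp_rw [sum_altSum_nonempty, frozenMean_empty]
  rw [indexAverage_sub, indexAverage_const hn]

/-- The singleton interactions add up to the linear term: those of a resampled model integrate its
influence function, while a model outside `A` has no coordinate in `coordsOf T A` and no increment.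
-/
theorem remainder_partialResample (hn : ∀ i, 0 < n i) (A : Finset (Fin m))
    {x : ∀ i, Fin (n i) → S i} {f : (∀ i, Fin (T i) → S i) → ℝ} (hf : Measurable f)
    (hfP : Integrable f (inputLaw T P))
    (hint : ∀ J : ∀ i, Fin (T i) → Fin (n i),
      Integrable (fun w => f (blend (coordsOf T A) (pick x J) w)) (inputLaw T P)) :
    remainder (perf T f) (influence T f) P (partialResample A P x) =
      ∑ B ∈ (coordsOf T A).powerset with 2 ≤ B.card,
        indexAverage T n fun J => interaction f P B J x := by
  rw [remainder, perf_partialResample hn A hf hint, ← indexAverage_sum]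
  unfold interaction
  simp_rw [sum_altSum_two_le]
  rw [indexAverage_sub, indexAverage_sub, indexAverage_sum]
  simp_rw [frozenMean_empty]
  rw [indexAverage_const hn]
  congr 1
  rw [coordsOf, Finset.sum_filter, Fintype.sum_sigma]
  refine Finset.sum_congr rfl fun i _ => ?_
  rw [(integrable_influence hf hfP i).2, sub_zero]
  by_cases hi : i ∈ A
  · simp only [partialResample, hi, if_true]
    rw [integral_influence_empirical hn x hf]
    refine Finset.sum_congr rfl fun t _ => ?_
    simp only [frozenMean_empty]
  · simp only [partialResample, hi, if_false, Finset.sum_const_zero,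
      (integrable_influence hf hfP i).2]

end Resample

/-! ### Moment bounds for plug-in estimators -/

section Bounds

theorem integral_sum_pow_le {Ω ι : Type*} [MeasurableSpace Ω] {μ : Measure Ω} {s : Finset ι}
    {a : ι → Ω → ℝ} {r : ℕ} (hr : 0 < r) (hr' : Even r) {c : ℝ} (hm : ∀ i ∈ s, Measurable (a i))
    (hi : ∀ i ∈ s, Integrable (fun ω => a i ω ^ r) μ)
    (hc : ∀ i ∈ s, ∫ ω, a i ω ^ r ∂μ ≤ c) :
    Integrable (fun ω => (∑ i ∈ s, a i ω) ^ r) μ ∧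
      ∫ ω, (∑ i ∈ s, a i ω) ^ r ∂μ ≤ (s.card : ℝ) ^ (r + 1) * c := by
  have hle : ∀ ω, (∑ i ∈ s, a i ω) ^ r ≤ (s.card : ℝ) ^ r * ∑ i ∈ s, a i ω ^ r := fun ω => by
    have := abs_sum_pow_le s (fun i => a i ω) hr
    simpa only [hr'.pow_abs] using this
  have hint : Integrable (fun ω => (s.card : ℝ) ^ r * ∑ i ∈ s, a i ω ^ r) μ :=
    (integrable_finsetSum _ hi).const_mul _
  have hint' : Integrable (fun ω => (∑ i ∈ s, a i ω) ^ r) μ := by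
    refine hint.mono' ?_ (ae_of_all _ fun ω => ?_)
    · exact ((Finset.measurable_fun_sum s hm).pow_const r).aestronglyMeasurable
    · rw [Real.norm_of_nonneg (hr'.pow_nonneg _)]
      exact hle ω
  refine ⟨hint', (integral_mono hint' hint hle).trans ?_⟩
  rw [integral_const_mul, integral_finsetSum _ hi, pow_succ, mul_assoc]
  gcongr
  calc _ ≤ ∑ _i ∈ s, c := Finset.sum_le_sum hc
    _ = _ := by simp

variable {m : ℕ} {S : Fin m → Type*} [∀ i, MeasurableSpace (S i)] {T n : Fin m → ℕ}
  {f : (∀ i, Fin (T i) → S i) → ℝ} {P : ∀ i, Measure (S i)}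
  [∀ i, IsProbabilityMeasure (P i)] {r L : ℕ}

@[fun_prop]
theorem measurable_indexAverage {Ω : Type*} [MeasurableSpace Ω]
    {φ : Ω → (∀ i, Fin (T i) → Fin (n i)) → ℝ} (h : ∀ J, Measurable fun ω => φ ω J) :
    Measurable fun ω => indexAverage T n (φ ω) := by
  unfold indexAverage; fun_prop

/-- A constant that only depends on the number of coordinates and on the order of the moment. -/
noncomputable def expansionConst (T : Fin m → ℕ) (r : ℕ) : ℝ :=
  (Fintype.card (Finset (Σ i, Fin (T i)))) ^ (r + 1) * momentConst T r

theorem expansionConst_nonneg (T : Fin m → ℕ) (r : ℕ) : 0 ≤ expansionConst T r :=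
  mul_nonneg (by positivity) (momentConst_nonneg T r)

theorem expansion_bound (𝒮 : Finset (Finset (Σ i, Fin (T i)))) {M : ℝ} (hM : 0 ≤ M) :
    (𝒮.card : ℝ) ^ (r + 1) * (momentConst T r * M) ≤ expansionConst T r * M := by
  have := momentConst_nonneg T r
  rw [expansionConst, mul_assoc]
  gcongr
  exact Finset.card_le_univ _

theorem integral_sum_indexAverage_pow_le (hf : Measurable f) (h : FiniteMoments T f P r)
    (hr : 0 < r) (hr' : Even r) (hL : 0 < L) (hLn : ∀ i, L ≤ n i)
    (𝒮 : Finset (Finset (Σ i, Fin (T i)))) {d : ℕ} (hd : ∀ B ∈ 𝒮, 2 * d ≤ r * B.card) :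
    Integrable (fun x => (∑ B ∈ 𝒮, indexAverage T n fun J => interaction f P B J x) ^ r)
      (inputLaw n P) ∧
    ∫ x, (∑ B ∈ 𝒮, indexAverage T n fun J => interaction f P B J x) ^ r ∂(inputLaw n P) ≤
      expansionConst T r * patternMoment T f P r / L ^ d := by
  have hb := fun B (hB : B ∈ 𝒮) =>
    integral_indexAverage_interaction_pow_le (n := n) hf h hr hr' B hL hLn (hd B hB)
  obtain ⟨h1, h2⟩ := integral_sum_pow_le hr hr' (s := 𝒮)
    (a := fun B x => indexAverage T n fun J => interaction f P B J x)
    (fun B _ => measurable_indexAverage fun J => measurable_interaction hf B J)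
    (fun B hB => (hb B hB).1) (fun B hB => (hb B hB).2)
  refine ⟨h1, h2.trans ?_⟩
  have := patternMoment_nonneg f P r
  rw [mul_div_assoc, mul_div_assoc]
  exact expansion_bound 𝒮 (by positivity)

theorem integral_sum_indexAverage_setIndex_pow_le (hf : Measurable f) (h : FiniteMoments T f P r)
    (hr : 0 < r) (hr' : Even r) (hL : 0 < L) (hLn : ∀ i, L ≤ n i)
    (k : Σ i, Fin (T i)) (j : Fin (n k.1)) (𝒮 : Finset (Finset (Σ i, Fin (T i))))
    (h𝒮 : ∀ B ∈ 𝒮, ∃ l ∈ B, l ≠ k) :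
    Integrable (fun x => (∑ B ∈ 𝒮, indexAverage T n fun J =>
      interaction f P B (setIndex k j J) x) ^ r) (inputLaw n P) ∧
    ∫ x, (∑ B ∈ 𝒮, indexAverage T n fun J => interaction f P B (setIndex k j J) x) ^ r
      ∂(inputLaw n P) ≤ expansionConst T r * (patternMoment T f P r / L) := by
  have hb := fun B (hB : B ∈ 𝒮) => integral_indexAverage_interaction_setIndex_pow_le (n := n)
    hf h hr hr' (h𝒮 B hB).choose_spec.1 (h𝒮 B hB).choose_spec.2 j hL hLn
  obtain ⟨h1, h2⟩ := integral_sum_pow_le hr hr' (s := 𝒮)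
    (a := fun B x => indexAverage T n fun J => interaction f P B (setIndex k j J) x)
    (fun B _ => measurable_indexAverage fun J => measurable_interaction hf B _)
    (fun B hB => (hb B hB).1) (fun B hB => (hb B hB).2)
  refine ⟨h1, h2.trans ?_⟩
  have := patternMoment_nonneg f P r
  rw [mul_div_assoc]
  exact expansion_bound 𝒮 (by positivity)

theorem FiniteMoments.ae_integrable_partialResample (hf : Measurable f)
    (h : FiniteMoments T f P r) (hr : 0 < r) (A : Finset (Fin m)) :
    ∀ᵐ x ∂(inputLaw n P), ∀ J : ∀ i, Fin (T i) → Fin (n i),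
      Integrable (fun w => f (blend (coordsOf T A) (pick x J) w)) (inputLaw T P) := by
  filter_upwards [h.ae_integrable_blend hf] with x hx J
  refine Integrable.of_abs_pow ?_ hr (hx _ J)
  have : Measurable fun w => f (blend (coordsOf T A) (pick x J) w) :=
    hf.comp (measurable_blend_right _ _)
  exact this.aestronglyMeasurable

theorem FiniteMoments.integrable (hf : Measurable f) (h : FiniteMoments T f P r) (hr : 0 < r) :
    Integrable f (inputLaw T P) :=
  Integrable.of_abs_pow hf.aestronglyMeasurable hr (h (fun _ t => t) fun _ _ => le_rfl)

/-- The plug-in estimator is consistent in `r`-th mean. -/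
theorem integral_perf_partialResample_sub_pow_le (hf : Measurable f) (h : FiniteMoments T f P r)
    (hr : 0 < r) (hr' : Even r) (hL : 0 < L) (hLn : ∀ i, L ≤ n i) (A : Finset (Fin m)) :
    Integrable (fun x => (perf T f (partialResample A P x) - perf T f P) ^ r) (inputLaw n P) ∧
    ∫ x, (perf T f (partialResample A P x) - perf T f P) ^ r ∂(inputLaw n P) ≤
      expansionConst T r * patternMoment T f P r / L := by
  have hn : ∀ i, 0 < n i := fun i => hL.trans_le (hLn i)
  -- Singletons only allow `2 * d ≤ r`; `d = 1` is admissible for every positive even `r` and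
  -- suffices for consistency.
  obtain ⟨h1, h2⟩ := integral_sum_indexAverage_pow_le (n := n) hf h hr hr' hL hLn
    ((coordsOf T A).powerset.filter fun B => 1 ≤ B.card) (d := 1) (fun B hB => by
      have h1 : 1 ≤ B.card := (Finset.mem_filter.1 hB).2
      have h2 : 2 ≤ r := by obtain ⟨k, hk⟩ := hr'; omega
      nlinarith)
  have hae : (fun x => (∑ B ∈ (coordsOf T A).powerset with 1 ≤ B.card,
      indexAverage T n fun J => interaction f P B J x) ^ r) =ᵐ[inputLaw n P]
      fun x => (perf T f (partialResample A P x) - perf T f P) ^ r := by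
    filter_upwards [h.ae_integrable_partialResample hf hr A] with x hx
    rw [perf_partialResample_sub hn A hf hx]
  refine ⟨h1.congr hae, ?_⟩
  rw [← integral_congr_ae hae]
  simpa using h2

/-- The remainder of the first order expansion of the plug-in estimator. -/
theorem integral_remainder_pow_le (hf : Measurable f) (h : FiniteMoments T f P r)
    (hr : 0 < r) (hr' : Even r) (hL : 0 < L) (hLn : ∀ i, L ≤ n i) (A : Finset (Fin m)) :
    Integrable (fun x => remainder (perf T f) (influence T f) P (partialResample A P x) ^ r)
      (inputLaw n P) ∧
    ∫ x, remainder (perf T f) (influence T f) P (partialResample A P x) ^ r ∂(inputLaw n P) ≤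
      expansionConst T r * patternMoment T f P r / L ^ r := by
  have hn : ∀ i, 0 < n i := fun i => hL.trans_le (hLn i)
  -- With `2 ≤ B.card`, half of the `r * B.card` slots are at least `r` slots, so `d = r` is
  -- admissible.
  obtain ⟨h1, h2⟩ := integral_sum_indexAverage_pow_le (n := n) hf h hr hr' hL hLn
    ((coordsOf T A).powerset.filter fun B => 2 ≤ B.card) (d := r) (fun B hB => by
      have h1 : 2 ≤ B.card := (Finset.mem_filter.1 hB).2
      nlinarith)
  have hae : (fun x => (∑ B ∈ (coordsOf T A).powerset with 2 ≤ B.card,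
      indexAverage T n fun J => interaction f P B J x) ^ r) =ᵐ[inputLaw n P]
      fun x => remainder (perf T f) (influence T f) P (partialResample A P x) ^ r := by
    filter_upwards [h.ae_integrable_partialResample hf hr A] with x hx
    rw [remainder_partialResample hn A hf (h.integrable hf hr) hx]
  refine ⟨h1.congr hae, ?_⟩
  rw [← integral_congr_ae hae]
  exact h2

/-! #### Variances and fourth moments -/

theorem FiniteMoments.two_of_four (hf : Measurable f) (h : FiniteMoments T f P 4) :
    FiniteMoments T f P 2 := by
  intro I hI
  refine Integrable.of_abs_pow (r := 2) ?_ two_pos ?_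
  · have : Measurable fun x : ∀ i, Fin (T i) → S i => |f (fun i t => x i (I i t))| ^ 2 := by
      fun_prop
    exact this.aestronglyMeasurable
  · refine (h I hI).congr (ae_of_all _ fun x => ?_)
    simp only [abs_pow, abs_abs, ← pow_mul]

omit [∀ i, IsProbabilityMeasure (P i)] in
theorem FiniteMoments.sq (h : FiniteMoments T f P 4) :
    FiniteMoments T (fun x => f x ^ 2) P 2 := by
  intro I hI
  refine (h I hI).congr (ae_of_all _ fun x => ?_)
  simp only [abs_pow, ← pow_mul]

omit [∀ i, IsProbabilityMeasure (P i)] in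
theorem patternMoment_sq : patternMoment T (fun x => f x ^ 2) P 2 = patternMoment T f P 4 := by
  unfold patternMoment
  simp only [abs_pow, ← pow_mul]

/-- Cauchy–Schwarz over the patterns, and Jensen's inequality within each pattern. -/
theorem sq_patternMoment_two_le (hf : Measurable f) (h : FiniteMoments T f P 4) :
    patternMoment T f P 2 ^ 2 ≤
      Fintype.card (∀ i, Fin (T i) → Fin (T i)) * patternMoment T f P 4 := by
  unfold patternMoment
  refine sq_sum_le_card_mul_sum_sq.trans ?_
  rw [Finset.card_univ]
  gcongr with I
  have h4 := h.integrable_pick (κ := fun i => Fin (T i)) hf I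
  have h2 := (h.two_of_four hf).integrable_pick (κ := fun i => Fin (T i)) hf I
  have e : (fun x : ∀ i, Fin (T i) → S i => |f (pick x I)| ^ 4) =
      fun x => (|f (pick x I)| ^ 2) ^ 2 := by
    funext x; rw [← pow_mul]
  rw [e] at h4 ⊢
  exact pow_integral_le even_two h2 h4

theorem sq_perf_le (hf : Measurable f) (h : FiniteMoments T f P 2) :
    perf T f P ^ 2 ≤ patternMoment T f P 2 := by
  have h2 := h.integrable_pick (κ := fun i => Fin (T i)) hf fun _ t => t
  simp only [sq_abs] at h2
  calc perf T f P ^ 2 ≤ ∫ x, f x ^ 2 ∂(inputLaw T P) :=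
        pow_integral_le even_two (h.integrable hf two_pos) h2
    _ = ∫ x, |f (pick x fun _ t => t)| ^ 2 ∂(sampleLaw (fun i => Fin (T i)) P) := by
        simp only [sq_abs]; rfl
    _ ≤ _ := integral_pick_le hf _

theorem simVariance_eq (hf : Integrable f (inputLaw T P))
    (hf2 : Integrable (fun x => f x ^ 2) (inputLaw T P)) :
    simVariance T f P = perf T (fun x => f x ^ 2) P - perf T f P ^ 2 := by
  unfold simVariance
  set c := perf T f P with hc
  have e : ∀ x, (f x - c) ^ 2 = f x ^ 2 - (2 * c) * f x + c ^ 2 := fun x => by ring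
  have hsub : Integrable (fun x => f x ^ 2 - 2 * c * f x) (inputLaw T P) :=
    hf2.sub (hf.const_mul _)
  simp_rw [e]
  rw [integral_add hsub (integrable_const _),
    integral_sub hf2 (hf.const_mul _), integral_const_mul]
  have : ∫ x, f x ∂(inputLaw T P) = c := rfl
  rw [this]
  simp [perf]
  ring

/-- A constant that only depends on the number of coordinates. -/
noncomputable def varianceConst (T : Fin m → ℕ) : ℝ :=
  2 * expansionConst T 2 + 4 * expansionConst T 4 +
    16 * (Fintype.card (∀ i, Fin (T i) → Fin (T i)) * expansionConst T 2)

theorem varianceConst_nonneg (T : Fin m → ℕ) : 0 ≤ varianceConst T := by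
  have h2 := expansionConst_nonneg T 2
  have h4 := expansionConst_nonneg T 4
  unfold varianceConst
  positivity

/-- The simulation variance at the resampled models is close to the original one in mean
square. -/
theorem exists_simVariance_sub_sq_le (hf : Measurable f) (h : FiniteMoments T f P 4)
    (hL : 0 < L) (hLn : ∀ i, L ≤ n i) (A : Finset (Fin m)) :
    ∃ G : (∀ i, Fin (n i) → S i) → ℝ, Integrable G (inputLaw n P) ∧
      (∀ᵐ x ∂(inputLaw n P),
        (simVariance T f (partialResample A P x) - simVariance T f P) ^ 2 ≤ G x) ∧
      ∫ x, G x ∂(inputLaw n P) ≤ varianceConst T * patternMoment T f P 4 / L := by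
  have hn : ∀ i, 0 < n i := fun i => hL.trans_le (hLn i)
  have hL' : (0 : ℝ) < L := Nat.cast_pos.2 hL
  have hf2 : Measurable fun x => f x ^ 2 := hf.pow_const 2
  have h2 := h.two_of_four hf
  obtain ⟨i1, b1⟩ := integral_perf_partialResample_sub_pow_le hf2 h.sq two_pos even_two hL hLn A
  obtain ⟨i2, b2⟩ := integral_perf_partialResample_sub_pow_le hf h2 two_pos even_two hL hLn A
  obtain ⟨i3, b3⟩ := integral_perf_partialResample_sub_pow_le hf h four_pos
    (by decide) hL hLn A
  rw [patternMoment_sq] at b1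
  set b := perf T f P with hb
  -- The dominating function comes from `(y - z (z + 2b))² ≤ 2y² + 4z⁴ + 16b²z²`, where `y` and `z`
  -- are the increments of the means of `f²` and `f`. Domination requires no measurability of the
  -- variance increment.
  refine ⟨_, ((i1.const_mul 2).add (i3.const_mul 4)).add (i2.const_mul (16 * b ^ 2)), ?_, ?_⟩
  · filter_upwards [h2.ae_integrable_partialResample hf two_pos A,
      h.sq.ae_integrable_partialResample hf2 two_pos A] with x hx hx2
    have := isProbabilityMeasure_partialResample hn A P x
    rw [simVariance_eq (integrable_inputLaw_partialResample hn A hf hx)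
        (integrable_inputLaw_partialResample hn A hf2 hx2),
      simVariance_eq (h2.integrable hf two_pos) (h.sq.integrable hf2 two_pos)]
    simp only [Pi.add_apply]
    rw [← hb]
    set a := perf T f (partialResample A P x)
    set u := perf T (fun x => f x ^ 2) (partialResample A P x)
    set v := perf T (fun x => f x ^ 2) P
    have e : u - a ^ 2 - (v - b ^ 2) = (u - v) - (a - b) * ((a - b) + 2 * b) := by ring
    rw [e]
    generalize u - v = y
    generalize a - b = z
    nlinarith [sq_nonneg (y + z * (z + 2 * b)), sq_nonneg (z * (z - 2 * b))]
  · rw [integral_add' ((i1.const_mul 2).add (i3.const_mul 4)) (i2.const_mul (16 * b ^ 2)),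
      integral_add' (i1.const_mul 2) (i3.const_mul 4), integral_const_mul, integral_const_mul,
      integral_const_mul]
    have hb2 : b ^ 2 ≤ patternMoment T f P 2 := sq_perf_le hf h2
    have hM2 := patternMoment_nonneg f P 2
    have hM := sq_patternMoment_two_le hf h
    have hc := expansionConst_nonneg T 2
    -- As `b ^ 2` is at most the second pattern moment, this term is quadratic in that moment, hence
    -- controlled by the fourth.
    have hlast : b ^ 2 * (expansionConst T 2 * patternMoment T f P 2 / L) ≤
        expansionConst T 2 * (Fintype.card (∀ i, Fin (T i) → Fin (T i)) *
          patternMoment T f P 4) / L := by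
      calc _ ≤ patternMoment T f P 2 * (expansionConst T 2 * patternMoment T f P 2 / L) := by
            gcongr
        _ = expansionConst T 2 * (patternMoment T f P 2 ^ 2) / L := by ring
        _ ≤ _ := by gcongr
    calc _ ≤ 2 * (expansionConst T 2 * patternMoment T f P 4 / L) +
          4 * (expansionConst T 4 * patternMoment T f P 4 / L) +
          16 * (expansionConst T 2 * (Fintype.card (∀ i, Fin (T i) → Fin (T i)) *
          patternMoment T f P 4) / L) := by
            have := mul_le_mul_of_nonneg_left b2 (sq_nonneg b)
            linarith
      _ = _ := by rw [varianceConst]; ring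

/-- The mean of a moment at the resampled models. -/
theorem integral_indexAverage_frozenMean_abs_pow_le (hf : Measurable f)
    (h : FiniteMoments T f P r) (hn : ∀ i, 0 < n i) (C : Finset (Σ i, Fin (T i))) :
    Integrable (fun x => indexAverage T n fun J => frozenMean (fun y => |f y| ^ r) P C (pick x J))
      (inputLaw n P) ∧
    ∫ x, (indexAverage T n fun J => frozenMean (fun y => |f y| ^ r) P C (pick x J))
      ∂(inputLaw n P) ≤ patternMoment T f P r := by
  have hm : Measurable fun y => |f y| ^ r := by fun_prop
  have key : ∀ J : ∀ i, Fin (T i) → Fin (n i),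
      Integrable (fun x => frozenMean (fun y => |f y| ^ r) P C (pick x J)) (inputLaw n P) ∧
      ∫ x, frozenMean (fun y => |f y| ^ r) P C (pick x J) ∂(inputLaw n P) ≤
        patternMoment T f P r := by
    intro J
    have hj := measurePreserving_joinGhost (T := T) (n := n) P
    have h1 := h.integrable_pick hf (ghostIndex (n := n) C J)
    have h2 := integral_pick_le (P := P) (r := r) hf (ghostIndex (n := n) C J)
    rw [← hj.map_eq] at h1 h2
    have h3 : Integrable (fun q => |f (pick (joinSample q) (ghostIndex C J))| ^ r)
      ((inputLaw n P).prod (sampleLaw (GhostIndex T n) P)) := h1.comp_measurable hj.measurable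
    rw [integral_map hj.measurable.aemeasurable
      (Measurable.aestronglyMeasurable (by fun_prop)), integral_prod _ h3] at h2
    simp_rw [frozenMean_eq_integral_ghost hm]
    exact ⟨h3.integral_prod_left, h2⟩
  unfold indexAverage
  refine ⟨(integrable_finsetSum _ fun J _ => (key J).1).const_mul _, ?_⟩
  rw [integral_const_mul, integral_finsetSum _ fun J _ => (key J).1]
  calc _ ≤ (Fintype.card (∀ i, Fin (T i) → Fin (n i)) : ℝ)⁻¹ *
        ∑ _J : ∀ i, Fin (T i) → Fin (n i), patternMoment T f P r := by
        gcongr with J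
        exact (key J).2
    _ = _ := indexAverage_const hn _

/-- Combines `(a - c)⁴ ≤ 8a⁴ + 8c⁴` with Jensen's inequality for the mean `c`. -/
theorem simFourthMoment_le (hf : Measurable f)
    (h4 : Integrable (fun x => |f x| ^ 4) (inputLaw T P)) :
    simFourthMoment T f P ≤ 16 * perf T (fun x => |f x| ^ 4) P := by
  have hint : Integrable f (inputLaw T P) :=
    Integrable.of_abs_pow hf.aestronglyMeasurable four_pos h4
  have he : Even 4 := by decide
  set c := perf T f P with hc
  have hc4 : c ^ 4 ≤ perf T (fun x => |f x| ^ 4) P := by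
    simp only [he.pow_abs] at h4 ⊢
    exact pow_integral_le he hint h4
  have hle : ∀ x, (f x - c) ^ 4 ≤ 8 * |f x| ^ 4 + 8 * c ^ 4 := fun x => by
    rw [he.pow_abs]
    generalize f x = a
    nlinarith [sq_nonneg (a ^ 2 - c ^ 2), sq_nonneg (a + c), sq_nonneg (a - c),
      sq_nonneg ((a + c) ^ 2), sq_nonneg (a * (a + c)), sq_nonneg (c * (a + c)),
      mul_nonneg (sq_nonneg (a + c)) (sq_nonneg (a - c)),
      mul_nonneg (sq_nonneg (a + c)) (sq_nonneg a), mul_nonneg (sq_nonneg (a + c)) (sq_nonneg c)]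
  unfold simFourthMoment
  rw [← hc]
  calc _ ≤ ∫ x, (8 * |f x| ^ 4 + 8 * c ^ 4) ∂(inputLaw T P) :=
        integral_mono_of_nonneg (ae_of_all _ fun x => he.pow_nonneg _)
          ((h4.const_mul 8).add (integrable_const _)) (ae_of_all _ hle)
    _ = 8 * perf T (fun x => |f x| ^ 4) P + 8 * c ^ 4 := by
        rw [integral_add (h4.const_mul 8) (integrable_const _), integral_const_mul]
        simp [perf]
    _ ≤ _ := by linarith

theorem integral_simFourthMoment_le (hf : Measurable f) (h : FiniteMoments T f P 4)
    (hn : ∀ i, 0 < n i) (A : Finset (Fin m)) :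
    ∫ x, simFourthMoment T f (partialResample A P x) ∂(inputLaw n P) ≤
      16 * patternMoment T f P 4 := by
  obtain ⟨h1, h2⟩ := integral_indexAverage_frozenMean_abs_pow_le hf h hn (coordsOf T A)
  have hm : Measurable fun y => |f y| ^ 4 := by fun_prop
  refine le_trans ?_ (mul_le_mul_of_nonneg_left h2 (by norm_num))
  rw [← integral_const_mul]
  refine integral_mono_of_nonneg (ae_of_all _ fun x => ?_) (h1.const_mul 16) ?_
  · exact integral_nonneg fun y => Even.pow_nonneg (by decide) _
  · filter_upwards [h.ae_integrable_blend hf] with x hx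
    have := isProbabilityMeasure_partialResample hn A P x
    rw [← perf_partialResample hn A hm fun J => hx _ J]
    exact simFourthMoment_le hf (integrable_inputLaw_partialResample hn A hm fun J => hx _ J)

/-! #### Influence functions at the empirical models -/

/-- A constant that only depends on the number of coordinates and on the order of the moment. -/
noncomputable def influenceConst (T : Fin m → ℕ) (i : Fin m) (r : ℕ) : ℝ :=
  2 ^ (r + 1) * ((T i : ℝ) ^ (r + 1) * expansionConst T r)

omit [∀ i, MeasurableSpace (S i)] in
theorem pick_setIndex (x : ∀ i, Fin (n i) → S i) (J : ∀ i, Fin (T i) → Fin (n i)) (i : Fin m)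
    (t : Fin (T i)) (j : Fin (n i)) :
    Function.update (pick x J) i (Function.update (pick x J i) t (x i j)) =
      pick x (setIndex ⟨i, t⟩ j J) := by
  funext i' t'
  by_cases hi : i' = i
  · subst hi
    by_cases ht : t' = t
    · subst ht; simp [pick, setIndex]
    · simp [pick, setIndex, ht]
  · simp [pick, setIndex, hi]

/-- Freezing `(i, t)` at the data point `j` restricts the index maps to those of the form
`setIndex`. Inversion over all coordinates minus inversion over `{(i, t)}` leaves the sets `B` that
contain some other coordinate, and such a coordinate still has to be matched. -/
theorem condMean_empirical_sub (hf : Measurable f) (hn : ∀ i, 0 < n i)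
    (x : ∀ i, Fin (n i) → S i) (i : Fin m) (t : Fin (T i)) (j : Fin (n i)) :
    condMean T f (fun i => empirical (x i)) i t (x i j) - condMean T f P i t (x i j) =
      ∑ B ∈ (Finset.univ : Finset (Σ i, Fin (T i))).powerset \ ({⟨i, t⟩} : Finset _).powerset,
        indexAverage T n fun J => interaction f P B (setIndex ⟨i, t⟩ j J) x := by
  have hm : Measurable fun w : ∀ i, Fin (T i) → S i =>
      f (Function.update w i (Function.update (w i) t (x i j))) := by
    refine hf.comp (measurable_pi_lambda _ fun i' => measurable_pi_lambda _ fun t' => ?_)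
    by_cases hi : i' = i
    · subst hi
      by_cases ht : t' = t
      · subst ht
        simp only [Function.update_self]
        fun_prop
      · simp only [Function.update_self, Function.update_of_ne ht]
        fun_prop
    · simp only [Function.update_of_ne hi]
      fun_prop
  have h1 : condMean T f (fun i => empirical (x i)) i t (x i j) =
      indexAverage T n fun J => f (pick x (setIndex ⟨i, t⟩ j J)) := by
    have := perf_empirical hn x hm
    simp only [pick_setIndex] at this
    exact this
  have h2 : condMean T f P i t (x i j) = indexAverage T n fun J =>
      frozenMean f P {⟨i, t⟩} (pick x (setIndex ⟨i, t⟩ j J)) := by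
    rw [← indexAverage_const (T := T) hn (condMean T f P i t (x i j))]
    congr 1
    funext J
    rw [← condMean_eq_frozenMean]
    congr 1
    simp [pick, setIndex]
  rw [h1, h2, ← indexAverage_sub, ← indexAverage_sum]
  congr 1
  funext J
  unfold interaction
  rw [Finset.sum_sdiff_eq_sub (Finset.powerset_mono.2 (Finset.subset_univ _)),
    sum_powerset_altSum, sum_powerset_altSum, frozenMean_univ]

/-- The empirical influence function, at a data point, converges in `r`-th mean. -/
theorem integral_influence_empirical_sub_pow_le (hf : Measurable f) (h : FiniteMoments T f P r)
    (hr : 0 < r) (hr' : Even r) (hL : 0 < L) (hLn : ∀ i, L ≤ n i) (i : Fin m) (j : Fin (n i)) :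
    Integrable (fun x => (influence T f (fun i => empirical (x i)) i (x i j) -
      influence T f P i (x i j)) ^ r) (inputLaw n P) ∧
    ∫ x, (influence T f (fun i => empirical (x i)) i (x i j) -
      influence T f P i (x i j)) ^ r ∂(inputLaw n P) ≤
      influenceConst T i r * patternMoment T f P r / L := by
  have hn : ∀ i, 0 < n i := fun i => hL.trans_le (hLn i)
  set ν := inputLaw n P
  -- The increment has `2 * T i` summands: `T i` conditional means, and `T i` copies of the centring
  -- term.
  let a : Fin (T i) ⊕ Fin (T i) → (∀ i, Fin (n i) → S i) → ℝ := Sum.elim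
    (fun t x => condMean T f (fun i => empirical (x i)) i t (x i j) - condMean T f P i t (x i j))
    (fun _ x => -(perf T f (partialResample Finset.univ P x) - perf T f P))
  have hsum : ∀ x : ∀ i, Fin (n i) → S i, influence T f (fun i => empirical (x i)) i (x i j) -
      influence T f P i (x i j) = ∑ o, a o x := by
    intro x
    simp only [Fintype.sum_sum_type, a, Sum.elim_inl, Sum.elim_inr, influence,
      Finset.sum_sub_distrib, Finset.sum_const, Finset.card_univ, Fintype.card_fin,
      nsmul_eq_mul, partialResample_univ]
    ring
  have hperf : Measurable fun x : ∀ i, Fin (n i) → S i =>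
      perf T f (partialResample Finset.univ P x) := by
    have : ∀ x : ∀ i, Fin (n i) → S i, perf T f (partialResample Finset.univ P x) =
        indexAverage T n fun J => f (pick x J) := fun x => by
      rw [partialResample_univ, perf_empirical hn x hf]
    simp_rw [this]
    exact measurable_indexAverage fun J => by fun_prop
  have hinl : ∀ t : Fin (T i), a (Sum.inl t) = fun x =>
      ∑ B ∈ (Finset.univ : Finset (Σ i, Fin (T i))).powerset \ ({⟨i, t⟩} : Finset _).powerset,
        indexAverage T n fun J => interaction f P B (setIndex ⟨i, t⟩ j J) x := fun t => by
    funext x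
    exact condMean_empirical_sub hf hn x i t j
  have hbound : ∀ o, Measurable (a o) ∧ Integrable (fun x => a o x ^ r) ν ∧
      ∫ x, a o x ^ r ∂ν ≤ expansionConst T r * (patternMoment T f P r / L) := by
    rintro (t | t)
    · rw [hinl]
      refine ⟨?_, integral_sum_indexAverage_setIndex_pow_le hf h hr hr' hL hLn ⟨i, t⟩ j _
        fun B hB => ?_⟩
      · exact Finset.measurable_fun_sum _ fun B _ =>
          measurable_indexAverage fun J => measurable_interaction hf B _
      · simp only [Finset.mem_sdiff, Finset.mem_powerset] at hB
        obtain ⟨l, hl, hlk⟩ := Finset.not_subset.1 hB.2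
        exact ⟨l, hl, by simpa using hlk⟩
    · have := integral_perf_partialResample_sub_pow_le hf h hr hr' hL hLn Finset.univ
      simp only [a, Sum.elim_inr, hr'.neg_pow]
      refine ⟨(hperf.sub_const _).neg, this.1, this.2.trans (le_of_eq (mul_div_assoc _ _ _))⟩
  simp_rw [hsum]
  obtain ⟨h1, h2⟩ := integral_sum_pow_le (μ := ν) hr hr' (s := Finset.univ) (a := a)
    (fun o _ => (hbound o).1) (fun o _ => (hbound o).2.1) (fun o _ => (hbound o).2.2)
  refine ⟨h1, h2.trans (le_of_eq ?_)⟩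
  rw [influenceConst]
  simp only [Finset.card_univ, Fintype.card_sum, Fintype.card_fin]
  push_cast
  rw [← two_mul, mul_pow]
  ring

/-! #### Moments at the empirical models -/

theorem finiteMoments_empirical (hf : Measurable f) (hn : ∀ i, 0 < n i)
    (x : ∀ i, Fin (n i) → S i) : FiniteMoments T f (fun i => empirical (x i)) r :=
  fun I _ => integrable_inputLaw_empirical hn x (by fun_prop)

theorem patternMoment_empirical (hf : Measurable f) (hn : ∀ i, 0 < n i)
    (x : ∀ i, Fin (n i) → S i) :
    patternMoment T f (fun i => empirical (x i)) r =
      ∑ I : ∀ i, Fin (T i) → Fin (T i), indexAverage T n fun J =>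
        |f (pick x fun i t => J i (I i t))| ^ r := by
  unfold patternMoment
  refine Finset.sum_congr rfl fun I _ => ?_
  have hm : Measurable fun y : ∀ i, Fin (T i) → S i => |f (pick y I)| ^ r := by fun_prop
  exact perf_empirical hn x hm

/-- An index map composed with a pattern is again an index map, so every term of the average has
mean at most `patternMoment T f P r`. Moment control thus passes to the empirical laws. -/
theorem integral_patternMoment_empirical_le (hf : Measurable f) (h : FiniteMoments T f P r)
    (hn : ∀ i, 0 < n i) :
    Measurable (fun x : ∀ i, Fin (n i) → S i =>
      patternMoment T f (fun i => empirical (x i)) r) ∧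
    Integrable (fun x => patternMoment T f (fun i => empirical (x i)) r) (inputLaw n P) ∧
    ∫ x, patternMoment T f (fun i => empirical (x i)) r ∂(inputLaw n P) ≤
      Fintype.card (∀ i, Fin (T i) → Fin (T i)) * patternMoment T f P r := by
  simp_rw [patternMoment_empirical hf hn]
  have hi : ∀ (I : ∀ i, Fin (T i) → Fin (T i)) (J : ∀ i, Fin (T i) → Fin (n i)),
      Integrable (fun x => |f (pick x fun i t => J i (I i t))| ^ r) (inputLaw n P) :=
    fun I J => h.integrable_pick hf (κ := fun i => Fin (n i)) fun i t => J i (I i t)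
  have ha : ∀ (I : ∀ i, Fin (T i) → Fin (T i)),
      Integrable (fun x => indexAverage T n fun J : ∀ i, Fin (T i) → Fin (n i) =>
        |f (pick x fun i t => J i (I i t))| ^ r) (inputLaw n P) :=
    fun I => (integrable_finsetSum _ fun J _ => hi I J).const_mul _
  refine ⟨?_, integrable_finsetSum _ fun I _ => ha I, ?_⟩
  · exact Finset.measurable_fun_sum _ fun I _ => measurable_indexAverage fun J => by fun_prop
  · rw [integral_finsetSum _ fun I _ => ha I, ← nsmul_eq_mul, ← Finset.card_univ,
      ← Finset.sum_const]
    refine Finset.sum_le_sum fun I _ => ?_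
    unfold indexAverage
    rw [integral_const_mul, integral_finsetSum _ fun J _ => hi I J]
    calc _ ≤ (Fintype.card (∀ i, Fin (T i) → Fin (n i)) : ℝ)⁻¹ *
          ∑ _J : ∀ i, Fin (T i) → Fin (n i), patternMoment T f P r := by
          gcongr with J
          exact integral_pick_le hf (κ := fun i => Fin (n i)) fun i t => J i (I i t)
      _ = _ := indexAverage_const hn _

end Bounds

/-! ### Asymptotics -/

section Asymptotics

/-- Markov's inequality through a dominating function `G`, which spares any measurability of `A N`.
-/
theorem tendstoInMeasure_of_pow_le {Ω : Type*} [MeasurableSpace Ω] {μ : Measure Ω}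
    [IsFiniteMeasure μ] {A G : ℕ → Ω → ℝ} {a : ℝ} {b : ℕ → ℝ} (p : ℕ)
    (hAG : ∀ᶠ N in atTop, ∀ᵐ ω ∂μ, |A N ω - a| ^ p ≤ G N ω)
    (hG : ∀ᶠ N in atTop, Integrable (G N) μ) (hb : ∀ᶠ N in atTop, ∫ ω, G N ω ∂μ ≤ b N)
    (hb0 : Tendsto b atTop (𝓝 0)) : TendstoInMeasure μ A atTop fun _ => a := by
  rw [tendstoInMeasure_iff_measureReal_norm]
  intro ε hε
  have hεp : 0 < ε ^ p := pow_pos hε p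
  refine squeeze_zero' (Eventually.of_forall fun N => measureReal_nonneg) ?_
    (by simpa using hb0.div_const (ε ^ p))
  filter_upwards [hAG, hG, hb] with N h1 h2 h3
  rw [le_div_iff₀ hεp, mul_comm]
  have h0 : 0 ≤ᵐ[μ] G N := by
    filter_upwards [h1] with ω hω using (pow_nonneg (abs_nonneg _) _).trans hω
  refine le_trans ?_ ((mul_meas_ge_le_integral_of_nonneg h0 h2 (ε ^ p)).trans h3)
  gcongr ε ^ p * ?_
  refine ENNReal.toReal_mono (measure_ne_top _ _) (measure_mono_ae ?_)
  filter_upwards [h1] with ω hω hε'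
  exact (pow_le_pow_left₀ hε.le hε' p).trans hω

variable {m : ℕ}

/-- Balanced sizes are bounded below by a sequence of the order of their average. -/
theorem Balanced.exists_lower {n : ℕ → Fin m → ℕ} (hn : Balanced n) :
    ∃ (L : ℕ → ℕ) (c : ℝ), Tendsto L atTop atTop ∧ 0 ≤ c ∧
      ∀ᶠ N in atTop, (∀ i, L N ≤ n N i) ∧ avgSize (n N) ≤ c * L N := by
  rcases Nat.eq_zero_or_pos m with rfl | hm
  -- Without models the average is `0 / 0 = 0`, and any diverging sequence serves as `L`.
  · exact ⟨id, 0, tendsto_id, le_rfl, Eventually.of_forall fun N =>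
      ⟨fun i => i.elim0, by simp [avgSize]⟩⟩
  have : Nonempty (Fin m) := ⟨⟨0, hm⟩⟩
  obtain ⟨h1, c, hc, h2⟩ := hn
  refine ⟨fun N => Finset.univ.inf' Finset.univ_nonempty (n N), c, ?_, hc.le, ?_⟩
  · rw [tendsto_atTop]
    intro K
    filter_upwards [eventually_all.2 fun i => tendsto_atTop.1 (h1 i) K] with N hN
    exact (Finset.le_inf'_iff _ _).2 fun i _ => hN i
  · filter_upwards [h2] with N hN
    refine ⟨fun i => Finset.inf'_le _ (Finset.mem_univ i), ?_⟩
    obtain ⟨i, -, hi⟩ := Finset.exists_mem_eq_inf' Finset.univ_nonempty (n N)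
    rw [hi, avgSize, div_le_iff₀ (Nat.cast_pos.2 hm)]
    calc ∑ j, (n N j : ℝ) ≤ ∑ _j : Fin m, c * n N i := Finset.sum_le_sum fun j _ => hN j i
      _ = _ := by simp [mul_comm]

variable {S : Fin m → Type*} [∀ i, MeasurableSpace (S i)] {T : Fin m → ℕ}
  {Ω : Type*} [MeasurableSpace Ω] {μ : Measure Ω} [IsProbabilityMeasure μ]
  {F : ∀ i, Measure (S i)} [∀ i, IsProbabilityMeasure (F i)] {X : ∀ i, ℕ → Ω → S i}
  {f : (∀ i, Fin (T i) → S i) → ℝ}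

omit [IsProbabilityMeasure μ] in
theorem IsInputData.integral_comp (hX : IsInputData μ F X) {k : Fin m → ℕ}
    {g : (∀ i, Fin (k i) → S i) → ℝ} (hg : Integrable g (inputLaw k F)) :
    Integrable (fun ω => g fun i (j : Fin (k i)) => X i j ω) μ ∧
      ∫ ω, g (fun i (j : Fin (k i)) => X i j ω) ∂μ = ∫ x, g x ∂(inputLaw k F) := by
  have h := hX.map_eq k
  rw [← h.map_eq] at hg ⊢
  exact ⟨hg.comp_measurable h.measurable,
    (integral_map h.measurable.aemeasurable hg.aestronglyMeasurable).symm⟩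

omit [IsProbabilityMeasure μ] in
/-- The moments at the empirical models are bounded in mean. -/
theorem IsInputData.integral_patternMoment_le (hX : IsInputData μ F X) (hf : Measurable f)
    {r : ℕ} (h : FiniteMoments T f F r) {k : Fin m → ℕ} (hk : ∀ i, 0 < k i) :
    Integrable (fun ω => patternMoment T f (empiricalInputs X k ω) r) μ ∧
      ∫ ω, patternMoment T f (empiricalInputs X k ω) r ∂μ ≤
        Fintype.card (∀ i, Fin (T i) → Fin (T i)) * patternMoment T f F r := by
  obtain ⟨-, h1, h2⟩ := integral_patternMoment_empirical_le (n := k) hf h hk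
  have := hX.integral_comp h1
  exact ⟨this.1, this.2.trans_le h2⟩

theorem tendsto_const_div_natCast {L : ℕ → ℕ} (hL : Tendsto L atTop atTop) (c : ℝ) :
    Tendsto (fun N => c / (L N : ℝ)) atTop (𝓝 0) :=
  (tendsto_const_div_atTop_nhds_zero_nat c).comp hL

/-- At a random coordinate the conditional mean is a frozen mean, that is, a conditional expectation
of `f`; Jensen's inequality passes the fourth moment on. -/
theorem memLp_condMean (hf : Measurable f) (h : FiniteMoments T f F 4) (i : Fin m)
    (t : Fin (T i)) : MemLp (condMean T f F i t) 4 (F i) := by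
  have he := measurePreserving_inputLaw_eval F i t
  have hc := measurable_condMean (P := F) hf i t
  have hm := measurable_frozenMean (P := F) hf {⟨i, t⟩}
  have hb := measurePreserving_blend_mixedLaw (P := F) (Q := F) ({⟨i, t⟩} : Finset (Σ i, Fin (T i)))
  rw [mixedLaw_self] at hb
  have h4 : Integrable (fun x => |f x| ^ 4) (inputLaw T F) := h (fun _ t => t) fun _ _ => le_rfl
  have hf4 : Measurable fun x => |f x| ^ 4 := by fun_prop
  rw [← he.map_eq, memLp_map_measure_iff hc.aestronglyMeasurable he.measurable.aemeasurable]
  have e : condMean T f F i t ∘ (fun w : ∀ i, Fin (T i) → S i => w i t) =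
      frozenMean f F {⟨i, t⟩} := funext fun u => condMean_eq_frozenMean f F i t u
  rw [e, ← integrable_norm_rpow_iff hm.aestronglyMeasurable (by norm_num) (by norm_num)]
  have hprod : Integrable (fun q : (∀ i, Fin (T i) → S i) × (∀ i, Fin (T i) → S i) =>
      |f (blend {⟨i, t⟩} q.1 q.2)| ^ 4) ((inputLaw T F).prod (inputLaw T F)) := by
    rw [← hb.map_eq] at h4
    exact h4.comp_measurable hb.measurable
  refine hprod.integral_prod_left.mono' (hm.norm.pow_const _).aestronglyMeasurable ?_
  filter_upwards [hprod.prod_right_ae] with u hu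
  have hev : Even 4 := by decide
  have hfu : Measurable fun w => f (blend {⟨i, t⟩} u w) := hf.comp (measurable_blend_right _ _)
  have h1 := Integrable.of_abs_pow hfu.aestronglyMeasurable four_pos hu
  simp only [hev.pow_abs] at hu ⊢
  have e4 : ‖frozenMean f F {⟨i, t⟩} u‖ ^ (4 : ℝ≥0∞).toReal = frozenMean f F {⟨i, t⟩} u ^ 4 := by
    rw [show (4 : ℝ≥0∞).toReal = ((4 : ℕ) : ℝ) by norm_num, Real.rpow_natCast, Real.norm_eq_abs,
      hev.pow_abs]
  rw [e4, Real.norm_of_nonneg (hev.pow_nonneg _)]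
  exact pow_integral_le hev h1 hu

/-- The influence function differs from the sum of conditional means by a constant, so the variances
agree. -/
theorem variance_influence_pos (hf : Measurable f) (h : FiniteMoments T f F 4)
    (hvar : NondegenerateInfluence T f F) (i : Fin m) :
    0 < variance (influence T f F i) (F i) ∧ MemLp (influence T f F i) 4 (F i) := by
  have hc : MemLp (fun z => ∑ t, condMean T f F i t z) 4 (F i) :=
    memLp_finsetSum _ fun t _ => memLp_condMean hf h i t
  have hg : MemLp (influence T f F i) 4 (F i) := hc.sub (memLp_const _)
  refine ⟨?_, hg⟩
  have hint : Integrable (fun z => ∑ t, condMean T f F i t z) (F i) :=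
    hc.integrable (by norm_num)
  have : evariance (influence T f F i) (F i) =
      evariance (fun z => ∑ t, condMean T f F i t z) (F i) := by
    unfold evariance influence
    rw [integral_sub hint (integrable_const _)]
    simp
  rw [variance, this]
  exact ENNReal.toReal_pos (hvar i).1.ne' (hvar i).2.ne

omit [IsProbabilityMeasure μ] in
theorem smoothAtTruth {n : ℕ → Fin m → ℕ} (hX : IsInputData μ F X) (hn : Balanced n)
    (hf : Measurable f) (hvar : NondegenerateInfluence T f F) (hmom : FiniteMoments T f F 4) :
    SmoothAtTruth μ F X n (perf T f) (influence T f) := by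
  obtain ⟨L, c, hL, hc, hLn⟩ := hn.exists_lower
  have key : ∀ᶠ N in atTop, (∀ i, L N ≤ n N i) ∧ 0 < L N ∧
      Integrable (fun ω => remainder (perf T f) (influence T f) F
        (empiricalInputs X (n N) ω) ^ 2) μ ∧
      ∫ ω, remainder (perf T f) (influence T f) F (empiricalInputs X (n N) ω) ^ 2 ∂μ ≤
        expansionConst T 2 * patternMoment T f F 2 / (L N : ℝ) ^ 2 := by
    filter_upwards [hLn, hL.eventually_gt_atTop 0] with N h1 h2
    obtain ⟨i1, b1⟩ := integral_remainder_pow_le hf (hmom.two_of_four hf) two_pos even_two h2 h1.1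
      Finset.univ
    simp only [partialResample_univ] at i1 b1
    have := hX.integral_comp i1
    exact ⟨h1.1, h2, this.1, this.2.trans_le b1⟩
  refine ⟨key.mono fun N h => h.2.2.1, ?_, variance_influence_pos hf hmom hvar⟩
  rcases Nat.eq_zero_or_pos m with rfl | hm
  -- For `m = 0` the comparison sequence is `0⁻¹ = 0`, so the remainder has to vanish identically;
  -- it does, as there is only one tuple of laws.
  · have : ∀ Q : ∀ i, Measure (S i), remainder (perf T f) (influence T f) F Q = 0 := fun Q => by
      rw [Subsingleton.elim Q F]
      simp [remainder]
    simp only [this]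
    simp
  set C := expansionConst T 2 * patternMoment T f F 2 with hC
  have hC0 : 0 ≤ C := mul_nonneg (expansionConst_nonneg T 2) (patternMoment_nonneg f F 2)
  rw [isLittleO_iff]
  intro ε hε
  filter_upwards [key, hLn, (tendsto_const_div_natCast hL (C * c)).eventually (gt_mem_nhds hε)]
    with N h1 h2 h3
  obtain ⟨hle, hpos, -, hb⟩ := h1
  have hLpos : (0 : ℝ) < L N := Nat.cast_pos.2 hpos
  have havg : 0 < avgSize (n N) := by
    refine div_pos (Finset.sum_pos (fun i _ => ?_) ⟨⟨0, hm⟩, Finset.mem_univ _⟩)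
      (Nat.cast_pos.2 hm)
    exact Nat.cast_pos.2 (hpos.trans_le (hle i))
  rw [Real.norm_of_nonneg (integral_nonneg fun _ => sq_nonneg _), norm_inv,
    Real.norm_of_nonneg havg.le]
  refine hb.trans ?_
  rw [← div_eq_mul_inv, le_div_iff₀ havg]
  calc C / (L N : ℝ) ^ 2 * avgSize (n N) ≤ C / (L N : ℝ) ^ 2 * (c * L N) := by
        gcongr
        exact h2.2
    _ = C * c / L N := by field_simp
    _ ≤ ε := h3.le

theorem smoothAtEmpirical {n s : ℕ → Fin m → ℕ} (hX : IsInputData μ F X) (hn : Balanced n)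
    (hs : Balanced s) (hf : Measurable f) (hmom : FiniteMoments T f F 4) :
    SmoothAtEmpirical μ F X n s (perf T f) (influence T f) := by
  obtain ⟨L, _, hL, _, hLn⟩ := hn.exists_lower
  obtain ⟨L', c', hL', hc', hLs⟩ := hs.exists_lower
  have hev : Even 4 := by decide
  refine ⟨fun i => ?_, fun A => ?_⟩
  · have key : ∀ᶠ N in atTop,
        Integrable (fun ω => (influence T f (empiricalInputs X (n N) ω) i (X i 0 ω) -
          influence T f F i (X i 0 ω)) ^ 4) μ ∧
        ∫ ω, (influence T f (empiricalInputs X (n N) ω) i (X i 0 ω) -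
          influence T f F i (X i 0 ω)) ^ 4 ∂μ ≤
          influenceConst T i 4 * patternMoment T f F 4 / L N := by
      filter_upwards [hLn, hL.eventually_gt_atTop 0] with N h1 h2
      obtain ⟨i1, b1⟩ := integral_influence_empirical_sub_pow_le hf hmom four_pos hev h2 h1.1 i
        ⟨0, h2.trans_le (h1.1 i)⟩
      have := hX.integral_comp i1
      exact ⟨this.1, this.2.trans_le b1⟩
    refine ⟨key.mono fun N h => h.1, ?_⟩
    exact squeeze_zero' (Eventually.of_forall fun N => integral_nonneg fun ω => hev.pow_nonneg _)
      (key.mono fun N h => h.2) (tendsto_const_div_natCast hL _)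
  · set C := expansionConst T 4 with hC
    have hC0 : 0 ≤ C := expansionConst_nonneg T 4
    set K := (Fintype.card (∀ i, Fin (T i) → Fin (T i)) : ℝ) * patternMoment T f F 4
    -- Conditionally on the data, the remainder bound holds with the empirical laws as `P`. Its rate
    -- `L'⁻⁴` against `s² ≤ (c' L')²` leaves `L'⁻²`, times a pattern moment of mean at most `K`.
    refine tendstoInMeasure_of_pow_le 1
      (G := fun N ω => C * c' ^ 2 / (L' N : ℝ) ^ 2 *
        patternMoment T f (empiricalInputs X (n N) ω) 4)
      (b := fun N => C * c' ^ 2 / (L' N : ℝ) ^ 2 * K) ?_ ?_ ?_ ?_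
    · filter_upwards [hLn, hL.eventually_gt_atTop 0, hLs, hL'.eventually_gt_atTop 0]
        with N h1 h2 h3 h4
      refine ae_of_all _ fun ω => ?_
      have hk : ∀ i, 0 < n N i := fun i => h2.trans_le (h1.1 i)
      have : ∀ i, IsProbabilityMeasure (empiricalInputs X (n N) ω i) := fun i =>
        isProbabilityMeasure_empirical (hk i) _
      obtain ⟨-, b1⟩ := integral_remainder_pow_le (P := empiricalInputs X (n N) ω) hf
        (finiteMoments_empirical hf hk _) four_pos hev h4 h3.1 A
      have h0 : 0 ≤ avgSize (s N) := by unfold avgSize; positivity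
      have hM := patternMoment_nonneg f (empiricalInputs X (n N) ω) 4
      have hL0 : (0 : ℝ) < L' N := Nat.cast_pos.2 h4
      rw [sub_zero, pow_one, div_inv_eq_mul, abs_of_nonneg (mul_nonneg
        (integral_nonneg fun _ => hev.pow_nonneg _) (sq_nonneg _))]
      calc _ ≤ C * patternMoment T f (empiricalInputs X (n N) ω) 4 / (L' N : ℝ) ^ 4 *
            (c' * L' N) ^ 2 := by
            refine mul_le_mul b1 (pow_le_pow_left₀ h0 h3.2 2) (sq_nonneg _) (by positivity)
        _ = _ := by field_simp
    · filter_upwards [hLn, hL.eventually_gt_atTop 0] with N h1 h2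
      exact (hX.integral_patternMoment_le hf hmom fun i => h2.trans_le (h1.1 i)).1.const_mul _
    · filter_upwards [hLn, hL.eventually_gt_atTop 0] with N h1 h2
      rw [integral_const_mul]
      have := (hX.integral_patternMoment_le hf hmom fun i => h2.trans_le (h1.1 i)).2
      gcongr
    · have h1 := (tendsto_const_div_natCast hL' (C * c' ^ 2)).mul
        (tendsto_const_div_natCast hL' K)
      rw [mul_zero] at h1
      refine h1.congr fun N => ?_
      ring

theorem empiricalVarianceConverges {n : ℕ → Fin m → ℕ} (hX : IsInputData μ F X)
    (hn : Balanced n) (hf : Measurable f) (hmom : FiniteMoments T f F 4) :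
    EmpiricalVarianceConverges μ F X n (simVariance T f) := by
  obtain ⟨L, _, hL, _, hLn⟩ := hn.exists_lower
  -- Stated for every `N` as an implication, so that the dominating functions can be chosen as one
  -- sequence.
  have key : ∀ N, ∃ G : Ω → ℝ, (∀ i, L N ≤ n N i) ∧ 0 < L N →
      Integrable G μ ∧ (∀ᵐ ω ∂μ, |simVariance T f (empiricalInputs X (n N) ω) -
        simVariance T f F| ^ 2 ≤ G ω) ∧
      ∫ ω, G ω ∂μ ≤ varianceConst T * patternMoment T f F 4 / L N := by
    intro N
    by_cases h : (∀ i, L N ≤ n N i) ∧ 0 < L N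
    · obtain ⟨G, i1, a1, b1⟩ := exists_simVariance_sub_sq_le hf hmom h.2 h.1 Finset.univ
      have := hX.integral_comp i1
      refine ⟨_, fun _ => ⟨this.1, ?_, this.2.trans_le b1⟩⟩
      have hq := (hX.map_eq (n N)).quasiMeasurePreserving.ae a1
      filter_upwards [hq] with ω hω
      rw [sq_abs]
      rwa [partialResample_univ] at hω
    · exact ⟨0, fun h' => absurd h' h⟩
  choose G hG using key
  have hev : ∀ᶠ N in atTop, (∀ i, L N ≤ n N i) ∧ 0 < L N := by
    filter_upwards [hLn, hL.eventually_gt_atTop 0] with N h1 h2 using ⟨h1.1, h2⟩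
  exact tendstoInMeasure_of_pow_le 2 (G := G) (hev.mono fun N h => (hG N h).2.1)
    (hev.mono fun N h => (hG N h).1) (hev.mono fun N h => (hG N h).2.2)
    (tendsto_const_div_natCast hL _)

theorem bootstrapVarianceConverges {n s : ℕ → Fin m → ℕ} (hX : IsInputData μ F X)
    (hn : Balanced n) (hs : Balanced s) (hf : Measurable f) (hmom : FiniteMoments T f F 4) :
    BootstrapVarianceConverges μ X n s (simVariance T f) := by
  obtain ⟨L, _, hL, _, hLn⟩ := hn.exists_lower
  obtain ⟨L', _, hL', _, hLs⟩ := hs.exists_lower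
  intro A
  set C := varianceConst T with hC
  have hC0 : 0 ≤ C := varianceConst_nonneg T
  set K := (Fintype.card (∀ i, Fin (T i) → Fin (T i)) : ℝ) * patternMoment T f F 4
  refine tendstoInMeasure_of_pow_le 1
    (G := fun N ω => C / L' N * patternMoment T f (empiricalInputs X (n N) ω) 4)
    (b := fun N => C / L' N * K) ?_ ?_ ?_ ?_
  · filter_upwards [hLn, hL.eventually_gt_atTop 0, hLs, hL'.eventually_gt_atTop 0]
      with N h1 h2 h3 h4
    refine ae_of_all _ fun ω => ?_
    have hk : ∀ i, 0 < n N i := fun i => h2.trans_le (h1.1 i)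
    have : ∀ i, IsProbabilityMeasure (empiricalInputs X (n N) ω i) := fun i =>
      isProbabilityMeasure_empirical (hk i) _
    obtain ⟨G, i1, a1, b1⟩ := exists_simVariance_sub_sq_le (P := empiricalInputs X (n N) ω) hf
      (finiteMoments_empirical hf hk _) h4 h3.1 A
    rw [sub_zero, pow_one, div_one]
    refine (abs_of_nonneg (integral_nonneg fun _ => sq_nonneg _)).trans_le ?_
    calc _ ≤ _ := integral_mono_of_nonneg (ae_of_all _ fun _ => sq_nonneg _) i1 a1
      _ ≤ _ := b1
      _ = _ := by ring
  · filter_upwards [hLn, hL.eventually_gt_atTop 0] with N h1 h2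
    exact (hX.integral_patternMoment_le hf hmom fun i => h2.trans_le (h1.1 i)).1.const_mul _
  · filter_upwards [hLn, hL.eventually_gt_atTop 0] with N h1 h2
    rw [integral_const_mul]
    have := (hX.integral_patternMoment_le hf hmom fun i => h2.trans_le (h1.1 i)).2
    gcongr
  · simpa using (tendsto_const_div_natCast hL' C).mul_const K

theorem fourthMomentBounded {n s : ℕ → Fin m → ℕ} (hX : IsInputData μ F X)
    (hn : Balanced n) (hs : Balanced s) (hf : Measurable f) (hmom : FiniteMoments T f F 4) :
    FourthMomentBounded μ X n s (simFourthMoment T f) := by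
  obtain ⟨L, _, hL, _, hLn⟩ := hn.exists_lower
  obtain ⟨L', _, hL', _, hLs⟩ := hs.exists_lower
  intro A ε hε
  set K := 16 * ((Fintype.card (∀ i, Fin (T i) → Fin (T i)) : ℝ) * patternMoment T f F 4)
    with hK
  have hK0 : 0 ≤ K := by
    have := patternMoment_nonneg f F 4
    positivity
  -- Markov's inequality then gives the exceptional probability `ε K / (K + 1) < ε`; the `+ 1` also
  -- keeps the bound positive when `K = 0`.
  refine ⟨(K + 1) / ε, by positivity, ?_⟩
  filter_upwards [hLn, hL.eventually_gt_atTop 0, hLs, hL'.eventually_gt_atTop 0]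
    with N h1 h2 h3 h4
  have hk : ∀ i, 0 < n N i := fun i => h2.trans_le (h1.1 i)
  have hsk : ∀ i, 0 < s N i := fun i => h4.trans_le (h3.1 i)
  set M := (K + 1) / ε with hM
  have hM0 : 0 < M := by positivity
  set G : Ω → ℝ := fun ω => 16 * patternMoment T f (empiricalInputs X (n N) ω) 4 with hG
  obtain ⟨i1, b1⟩ := hX.integral_patternMoment_le hf hmom hk
  have hGi : Integrable G μ := i1.const_mul 16
  have hGm : Measurable G := by
    have hm := (integral_patternMoment_empirical_le (P := F) (n := n N) hf hmom hk).1
    exact (hm.comp (hX.map_eq (n N)).measurable).const_mul 16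
  have hGb : ∫ ω, G ω ∂μ ≤ K := by
    rw [hG, integral_const_mul]
    linarith
  have hG0 : 0 ≤ G := fun ω => by
    have := patternMoment_nonneg f (empiricalInputs X (n N) ω) 4
    simp only [hG, Pi.zero_apply]
    positivity
  have hsub : {ω | M ≤ G ω}ᶜ ⊆ {ω | |resampleExp (s N) (empiricalInputs X (n N) ω) fun x =>
      simFourthMoment T f (partialResample A (empiricalInputs X (n N) ω) x)| ≤ M} := by
    intro ω hω
    have : ∀ i, IsProbabilityMeasure (empiricalInputs X (n N) ω i) := fun i =>
      isProbabilityMeasure_empirical (hk i) _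
    have hb := integral_simFourthMoment_le (P := empiricalInputs X (n N) ω) (n := s N) hf
      (finiteMoments_empirical hf hk _) hsk A
    have h0 : 0 ≤ resampleExp (s N) (empiricalInputs X (n N) ω) fun x =>
        simFourthMoment T f (partialResample A (empiricalInputs X (n N) ω) x) :=
      integral_nonneg fun x => integral_nonneg fun y => Even.pow_nonneg (by decide) _
    simp only [Set.mem_compl_iff, Set.mem_ofPred_eq, not_le] at hω ⊢
    rw [abs_of_nonneg h0]
    exact hb.trans hω.le
  refine lt_of_lt_of_le ?_ (measureReal_mono hsub)
  rw [probReal_compl_eq_one_sub (measurableSet_le measurable_const hGm)]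
  have hmk := (mul_meas_ge_le_integral_of_nonneg (ae_of_all μ hG0) hGi M).trans hGb
  have : μ.real {ω | M ≤ G ω} < ε := by
    have h5 : μ.real {ω | M ≤ G ω} ≤ K / M := by
      rw [le_div_iff₀ hM0, mul_comm]; exact hmk
    refine h5.trans_lt ?_
    rw [div_lt_iff₀ hM0, hM, mul_div_cancel₀ _ hε.ne']
    linarith
  linarith

end Asymptotics

/-! ### First order differentiability -/

section Differentiability

theorem isProbabilityMeasure_of_mem_hullWithDiracs {S : Type*} [TopologicalSpace S]
    [MeasurableSpace S] {F P : Measure S} [IsProbabilityMeasure F] (hP : P ∈ hullWithDiracs F) :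
    IsProbabilityMeasure P := by
  obtain ⟨l, w₀, w, x, -, hw, rfl⟩ := hP
  refine ⟨?_⟩
  simp only [Measure.add_apply, Measure.smul_apply, measure_univ, Measure.coe_finsetSum,
    Finset.sum_apply, ENNReal.smul_def, smul_eq_mul, mul_one]
  exact_mod_cast hw

theorem mix_half {S : Type*} [MeasurableSpace S] (P Q : Measure S) :
    mix P Q (1 / 2) = (1 / 2 : ℝ≥0) • P + (1 / 2 : ℝ≥0) • Q := by
  have : ENNReal.ofReal (1 / 2) = ((1 / 2 : ℝ≥0) : ℝ≥0∞) := by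
    rw [ENNReal.ofReal]
    congr 1
    ext
    simp
  rw [mix, show (1 : ℝ) - 1 / 2 = 1 / 2 by norm_num, this]
  rfl

/-- The two lists of atoms are concatenated. The midpoint is enough, as it only serves to transfer
integrability. -/
theorem mix_half_mem_hullWithDiracs {S : Type*} [TopologicalSpace S]
    [MeasurableSpace S] {F P Q : Measure S} (hP : P ∈ hullWithDiracs F)
    (hQ : Q ∈ hullWithDiracs F) : mix P Q (1 / 2) ∈ hullWithDiracs F := by
  obtain ⟨l, w₀, w, x, hx, hw, rfl⟩ := hP
  obtain ⟨l', w₀', w', x', hx', hw', rfl⟩ := hQ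
  refine ⟨l + l', 1 / 2 * w₀ + 1 / 2 * w₀', Fin.append (fun k => 1 / 2 * w k) fun k => 1 / 2 * w' k,
    Fin.append x x', ?_, ?_, ?_⟩
  · intro k
    induction k using Fin.addCases with
    | left k => simpa using hx k
    | right k => simpa using hx' k
  · rw [Fin.sum_univ_add]
    simp only [Fin.append_left, Fin.append_right, ← Finset.mul_sum]
    calc 1 / 2 * w₀ + 1 / 2 * w₀' + (1 / 2 * ∑ k, w k + 1 / 2 * ∑ k, w' k) =
          1 / 2 * (w₀ + ∑ k, w k) + 1 / 2 * (w₀' + ∑ k, w' k) := by ring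
      _ = 1 := by rw [hw, hw']; ext; push_cast; norm_num
  · rw [mix_half, Fin.sum_univ_add]
    simp only [Fin.append_left, Fin.append_right, smul_add, Finset.smul_sum, mul_smul, add_smul]
    abel

variable {m : ℕ} {S : Fin m → Type*} [∀ i, MeasurableSpace (S i)] {T : Fin m → ℕ}
  {P Q : ∀ i, Measure (S i)} [∀ i, IsProbabilityMeasure (P i)]
  [∀ i, IsProbabilityMeasure (Q i)]

instance (C : Finset (Σ i, Fin (T i))) : IsProbabilityMeasure (mixedLaw C Q P) := by
  have : ∀ i t, IsProbabilityMeasure (if (⟨i, t⟩ : Σ i, Fin (T i)) ∈ C then Q i else P i) :=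
    fun i t => by split_ifs <;> infer_instance
  unfold mixedLaw
  infer_instance

theorem mixedLaw_boxes (C : Finset (Σ i, Fin (T i))) (s : ∀ i, Fin (T i) → Set (S i)) :
    mixedLaw C Q P {y | ∀ i k, y i k ∈ s i k} =
      (∏ k ∈ C, Q k.1 (s k.1 k.2)) * ∏ k ∈ Finset.univ \ C, P k.1 (s k.1 k.2) := by
  have : ∀ i t, IsProbabilityMeasure (if (⟨i, t⟩ : Σ i, Fin (T i)) ∈ C then Q i else P i) :=
    fun i t => by split_ifs <;> infer_instance
  have e : {y : ∀ i, Fin (T i) → S i | ∀ i k, y i k ∈ s i k} =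
      Set.univ.pi fun i => Set.univ.pi fun k => s i k := by
    ext y; simp [Set.mem_pi]
  rw [e, mixedLaw, Measure.pi_pi]
  simp_rw [Measure.pi_pi]
  rw [← Fintype.prod_sigma' fun i t => (if (⟨i, t⟩ : Σ i, Fin (T i)) ∈ C then Q i else P i) (s i t),
    ← Finset.prod_sdiff (Finset.subset_univ C), mul_comm]
  congr 1
  · exact Finset.prod_congr rfl fun k hk => by simp [hk]
  · exact Finset.prod_congr rfl fun k hk => by simp [(Finset.mem_sdiff.1 hk).2]

/-- Each coordinate chooses independently between `P` and `Q`; `C` collects those that choose `Q`.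
-/
theorem inputLaw_mix {v : Fin m → ℝ} :
    inputLaw T (fun i => mix (P i) (Q i) (v i)) =
      ∑ C ∈ (Finset.univ : Finset (Σ i, Fin (T i))).powerset,
        ((∏ k ∈ C, ENNReal.ofReal (v k.1)) *
          ∏ k ∈ Finset.univ \ C, ENNReal.ofReal (1 - v k.1)) • mixedLaw C Q P := by
  have hfin : ∀ i, IsFiniteMeasure (mix (P i) (Q i) (v i)) := fun i => by
    unfold mix
    have h1 := Measure.smul_finite (P i) (ENNReal.ofReal_ne_top (r := 1 - v i))
    have h2 := Measure.smul_finite (Q i) (ENNReal.ofReal_ne_top (r := v i))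
    infer_instance
  refine (pi_pi_eq_of_boxes (fun i (_ : Fin (T i)) => mix (P i) (Q i) (v i))
    fun s hs => ?_).symm
  simp only [Measure.coe_finsetSum, Finset.sum_apply, Measure.smul_apply, smul_eq_mul,
    mixedLaw_boxes, mix, Measure.add_apply]
  rw [← Fintype.prod_sigma' fun i t => ENNReal.ofReal (1 - v i) * P i (s i t) +
    ENNReal.ofReal (v i) * Q i (s i t)]
  simp_rw [add_comm (ENNReal.ofReal (1 - v _) * _)]
  rw [Finset.prod_add]
  refine Finset.sum_congr rfl fun C _ => ?_
  rw [Finset.prod_mul_distrib, Finset.prod_mul_distrib]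
  ring

/-- At the midpoint every `mixedLaw C Q P` enters the mixture with positive weight. This reaches
laws in which coordinates of one model differ, to which `PerfWellDefined` does not apply directly.
-/
theorem integrable_mixedLaw {f : (∀ i, Fin (T i) → S i) → ℝ}
    (h : Integrable f (inputLaw T fun i => mix (P i) (Q i) (1 / 2)))
    (C : Finset (Σ i, Fin (T i))) : Integrable f (mixedLaw C Q P) := by
  rw [inputLaw_mix (v := fun _ => 1 / 2), integrable_finsetSum_measure] at h
  have h0 : ENNReal.ofReal (1 / 2) ≠ 0 := by simp
  have h1 : ENNReal.ofReal (1 - 1 / 2) ≠ 0 := by norm_num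
  refine (integrable_smul_measure ?_ ?_).1 (h C (by simp))
  · exact mul_ne_zero (Finset.prod_ne_zero_iff.2 fun _ _ => h0)
      (Finset.prod_ne_zero_iff.2 fun _ _ => h1)
  · exact ENNReal.mul_ne_top (ENNReal.prod_ne_top fun _ _ => ENNReal.ofReal_ne_top)
      (ENNReal.prod_ne_top fun _ _ => ENNReal.ofReal_ne_top)

/-- The expansion at `v = 0` of a multilinear interpolation, in which all coordinates of a model
share one variable. -/
theorem perf_mix {f : (∀ i, Fin (T i) → S i) → ℝ} (h : ∀ C, Integrable f (mixedLaw C Q P))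
    {v : Fin m → ℝ} (hv : v ∈ Set.Icc (0 : Fin m → ℝ) 1) :
    perf T f (fun i => mix (P i) (Q i) (v i)) =
      ∑ B ∈ (Finset.univ : Finset (Σ i, Fin (T i))).powerset,
        (∏ k ∈ B, v k.1) * altSum (fun C => ∫ x, f x ∂(mixedLaw C Q P)) B := by
  rw [sum_powerset_prod_mul_altSum _ (fun k : Σ i, Fin (T i) => v k.1), perf, inputLaw_mix,
    integral_finsetSum_measure]
  · refine Finset.sum_congr rfl fun C _ => ?_
    rw [integral_smul_measure, smul_eq_mul, ENNReal.toReal_mul, ENNReal.toReal_prod,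
      ENNReal.toReal_prod]
    congr 2
    · exact Finset.prod_congr rfl fun k _ => ENNReal.toReal_ofReal (hv.1 k.1)
    · exact Finset.prod_congr rfl fun k _ => ENNReal.toReal_ofReal (sub_nonneg.2 (hv.2 k.1))
  · exact fun C _ => (h C).smul_measure
      (ENNReal.mul_ne_top (ENNReal.prod_ne_top fun _ _ => ENNReal.ofReal_ne_top)
        (ENNReal.prod_ne_top fun _ _ => ENNReal.ofReal_ne_top))

/-- Each factor is at most the Euclidean norm of `v`, and there are at least two of them. -/
theorem isLittleO_prod_sqrt_sum_sq (B : Finset (Σ i, Fin (T i))) (hB : 2 ≤ B.card) (c : ℝ)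
    (l : Filter (Fin m → ℝ)) (hl : l ≤ 𝓝 0) :
    (fun v : Fin m → ℝ => (∏ k ∈ B, v k.1) * c) =o[l] fun v => Real.sqrt (∑ i, v i ^ 2) := by
  have hle : ∀ v : Fin m → ℝ, ∀ i, |v i| ≤ Real.sqrt (∑ i, v i ^ 2) := fun v i =>
    Real.abs_le_sqrt (Finset.single_le_sum (f := fun i => v i ^ 2) (fun _ _ => sq_nonneg _)
      (Finset.mem_univ i))
  have h1 : (fun v : Fin m → ℝ => (∏ k ∈ B, v k.1) * c) =O[l]
      fun v => Real.sqrt (∑ i, v i ^ 2) ^ B.card := by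
    refine IsBigO.of_bound |c| (Eventually.of_forall fun v => ?_)
    rw [norm_mul, Real.norm_eq_abs, Real.norm_eq_abs, Real.norm_of_nonneg (by positivity),
      Finset.abs_prod, mul_comm]
    gcongr
    calc ∏ k ∈ B, |v k.1| ≤ ∏ _k ∈ B, Real.sqrt (∑ i, v i ^ 2) :=
          Finset.prod_le_prod (fun _ _ => abs_nonneg _) fun k _ => hle v k.1
      _ = _ := by simp
  have ht : Tendsto (fun v : Fin m → ℝ => Real.sqrt (∑ i, v i ^ 2)) l (𝓝 0) := by
    have hc : Continuous fun v : Fin m → ℝ => Real.sqrt (∑ i, v i ^ 2) := by fun_prop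
    have := hc.tendsto 0
    simp only [Pi.zero_apply, ne_eq, OfNat.ofNat_ne_zero, not_false_eq_true, zero_pow,
      Finset.sum_const_zero, Real.sqrt_zero] at this
    exact this.mono_left hl
  have h2 := (isLittleO_pow_id (𝕜 := ℝ) (n := B.card) (by omega)).comp_tendsto ht
  exact h1.trans_isLittleO h2

theorem firstOrderDifferentiable [∀ i, TopologicalSpace (S i)] {F : ∀ i, Measure (S i)}
    [∀ i, IsProbabilityMeasure (F i)] {f : (∀ i, Fin (T i) → S i) → ℝ} (hf : Measurable f)
    (h : PerfWellDefined T f F) :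
    FirstOrderDifferentiable F (perf T f) (influence T f) := by
  intro P Q hP hQ
  have := fun i => isProbabilityMeasure_of_mem_hullWithDiracs (hP i)
  have := fun i => isProbabilityMeasure_of_mem_hullWithDiracs (hQ i)
  have hint := fun C => integrable_mixedLaw (T := T)
    (h _ fun i => mix_half_mem_hullWithDiracs (hP i) (hQ i)) C
  have hgP := integrable_influence hf (h P hP)
  have hgQ := fun i => integrable_influence_of_mixedLaw (P := P) (Q := Q) (i := i) hf
    fun t => hint _
  refine ⟨fun i => ⟨(hgP i).1, (hgQ i).1, (hgP i).2⟩, ?_⟩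
  set φ : Finset (Σ i, Fin (T i)) → ℝ := fun C => ∫ x, f x ∂(mixedLaw C Q P) with hφ
  have hφ0 : φ ∅ = perf T f P := by simp only [hφ, mixedLaw_empty, perf]
  have hsum : IsLittleO (𝓝[Set.Icc 0 1] 0)
      (fun v : Fin m → ℝ => ∑ B ∈ (Finset.univ : Finset (Σ i, Fin (T i))).powerset with
        2 ≤ B.card, (∏ k ∈ B, v k.1) * altSum φ B)
      fun v => Real.sqrt (∑ i, v i ^ 2) :=
    IsLittleO.fun_sum fun B hB =>
      isLittleO_prod_sqrt_sum_sq B (Finset.mem_filter.1 hB).2 _ _ nhdsWithin_le_nhds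
  refine hsum.congr' ?_ EventuallyEq.rfl
  filter_upwards [self_mem_nhdsWithin] with v hv
  rw [perf_mix hint hv, ← hφ, sum_powerset_split, altSum_empty, hφ0]
  simp_rw [altSum_singleton, hφ0, (hgQ _).2, (hgP _).2, sub_zero, Finset.mul_sum,
    Fintype.sum_sigma, Finset.prod_singleton, Finset.prod_empty]
  ring

end Differentiability

end InputUncertainty

theorem theorem3 {m : ℕ} {S : Fin m → Type*}
    [∀ i, TopologicalSpace (S i)] [∀ i, PolishSpace (S i)]
    [∀ i, MeasurableSpace (S i)] [∀ i, BorelSpace (S i)]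
    {Ω : Type*} [MeasurableSpace Ω] (μ : Measure Ω) [IsProbabilityMeasure μ]
    (F : ∀ i, Measure (S i)) [∀ i, IsProbabilityMeasure (F i)]
    (X : ∀ i, ℕ → Ω → S i) (hX : IsInputData μ F X)
    (n s : ℕ → Fin m → ℕ) (hn : Balanced n) (hs : Balanced s)
    (T : Fin m → ℕ) (h : (∀ i, Fin (T i) → S i) → ℝ) (hmeas : Measurable h)
    (hvar : NondegenerateInfluence T h F) (hmom : FiniteMoments T h F 4) :
    (PerfWellDefined T h F →
      FirstOrderDifferentiable F (perf T h) (influence T h)) ∧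
    SmoothAtTruth μ F X n (perf T h) (influence T h) ∧
    SmoothAtEmpirical μ F X n s (perf T h) (influence T h) ∧
    EmpiricalVarianceConverges μ F X n (simVariance T h) ∧
    BootstrapVarianceConverges μ X n s (simVariance T h) ∧
    FourthMomentBounded μ X n s (simFourthMoment T h) := by
  exact ⟨firstOrderDifferentiable hmeas, smoothAtTruth hX hn hmeas hvar hmom,
    smoothAtEmpirical hX hn hs hmeas hmom, empiricalVarianceConverges hX hn hmeas hmom,
    bootstrapVarianceConverges hX hn hs hmeas hmom, fourthMomentBounded hX hn hs hmeas hmom⟩
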